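/- **Setting.** All functions are real-valued; $\hat u$ is the unitary Fourier transform on $\mathbb R$ and $\langle k\rangle=(1+k^2)^{1/2}$. Let $\dot H^{1/2},H_\star^{1/2}$ be the completions of $\mathcal S(\mathbb R)$, and $\dot H^{-1/2},H_\star^{-1/2}$ the completions of $\{u\in\mathcal S(\mathbb R):\hat u(0)=0\}$, with respect to the norms $(\int w|\hat u|^2\,dk)^{1/2}$ with weights $w=|k|,\ \langle k\rangle^{-1}k^2,\ |k|^{-1},\ \langle k\rangle k^{-2}$ respectively; $H^{\pm1/2}$ are the usual Sobolev spaces ($w=\langle k\rangle^{\pm1}$). Via the Fourier transform each of these is the weighted space of Hermitian-symmetric functions in $L^2(w\,dk)$, so that $H^{1/2}\subset\dot H^{1/2}\subset H^{1/2}_\star$ and $H^{-1/2}_\star\subset\dot H^{-1/2}\subset H^{-1/2}$. Define the Hilbert spaces $$X=\{\Phi\in(H_\star^{1/2})^2:\Phi_2-\Phi_1\in H^{1/2}\},\qquad Y=\{\Psi\in(H^{-1/2})^2:\Psi_2+\Psi_1\in H_\star^{-1/2}\},$$ $$\tilde X=\{\xi\in(H_\star^{1/2})^2:\xi_1+\xi_2\in\dot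 H^{1/2}\},\qquad \tilde Y=\{\zeta\in(\dot H^{-1/2})^2:\zeta_2-\zeta_1\in H_\star^{-1/2}\},$$ $$\breve X=\{\xi\in(\dot H^{1/2})^2:\xi_2-\xi_1\in H^{1/2}\},\qquad \breve Y=\{\zeta\in(H^{-1/2})^2:\zeta_1+\zeta_2\in\dot H^{-1/2}\},$$ each with squared norm the sum of the squared norms of the two components and of the indicated combination. The pairings $Y\times X$ and $\breve Y\times\breve X$ are $\langle\Psi,\Phi\rangle=\langle\Psi_2,\Phi_2-\Phi_1\rangle+\langle\Psi_2+\Psi_1,\Phi_1\rangle$. Let $\rho\in(0,1)$, $h_0\in(0,1)$ and let $\eta=(\underline\eta,\overline\eta)\in W$, that is, $\underline\eta,\overline\eta\in W^{1,\infty}(\mathbb R)$ with $1+\inf(\overline\eta-\underline\eta)>h_0$. Put $\underline\Sigma=\{y<\underline\eta(x)\}$ and $\overline\Sigma=\{\underline\eta(x)<y<1+\overline\eta(x)\}$. For $\Omega=\underline\Sigma$ or $\overline\Sigma$ let $\dot H^1(\Omega)$ be the completion of the Schwartz class $\mathcal S(\overline\Omega)$ (smooth functions with rapidly decaying derivatives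 on $\overline\Omega$) under $\|\nabla u\|_{L^2(\Omega)}$; traces $u|_{y=\underline\eta}\in\dot H^{1/2}$ and $(u|_{y=\underline\eta},u|_{y=1+\overline\eta})\in X$, respectively, are defined as limits of traces of functions in $\mathcal S(\overline\Omega)$. The Dirichlet–Neumann operators $\underline G(\underline\eta):\dot H^{1/2}\to\dot H^{-1/2}$ and $\overline G(\eta):X\to Y$ are the bounded operators with $\langle G\Phi,\Phi'\rangle=\int\nabla\phi\cdot\nabla\phi'\,dx\,dy$ over the corresponding domain, where $\phi,\phi'$ are the unique elements of $\dot H^1$ with traces $\Phi,\Phi'$ that are weakly harmonic, i.e. whose gradients are $L^2$-orthogonal to $\nabla\psi$ for every $\psi\in\dot H^1$ with zero trace. Let $\underline N=\underline G^{-1}$, $\overline N=\overline G^{-1}$. Let $\overline G_{ij}:H^{1/2}\to H^{-1/2}$ be the entries of $\overline G$ on $(H^{1/2})^2\subset X$, and let $B=\overline G_{11}+\rho\underline G:H^{1/2}\to H^{-1/2}$. Let $G(\eta):\tilde X\to\tilde Y$ be the bounded extension of $$\begin{pmatrix}\underline G B^{-1}\overline G_{11}&-\underline G B^{-1}\overline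 G_{12}\\ -\overline G_{21}B^{-1}\underline G&\tfrac1\rho\overline G_{22}-\tfrac1\rho\overline G_{21}B^{-1}\overline G_{12}\end{pmatrix}$$ from $(H^{1/2})^2$ to $\tilde X$, and let $N(\eta):\tilde Y\to\tilde X$ be $$N(\eta)=\begin{pmatrix}\rho\overline N_{11}+\underline N&-\rho\overline N_{12}\\-\rho\overline N_{21}&\rho\overline N_{22}\end{pmatrix},$$ where $\overline N_{i1}\zeta_1-\overline N_{i2}\zeta_2$ denotes the $i$-th component of $\overline N(\zeta_1,-\zeta_2)$, with $(\zeta_1,-\zeta_2)\in Y$. **Statement.** The operators above are well defined: $\underline G(\underline\eta)$ and $\overline G(\eta)$ exist, are unique and are isomorphisms, $B$ is an isomorphism, and the bounded extension $G(\eta):\tilde X\to\tilde Y$ exists and is unique. Moreover: 1. $G(\eta):\tilde X\to\tilde Y$ is invertible with bounded inverse $G(\eta)^{-1}=N(\eta)$. 2. $K(\eta)=-\partial_xN(\eta)\partial_x$ defines an isomorphism $\breve X\to\breve Y$, and there is a constant $c>0$ such that $\langle K(\eta)\xi,\xi\rangle_{\breve Y\times\breve X}\ge c\|\xi\|_{\breve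 X}^2$ for all $\xi\in\breve X$. -/

import Mathlib

open MeasureTheory Filter Topology

noncomputable section

namespace TwoLayer

/-! ## Weighted spaces of Fourier transforms

Every Sobolev space on the line is realised through the (unitary) Fourier transform: a space
with norm `(∫ w(k) |û(k)|² dk)^(1/2)` is the weighted `L²` space of the transforms `û`.  For each
of the six weights below this weighted `L²` space is the completion, under that norm, of the
transforms of the real-valued Schwartz functions (those with `û(0) = 0` where `w` is not
integrable at `0`).  All spaces lie in one ambient space, so inclusions between them are literal. -/

/-- Complex measurable functions of the frequency `k`, modulo null sets. -/
abbrev FreqFun := ℝ →ₘ[volume] ℂ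

/-- A measurable weight that is positive away from the origin. -/
structure Weight where
  toFun : ℝ → ℝ
  meas : Measurable toFun
  pos : ∀ k, k ≠ 0 → 0 < toFun k

instance : CoeFun Weight (fun _ => ℝ → ℝ) := ⟨Weight.toFun⟩

/-- The Japanese bracket `(1 + k²)^(1/2)`. -/
def bracket (k : ℝ) : ℝ := √(1 + k ^ 2)

theorem bracket_pos (k : ℝ) : 0 < bracket k := Real.sqrt_pos.2 (by positivity)

theorem abs_le_bracket (k : ℝ) : |k| ≤ bracket k := by
  rw [← Real.sqrt_sq_eq_abs]
  exact Real.sqrt_le_sqrt (by linarith)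

theorem measurable_bracket : Measurable bracket := by
  unfold bracket
  fun_prop

/-- Weight of `Ḣ^{1/2}`. -/
def wDotHalf : Weight where
  toFun k := |k|
  meas := by fun_prop
  pos k hk := abs_pos.2 hk

/-- Weight of `Ḣ^{-1/2}`. -/
def wDotNegHalf : Weight where
  toFun k := |k|⁻¹
  meas := by fun_prop
  pos k hk := inv_pos.2 (abs_pos.2 hk)

/-- Weight of `H_⋆^{1/2}`. -/
def wStarHalf : Weight where
  toFun k := (bracket k)⁻¹ * k ^ 2
  meas := by have := measurable_bracket; fun_prop
  pos k hk := by have := bracket_pos k; positivity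

/-- Weight of `H_⋆^{-1/2}`. -/
def wStarNegHalf : Weight where
  toFun k := bracket k * (k ^ 2)⁻¹
  meas := by have := measurable_bracket; fun_prop
  pos k hk := by have := bracket_pos k; positivity

/-- Weight of `H^{1/2}`. -/
def wHalf : Weight where
  toFun k := bracket k
  meas := measurable_bracket
  pos k _ := bracket_pos k

/-- Weight of `H^{-1/2}`. -/
def wNegHalf : Weight where
  toFun k := (bracket k)⁻¹
  meas := by have := measurable_bracket; fun_prop
  pos k _ := inv_pos.2 (bracket_pos k)

theorem ae_ne_zero : ∀ᵐ k : ℝ, k ≠ 0 := by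
  simp [ae_iff]

theorem Weight.ae_pos (w : Weight) : ∀ᵐ k, 0 < w k := by
  filter_upwards [ae_ne_zero] with k hk using w.pos k hk

theorem negOne_smul (x : FreqFun) : (-1 : ℝ) • x = -x := neg_one_smul ℝ x

/-- `f` is the Fourier transform of a real-valued object. -/
def IsHermitian (f : FreqFun) : Prop := ∀ᵐ k : ℝ, f (-k) = (starRingEnd ℂ) (f k)

theorem ae_neg {p : ℝ → Prop} (h : ∀ᵐ k : ℝ, p k) : ∀ᵐ k : ℝ, p (-k) :=
  (Measure.measurePreserving_neg (volume : Measure ℝ)).quasiMeasurePreserving.ae h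

theorem aesm_re (w : Weight) (f g : FreqFun) :
    AEStronglyMeasurable (fun k => w k * (f k * (starRingEnd ℂ) (g k)).re) volume := by
  have h1 : AEMeasurable (f : ℝ → ℂ) := f.aemeasurable
  have h2 : AEMeasurable (g : ℝ → ℂ) := g.aemeasurable
  have h3 : AEMeasurable (fun k => (starRingEnd ℂ) (g k)) :=
    Complex.continuous_conj.measurable.comp_aemeasurable h2
  exact (w.meas.aemeasurable.mul
    (Complex.measurable_re.comp_aemeasurable (h1.mul h3))).aestronglyMeasurable

theorem aesm_sq (w : Weight) (f : FreqFun) :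
    AEStronglyMeasurable (fun k => w k * ‖f k‖ ^ 2) volume :=
  (w.meas.aemeasurable.mul ((f.aemeasurable.norm).pow_const 2)).aestronglyMeasurable

/-- The real vector space of Hermitian-symmetric `f` with `∫ w |f|² < ∞`. -/
def Sob (w : Weight) : Submodule ℝ FreqFun where
  carrier := {f | IsHermitian f ∧ Integrable (fun k => w k * ‖f k‖ ^ 2)}
  zero_mem' := by
    have h0 : ∀ᵐ k : ℝ, (0 : FreqFun) k = 0 := AEEqFun.coeFn_zero
    refine ⟨?_, ?_⟩
    · filter_upwards [h0, ae_neg h0] with k h1 h2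
      rw [h1, h2, map_zero]
    · refine (integrable_zero ℝ ℝ volume).congr ?_
      filter_upwards [h0] with k h1
      simp [h1]
  add_mem' := by
    rintro a b ⟨ha, ha'⟩ ⟨hb, hb'⟩
    have h0 : ∀ᵐ k : ℝ, (a + b : FreqFun) k = a k + b k := AEEqFun.coeFn_add a b
    refine ⟨?_, ?_⟩
    · filter_upwards [h0, ae_neg h0, ha, hb] with k h1 h2 h3 h4
      rw [h1, h2, h3, h4, map_add]
    · refine ((ha'.const_mul 2).add (hb'.const_mul 2)).mono' (aesm_sq w (a + b)) ?_
      filter_upwards [h0, w.ae_pos] with k h1 h2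
      rw [Real.norm_of_nonneg (by positivity), h1]
      have h3 := norm_add_le (a k) (b k)
      have h4 : ‖a k + b k‖ ^ 2 ≤ 2 * ‖a k‖ ^ 2 + 2 * ‖b k‖ ^ 2 := by
        nlinarith [sq_nonneg (‖a k‖ - ‖b k‖), norm_nonneg (a k + b k)]
      show _ ≤ 2 * (w k * ‖a k‖ ^ 2) + 2 * (w k * ‖b k‖ ^ 2)
      nlinarith
  smul_mem' := by
    rintro c a ⟨ha, ha'⟩
    have h0 : ∀ᵐ k : ℝ, (c • a : FreqFun) k = c • a k := AEEqFun.coeFn_smul c a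
    refine ⟨?_, ?_⟩
    · filter_upwards [h0, ae_neg h0, ha] with k h1 h2 h3
      rw [h1, h2, h3]
      simp
    · refine (ha'.const_mul (c ^ 2)).congr ?_
      filter_upwards [h0] with k h1
      rw [h1, norm_smul, mul_pow, Real.norm_eq_abs, sq_abs]
      ring

theorem Sob.integrable_inner {w : Weight} (f g : Sob w) : Integrable
    (fun k => w k * ((f : FreqFun) k * (starRingEnd ℂ) ((g : FreqFun) k)).re) := by
  refine (f.2.2.add g.2.2).mono' (aesm_re w _ _) ?_
  filter_upwards [w.ae_pos] with k hk
  set a := (f : FreqFun) k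
  set b := (g : FreqFun) k
  have h1 : |(a * (starRingEnd ℂ) b).re| ≤ ‖a‖ * ‖b‖ := by
    refine (Complex.abs_re_le_norm _).trans ?_
    simp
  rw [norm_mul, Real.norm_of_nonneg hk.le, Real.norm_eq_abs]
  show _ ≤ w k * ‖a‖ ^ 2 + w k * ‖b‖ ^ 2
  have h2 : |(a * (starRingEnd ℂ) b).re| ≤ ‖a‖ ^ 2 + ‖b‖ ^ 2 := by
    nlinarith [sq_nonneg (‖a‖ - ‖b‖), sq_nonneg (‖a‖ + ‖b‖)]
  nlinarith

theorem mul_conj_re_self (z : ℂ) : (z * (starRingEnd ℂ) z).re = ‖z‖ ^ 2 := by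
  rw [Complex.mul_conj, Complex.ofReal_re, Complex.normSq_eq_norm_sq]

/-- The inner product `⟨f, g⟩ = ∫ w(k) f(k) conj(g(k)) dk` (real, by Hermitian symmetry). -/
@[reducible] def Sob.core (w : Weight) : InnerProductSpace.Core ℝ (Sob w) where
  inner f g := ∫ k, w k * ((f : FreqFun) k * (starRingEnd ℂ) ((g : FreqFun) k)).re
  conj_inner_symm f g := by
    simp only [conj_trivial]
    refine integral_congr_ae (Eventually.of_forall fun k => ?_)
    simp only [Complex.mul_re, Complex.conj_re, Complex.conj_im]
    ring
  re_inner_nonneg f := by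
    simp only [RCLike.re_to_real]
    refine integral_nonneg_of_ae ?_
    filter_upwards [w.ae_pos] with k hk
    rw [mul_conj_re_self]
    show (0 : ℝ) ≤ _
    positivity
  add_left f g h := by
    rw [← integral_add (Sob.integrable_inner f h) (Sob.integrable_inner g h)]
    refine integral_congr_ae ?_
    filter_upwards [AEEqFun.coeFn_add (f : FreqFun) (g : FreqFun)] with k hk
    have hk' : ((f + g : Sob w) : FreqFun) k = (f : FreqFun) k + (g : FreqFun) k := hk
    simp only [hk', add_mul, Complex.add_re, mul_add]
  smul_left f g c := by
    simp only [conj_trivial]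
    rw [← integral_const_mul]
    refine integral_congr_ae ?_
    filter_upwards [AEEqFun.coeFn_smul c (f : FreqFun)] with k hk
    have hk' : ((c • f : Sob w) : FreqFun) k = c • (f : FreqFun) k := hk
    simp only [hk', smul_mul_assoc, Complex.smul_re, smul_eq_mul]
    ring
  definite f hf := by
    have h0 : 0 ≤ᵐ[volume] fun k =>
        w k * ((f : FreqFun) k * (starRingEnd ℂ) ((f : FreqFun) k)).re := by
      filter_upwards [w.ae_pos] with k hk
      rw [mul_conj_re_self]
      show (0 : ℝ) ≤ _
      positivity
    have h1 := (integral_eq_zero_iff_of_nonneg_ae h0 (Sob.integrable_inner f f)).1 hf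
    refine Subtype.ext (AEEqFun.ext ?_)
    have h2 : ∀ᵐ k : ℝ, ((0 : Sob w) : FreqFun) k = 0 := AEEqFun.coeFn_zero
    filter_upwards [h1, w.ae_pos, h2] with k hk hw hz
    rw [hz]
    rw [mul_conj_re_self] at hk
    have hk' : w k * ‖(f : FreqFun) k‖ ^ 2 = 0 := hk
    have := (mul_eq_zero.1 hk').resolve_left hw.ne'
    simpa using this

instance (w : Weight) : NormedAddCommGroup (Sob w) :=
  @InnerProductSpace.Core.toNormedAddCommGroup ℝ (Sob w) _ _ _ (Sob.core w)

instance (w : Weight) : InnerProductSpace ℝ (Sob w) := InnerProductSpace.ofCore (Sob.core w).toCore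

theorem Sob.norm_sq {w : Weight} (f : Sob w) : ‖f‖ ^ 2 = ∫ k, w k * ‖(f : FreqFun) k‖ ^ 2 := by
  rw [← real_inner_self_eq_norm_sq]
  show ∫ k, w k * ((f : FreqFun) k * (starRingEnd ℂ) ((f : FreqFun) k)).re = _
  simp only [mul_conj_re_self]

/-- The inclusion between weighted spaces when the target weight is dominated by the source one. -/
def Sob.incl {v w : Weight} (h : ∀ k, k ≠ 0 → w k ≤ v k) : Sob v →L[ℝ] Sob w :=
  LinearMap.mkContinuous
    { toFun := fun f => ⟨f, f.2.1, by
        refine f.2.2.mono' (aesm_sq w _) ?_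
        filter_upwards [ae_ne_zero] with k hk
        have := w.pos k hk
        rw [Real.norm_of_nonneg (by positivity)]
        exact mul_le_mul_of_nonneg_right (h k hk) (by positivity)⟩
      map_add' := fun _ _ => rfl
      map_smul' := fun _ _ => rfl } 1 (by
    intro f
    rw [one_mul]
    refine le_of_sq_le_sq ?_ (norm_nonneg _)
    rw [Sob.norm_sq, Sob.norm_sq]
    refine integral_mono_of_nonneg ?_ f.2.2 ?_
    · filter_upwards [w.ae_pos] with k hk
      show (0 : ℝ) ≤ _
      positivity
    filter_upwards [ae_ne_zero] with k hk
    exact mul_le_mul_of_nonneg_right (h k hk) (by positivity))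

theorem Sob.incl_coe {v w : Weight} (h : ∀ k, k ≠ 0 → w k ≤ v k) (f : Sob v) :
    (Sob.incl h f : FreqFun) = f := rfl

/-- The Fourier symbol `ik` of `∂ₓ`. -/
def derivSymbol : FreqFun :=
  AEEqFun.mk (fun k : ℝ => Complex.I * (k : ℂ)) (by fun_prop)

theorem derivSymbol_mul (f : FreqFun) :
    ∀ᵐ k : ℝ, (derivSymbol * f) k = Complex.I * (k : ℂ) * f k := by
  filter_upwards [AEEqFun.coeFn_mul derivSymbol f,
    AEEqFun.coeFn_mk (fun k : ℝ => Complex.I * (k : ℂ)) (by fun_prop)] with k h1 h2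
  rw [h1, Pi.mul_apply, ← h2]
  rfl

/-- `∂ₓ`, as multiplication by `ik` on Fourier transforms. -/
def freqDeriv : FreqFun →ₗ[ℝ] FreqFun where
  toFun f := derivSymbol * f
  map_add' f g := by
    refine AEEqFun.ext ?_
    filter_upwards [derivSymbol_mul f, derivSymbol_mul g, derivSymbol_mul (f + g),
      AEEqFun.coeFn_add f g, AEEqFun.coeFn_add (derivSymbol * f) (derivSymbol * g)]
      with k h1 h2 h3 h4 h5
    rw [h3, h4, h5, Pi.add_apply, Pi.add_apply, h1, h2, mul_add]
  map_smul' c f := by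
    refine AEEqFun.ext ?_
    filter_upwards [derivSymbol_mul f, derivSymbol_mul (c • f), AEEqFun.coeFn_smul c f,
      AEEqFun.coeFn_smul c (derivSymbol * f)] with k h1 h2 h3 h4
    rw [h2, h3, RingHom.id_apply, h4, Pi.smul_apply, Pi.smul_apply, h1, mul_smul_comm]

/-- `∂ₓ` between weighted spaces whose weights satisfy `k² w = v`. -/
def Sob.deriv (v w : Weight) (h : ∀ k, k ≠ 0 → k ^ 2 * w k = v k) : Sob v →L[ℝ] Sob w :=
  have key2 : ∀ f : FreqFun, (fun k => w k * ‖(freqDeriv f) k‖ ^ 2)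
      =ᵐ[volume] fun k => v k * ‖f k‖ ^ 2 := by
    intro f
    filter_upwards [derivSymbol_mul f, ae_ne_zero] with k h1 hk
    have h1' : (freqDeriv f) k = Complex.I * (k : ℂ) * f k := h1
    rw [h1', ← h k hk]
    simp only [norm_mul, Complex.norm_I, Complex.norm_real, Real.norm_eq_abs, one_mul, mul_pow,
      sq_abs]
    ring
  LinearMap.mkContinuous
    { toFun := fun f => ⟨freqDeriv (f : FreqFun), by
        filter_upwards [derivSymbol_mul f, ae_neg (derivSymbol_mul f), f.2.1] with k h1 h2 h3
        show (derivSymbol * (f : FreqFun)) (-k) = (starRingEnd ℂ) ((derivSymbol * (f : FreqFun)) k)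
        rw [h1, h2, h3]
        simp, f.2.2.congr (key2 f).symm⟩
      map_add' := fun f g => Subtype.ext (map_add freqDeriv (f : FreqFun) (g : FreqFun))
      map_smul' := fun c f => Subtype.ext (map_smul freqDeriv c (f : FreqFun)) } 1 (by
    intro f
    rw [one_mul]
    refine le_of_sq_le_sq ?_ (norm_nonneg _)
    rw [Sob.norm_sq, Sob.norm_sq]
    exact (integral_congr_ae (key2 f)).le)

/-! ## Spaces of pairs -/

/-- Pairs `(a, b)` in `(Sob w)²` with `b + s a` in `Sob v`. -/
def PairSob (w : Weight) (s : ℝ) (v : Weight) : Submodule ℝ (FreqFun × FreqFun) where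
  carrier := {p | p.1 ∈ Sob w ∧ p.2 ∈ Sob w ∧ p.2 + s • p.1 ∈ Sob v}
  zero_mem' := ⟨(Sob w).zero_mem, (Sob w).zero_mem, by simp⟩
  add_mem' := by
    rintro p q ⟨h1, h2, h3⟩ ⟨h4, h5, h6⟩
    refine ⟨(Sob w).add_mem h1 h4, (Sob w).add_mem h2 h5, ?_⟩
    have := (Sob v).add_mem h3 h6
    have e : (p + q).2 + s • (p + q).1 = p.2 + s • p.1 + (q.2 + s • q.1) := by
      simp only [Prod.fst_add, Prod.snd_add, smul_add]
      abel
    rwa [e]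
  smul_mem' := by
    rintro c p ⟨h1, h2, h3⟩
    refine ⟨(Sob w).smul_mem c h1, (Sob w).smul_mem c h2, ?_⟩
    have := (Sob v).smul_mem c h3
    rwa [smul_add, smul_comm c s] at this

section Pair

variable {w v : Weight} {s : ℝ}

/-- First component, as a linear map. -/
def PairSob.fstₗ : PairSob w s v →ₗ[ℝ] Sob w where
  toFun p := ⟨p.1.1, p.2.1⟩
  map_add' _ _ := rfl
  map_smul' _ _ := rfl

/-- Second component, as a linear map. -/
def PairSob.sndₗ : PairSob w s v →ₗ[ℝ] Sob w where
  toFun p := ⟨p.1.2, p.2.2.1⟩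
  map_add' _ _ := rfl
  map_smul' _ _ := rfl

/-- The combination `(a, b) ↦ b + s a`, as a linear map. -/
def PairSob.combₗ : PairSob w s v →ₗ[ℝ] Sob v where
  toFun p := ⟨p.1.2 + s • p.1.1, p.2.2.2⟩
  map_add' p q := Subtype.ext (by
    show p.1.2 + q.1.2 + s • (p.1.1 + q.1.1) = p.1.2 + s • p.1.1 + (q.1.2 + s • q.1.1)
    rw [smul_add]
    abel)
  map_smul' c p := Subtype.ext (by
    show c • p.1.2 + s • c • p.1.1 = c • (p.1.2 + s • p.1.1)
    rw [smul_add, smul_comm c s])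

/-- The inner product `⟨a, a'⟩ + ⟨b, b'⟩ + ⟨b + s a, b' + s a'⟩`. -/
@[reducible] def PairSob.core (w : Weight) (s : ℝ) (v : Weight) :
    InnerProductSpace.Core ℝ (PairSob w s v) where
  inner p q := inner ℝ (PairSob.fstₗ p) (PairSob.fstₗ q) + inner ℝ (PairSob.sndₗ p) (PairSob.sndₗ q)
    + inner ℝ (PairSob.combₗ p) (PairSob.combₗ q)
  conj_inner_symm p q := by
    simp only [conj_trivial]
    rw [real_inner_comm (PairSob.fstₗ p), real_inner_comm (PairSob.sndₗ p),
      real_inner_comm (PairSob.combₗ p)]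
  re_inner_nonneg p := by
    simp only [RCLike.re_to_real, real_inner_self_eq_norm_sq]
    positivity
  add_left p q r := by
    simp only [map_add, inner_add_left]
    ring
  smul_left p q c := by
    simp only [map_smul, real_inner_smul_left, conj_trivial]
    ring
  definite p hp := by
    simp only [real_inner_self_eq_norm_sq] at hp
    have h1 : PairSob.fstₗ p = 0 := by
      rw [← norm_eq_zero, ← sq_eq_zero_iff]
      nlinarith [sq_nonneg ‖PairSob.fstₗ p‖, sq_nonneg ‖PairSob.sndₗ p‖,
        sq_nonneg ‖PairSob.combₗ p‖]
    have h2 : PairSob.sndₗ p = 0 := by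
      rw [← norm_eq_zero, ← sq_eq_zero_iff]
      nlinarith [sq_nonneg ‖PairSob.fstₗ p‖, sq_nonneg ‖PairSob.sndₗ p‖,
        sq_nonneg ‖PairSob.combₗ p‖]
    exact Subtype.ext (Prod.ext (congrArg Subtype.val h1) (congrArg Subtype.val h2))

instance : NormedAddCommGroup (PairSob w s v) :=
  @InnerProductSpace.Core.toNormedAddCommGroup ℝ (PairSob w s v) _ _ _ (PairSob.core w s v)

instance : InnerProductSpace ℝ (PairSob w s v) :=
  InnerProductSpace.ofCore (PairSob.core w s v).toCore

theorem PairSob.norm_sq (p : PairSob w s v) : ‖p‖ ^ 2 =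
    ‖PairSob.fstₗ p‖ ^ 2 + ‖PairSob.sndₗ p‖ ^ 2 + ‖PairSob.combₗ p‖ ^ 2 := by
  rw [← real_inner_self_eq_norm_sq, ← real_inner_self_eq_norm_sq, ← real_inner_self_eq_norm_sq,
    ← real_inner_self_eq_norm_sq]
  rfl

/-- First component. -/
def PairSob.fst : PairSob w s v →L[ℝ] Sob w :=
  PairSob.fstₗ.mkContinuous 1 (fun p => by
    rw [one_mul]
    refine le_of_sq_le_sq ?_ (norm_nonneg _)
    rw [PairSob.norm_sq p]
    nlinarith [sq_nonneg ‖PairSob.sndₗ p‖, sq_nonneg ‖PairSob.combₗ p‖])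

/-- Second component. -/
def PairSob.snd : PairSob w s v →L[ℝ] Sob w :=
  PairSob.sndₗ.mkContinuous 1 (fun p => by
    rw [one_mul]
    refine le_of_sq_le_sq ?_ (norm_nonneg _)
    rw [PairSob.norm_sq p]
    nlinarith [sq_nonneg ‖PairSob.fstₗ p‖, sq_nonneg ‖PairSob.combₗ p‖])

/-- The combination `(a, b) ↦ b + s a`. -/
def PairSob.comb : PairSob w s v →L[ℝ] Sob v :=
  PairSob.combₗ.mkContinuous 1 (fun p => by
    rw [one_mul]
    refine le_of_sq_le_sq ?_ (norm_nonneg _)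
    rw [PairSob.norm_sq p]
    nlinarith [sq_nonneg ‖PairSob.fstₗ p‖, sq_nonneg ‖PairSob.sndₗ p‖])

theorem PairSob.comb_coe (p : PairSob w s v) : (PairSob.comb p : FreqFun) =
    (PairSob.snd p : FreqFun) + s • (PairSob.fst p : FreqFun) := rfl

/-- The bounded map `x ↦ (A x, B x)` into a space of pairs, where `B x + s A x = C x`. -/
def PairSob.lift {E : Type} [NormedAddCommGroup E] [NormedSpace ℝ E]
    (A B : E →L[ℝ] Sob w) (C : E →L[ℝ] Sob v)
    (h : ∀ x, (B x : FreqFun) + s • (A x : FreqFun) = C x) : E →L[ℝ] PairSob w s v :=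
  LinearMap.mkContinuous
    { toFun := fun x => ⟨((A x : FreqFun), (B x : FreqFun)), (A x).2, (B x).2, by
        show (B x : FreqFun) + s • (A x : FreqFun) ∈ Sob v
        rw [h x]
        exact (C x).2⟩
      map_add' := fun x y => Subtype.ext (Prod.ext (by simp) (by simp))
      map_smul' := fun c x => Subtype.ext (Prod.ext (by simp) (by simp)) }
    (‖A‖ + ‖B‖ + ‖C‖) (by
      intro x
      have hC : ∀ q : PairSob w s v, PairSob.fstₗ q = A x → PairSob.sndₗ q = B x →
          PairSob.combₗ q = C x → ‖q‖ ≤ (‖A‖ + ‖B‖ + ‖C‖) * ‖x‖ := by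
        intro q h1 h2 h3
        have h4 : ‖q‖ ≤ ‖A x‖ + ‖B x‖ + ‖C x‖ := by
          refine le_of_sq_le_sq ?_ (by positivity)
          rw [PairSob.norm_sq, h1, h2, h3]
          nlinarith [mul_nonneg (norm_nonneg (A x)) (norm_nonneg (B x)),
            mul_nonneg (norm_nonneg (A x)) (norm_nonneg (C x)),
            mul_nonneg (norm_nonneg (B x)) (norm_nonneg (C x))]
        linarith [A.le_opNorm x, B.le_opNorm x, C.le_opNorm x]
      exact hC _ rfl rfl (Subtype.ext (h x)))

theorem PairSob.lift_coe {E : Type} [NormedAddCommGroup E] [NormedSpace ℝ E]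
    (A B : E →L[ℝ] Sob w) (C : E →L[ℝ] Sob v)
    (h : ∀ x, (B x : FreqFun) + s • (A x : FreqFun) = C x) (x : E) :
    ((PairSob.lift A B C h x : PairSob w s v) : FreqFun × FreqFun)
      = ((A x : FreqFun), (B x : FreqFun)) := rfl

end Pair

/-! ## The function spaces -/

/-- `Ḣ^{1/2}(ℝ)` -/
abbrev DotHalf := Sob wDotHalf
/-- `Ḣ^{-1/2}(ℝ)` -/
abbrev DotNegHalf := Sob wDotNegHalf
/-- `H_⋆^{1/2}(ℝ)` -/
abbrev StarHalf := Sob wStarHalf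
/-- `H_⋆^{-1/2}(ℝ)` -/
abbrev StarNegHalf := Sob wStarNegHalf
/-- `H^{1/2}(ℝ)` -/
abbrev HHalf := Sob wHalf
/-- `H^{-1/2}(ℝ)` -/
abbrev HNegHalf := Sob wNegHalf

/-- `X`: pairs `(Φ_i, Φ_s)` in `(H_⋆^{1/2})²` with `Φ_s - Φ_i` in `H^{1/2}`. -/
abbrev SpX := PairSob wStarHalf (-1) wHalf
/-- `Y`: pairs `(Ψ_i, Ψ_s)` in `(H^{-1/2})²` with `Ψ_s + Ψ_i` in `H_⋆^{-1/2}`. -/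
abbrev SpY := PairSob wNegHalf 1 wStarNegHalf
/-- `X̃`: pairs in `(H_⋆^{1/2})²` whose sum is in `Ḣ^{1/2}`. -/
abbrev SpXt := PairSob wStarHalf 1 wDotHalf
/-- `Ỹ`: pairs in `(Ḣ^{-1/2})²` whose difference is in `H_⋆^{-1/2}`. -/
abbrev SpYt := PairSob wDotNegHalf (-1) wStarNegHalf
/-- `X̆`: pairs in `(Ḣ^{1/2})²` whose difference is in `H^{1/2}`. -/
abbrev SpXb := PairSob wDotHalf (-1) wHalf
/-- `Y̆`: pairs in `(H^{-1/2})²` whose sum is in `Ḣ^{-1/2}`. -/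
abbrev SpYb := PairSob wNegHalf 1 wDotNegHalf

/-- `H^{1/2} ⊂ Ḣ^{1/2}` -/
def inclHalfDot : HHalf →L[ℝ] DotHalf := Sob.incl fun k _ => abs_le_bracket k

theorem star_le_dot (k : ℝ) : (bracket k)⁻¹ * k ^ 2 ≤ |k| := by
  rw [inv_mul_le_iff₀ (bracket_pos k), ← sq_abs, sq]
  exact mul_le_mul_of_nonneg_right (abs_le_bracket k) (abs_nonneg k)

/-- `Ḣ^{1/2} ⊂ H_⋆^{1/2}` -/
def inclDotStar : DotHalf →L[ℝ] StarHalf := Sob.incl fun k _ => star_le_dot k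

/-- `H^{1/2} ⊂ H_⋆^{1/2}` -/
def inclHalfStar : HHalf →L[ℝ] StarHalf := inclDotStar ∘L inclHalfDot

/-- `Ḣ^{-1/2} ⊂ H^{-1/2}` -/
def inclDotNeg : DotNegHalf →L[ℝ] HNegHalf :=
  Sob.incl fun k hk => inv_anti₀ (abs_pos.2 hk) (abs_le_bracket k)

/-- The duality pairing `∫ Ψ Φ dx = ∫ Ψ̂ conj(Φ̂) dk`. -/
def dual (Ψ Φ : FreqFun) : ℝ := ∫ k, (Ψ k * (starRingEnd ℂ) (Φ k)).re

/-- The duality pairing `⟨Ψ₂, Φ₂ - Φ₁⟩ + ⟨Ψ₂ + Ψ₁, Φ₁⟩` between spaces of pairs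
(formally `⟨Ψ₁, Φ₁⟩ + ⟨Ψ₂, Φ₂⟩`), used for `Y × X` and for `Y̆ × X̆`. -/
def dualPair (Ψ Φ : FreqFun × FreqFun) : ℝ := dual Ψ.2 (Φ.2 - Φ.1) + dual (Ψ.2 + Ψ.1) Φ.1

/-! ## The fluid domains, `Ḣ¹` and traces -/

/-- `W^{1,∞}(ℝ)`: bounded Lipschitz functions. -/
def IsW1Inf (f : ℝ → ℝ) : Prop := (∃ C, ∀ x, |f x| ≤ C) ∧ ∃ L, LipschitzWith L f

/-- The class `W` of profiles `(lower, upper)`. -/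
def ClassW (h₀ : ℝ) : Set ((ℝ → ℝ) × (ℝ → ℝ)) :=
  {η | IsW1Inf η.1 ∧ IsW1Inf η.2 ∧ h₀ < 1 + ⨅ x, (η.2 x - η.1 x)}

/-- Lower fluid domain. -/
def lowerDomain (η : ℝ → ℝ) : Set (ℝ × ℝ) := {p | p.2 < η p.1}

/-- Upper fluid domain. -/
def upperDomain (η : (ℝ → ℝ) × (ℝ → ℝ)) : Set (ℝ × ℝ) := {p | η.1 p.1 < p.2 ∧ p.2 < 1 + η.2 p.1}

/-- The Schwartz class of the closure of `Ω`: smooth functions all of whose derivatives decay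
rapidly on the closure of `Ω`. -/
def IsSchwartzOn (Ω : Set (ℝ × ℝ)) (u : ℝ × ℝ → ℝ) : Prop :=
  ContDiff ℝ ((⊤ : ℕ∞) : WithTop ℕ∞) u ∧
    ∀ m n : ℕ, ∃ C : ℝ, ∀ p ∈ closure Ω, ‖p‖ ^ m * ‖iteratedFDeriv ℝ n u p‖ ≤ C

/-- The gradient `(u_x, u_y)`. -/
def grad (u : ℝ × ℝ → ℝ) (p : ℝ × ℝ) : EuclideanSpace ℝ (Fin 2) :=
  !₂[fderiv ℝ u p (1, 0), fderiv ℝ u p (0, 1)]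

/-- Square-integrable vector fields on `Ω`, with inner product `∫_Ω g · h`. An element of `Ḣ¹(Ω)`
(the completion of the Schwartz class of the closure of `Ω` under `‖∇u‖_{L²(Ω)}`) is represented
by its gradient, which is an `L²(Ω)`-limit of gradients of Schwartz functions. -/
abbrev L2Field (Ω : Set (ℝ × ℝ)) := Lp (EuclideanSpace ℝ (Fin 2)) 2 (volume.restrict Ω)

/-- The gradients of `u n` converge to `g` in `L²(Ω)`. -/
def GradTendsto (Ω : Set (ℝ × ℝ)) (u : ℕ → ℝ × ℝ → ℝ) (g : L2Field Ω) : Prop :=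
  Tendsto (fun n => eLpNorm (fun p => grad (u n) p - g p) 2 (volume.restrict Ω)) atTop (𝓝 0)

/-- The unitary Fourier transform. -/
def fourier (f : ℝ → ℝ) (k : ℝ) : ℂ :=
  ((√(2 * Real.pi))⁻¹ : ℝ) * ∫ x : ℝ, Complex.exp (-(Complex.I * k * x)) * (f x : ℂ)

/-- `t` is the Fourier transform of `f`. -/
def IsFourier (t : FreqFun) (f : ℝ → ℝ) : Prop := (t : ℝ → ℂ) =ᵐ[volume] fourier f

/-- `g` (the gradient of an element of `Ḣ¹` of the lower domain) has trace `Φ` on the interface: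
the trace map is the closure of restriction on Schwartz functions. -/
def HasLowerTrace (η : ℝ → ℝ) (g : L2Field (lowerDomain η)) (Φ : DotHalf) : Prop :=
  ∃ (u : ℕ → ℝ × ℝ → ℝ) (t : ℕ → DotHalf),
    (∀ n, IsSchwartzOn (lowerDomain η) (u n)) ∧
    (∀ n, IsFourier (t n) (fun x => u n (x, η x))) ∧
    GradTendsto (lowerDomain η) u g ∧ Tendsto t atTop (𝓝 Φ)

/-- `g` (the gradient of an element of `Ḣ¹` of the upper domain) has trace `Φ = (Φ_i, Φ_s)` on the
interface and the surface: the trace map is the closure of restriction on Schwartz functions. -/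
def HasUpperTrace (η : (ℝ → ℝ) × (ℝ → ℝ)) (g : L2Field (upperDomain η)) (Φ : SpX) : Prop :=
  ∃ (u : ℕ → ℝ × ℝ → ℝ) (t : ℕ → SpX),
    (∀ n, IsSchwartzOn (upperDomain η) (u n)) ∧
    (∀ n, IsFourier (t n).1.1 (fun x => u n (x, η.1 x)) ∧
      IsFourier (t n).1.2 (fun x => u n (x, 1 + η.2 x))) ∧
    GradTendsto (upperDomain η) u g ∧ Tendsto t atTop (𝓝 Φ)

/-! ## Dirichlet–Neumann operators -/

/-- `g` is the gradient of a weakly harmonic function on the lower domain with trace `Φ`. -/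
def IsLowerHarmonic (η : ℝ → ℝ) (Φ : DotHalf) (g : L2Field (lowerDomain η)) : Prop :=
  HasLowerTrace η g Φ ∧ ∀ h, HasLowerTrace η h 0 → inner ℝ g h = 0

/-- `g` is the gradient of a weakly harmonic function on the upper domain with trace `Φ`. -/
def IsUpperHarmonic (η : (ℝ → ℝ) × (ℝ → ℝ)) (Φ : SpX) (g : L2Field (upperDomain η)) : Prop :=
  HasUpperTrace η g Φ ∧ ∀ h, HasUpperTrace η h 0 → inner ℝ g h = 0

/-- The definition of the lower Dirichlet–Neumann operator: Dirichlet problems are uniquely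
solvable and `⟨G Φ₁, Φ₂⟩ = ∫ ∇φ₁ · ∇φ₂` for the solutions `φ₁`, `φ₂`. -/
def IsLowerDNO (η : ℝ → ℝ) (G : DotHalf →L[ℝ] DotNegHalf) : Prop :=
  (∀ Φ, ∃! g, IsLowerHarmonic η Φ g) ∧
    ∀ Φ₁ Φ₂ g₁ g₂, IsLowerHarmonic η Φ₁ g₁ → IsLowerHarmonic η Φ₂ g₂ →
      dual (G Φ₁) Φ₂ = inner ℝ g₁ g₂

/-- The definition of the upper Dirichlet–Neumann operator. -/
def IsUpperDNO (η : (ℝ → ℝ) × (ℝ → ℝ)) (G : SpX →L[ℝ] SpY) : Prop :=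
  (∀ Φ, ∃! g, IsUpperHarmonic η Φ g) ∧
    ∀ Φ₁ Φ₂ g₁ g₂, IsUpperHarmonic η Φ₁ g₁ → IsUpperHarmonic η Φ₂ g₂ →
      dualPair (G Φ₁) Φ₂ = inner ℝ g₁ g₂

open Classical in
/-- The operator satisfying `P` (`0` if there is none). -/
def theOperator {E F : Type} [NormedAddCommGroup E] [NormedSpace ℝ E] [NormedAddCommGroup F]
    [NormedSpace ℝ F] (P : (E →L[ℝ] F) → Prop) : E →L[ℝ] F :=
  if h : ∃ G, P G then h.choose else 0

/-- The lower Dirichlet–Neumann operator. -/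
def lowerG (η : (ℝ → ℝ) × (ℝ → ℝ)) : DotHalf →L[ℝ] DotNegHalf := theOperator (IsLowerDNO η.1)

/-- The upper Dirichlet–Neumann operator. -/
def upperG (η : (ℝ → ℝ) × (ℝ → ℝ)) : SpX →L[ℝ] SpY := theOperator (IsUpperDNO η)

/-- The lower Neumann–Dirichlet operator. -/
def lowerN (η : (ℝ → ℝ) × (ℝ → ℝ)) : DotNegHalf →L[ℝ] DotHalf := (lowerG η).inverse

/-- The upper Neumann–Dirichlet operator. -/
def upperN (η : (ℝ → ℝ) × (ℝ → ℝ)) : SpY →L[ℝ] SpX := (upperG η).inverse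

/-! ## The combined operator `G(η)` -/

/-- `a ↦ (a, 0)`, from `H^{1/2}` to `X`. -/
def injX₁ : HHalf →L[ℝ] SpX :=
  PairSob.lift inclHalfStar 0 (-ContinuousLinearMap.id ℝ HHalf) (fun x => by
    show (0 : FreqFun) + (-1 : ℝ) • (x : FreqFun) = -(x : FreqFun)
    rw [negOne_smul, zero_add])

/-- `b ↦ (0, b)`, from `H^{1/2}` to `X`. -/
def injX₂ : HHalf →L[ℝ] SpX :=
  PairSob.lift 0 inclHalfStar (ContinuousLinearMap.id ℝ HHalf) (fun x => by
    show (x : FreqFun) + (-1 : ℝ) • (0 : FreqFun) = (x : FreqFun)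
    rw [negOne_smul, neg_zero, add_zero])

section Entries

variable (η : (ℝ → ℝ) × (ℝ → ℝ))

/-- The entries of the upper Dirichlet–Neumann operator on `H^{1/2}`. -/
def G₁₁ : HHalf →L[ℝ] HNegHalf := PairSob.fst ∘L upperG η ∘L injX₁
/-- See `G₁₁`. -/
def G₁₂ : HHalf →L[ℝ] HNegHalf := PairSob.fst ∘L upperG η ∘L injX₂
/-- See `G₁₁`. -/
def G₂₁ : HHalf →L[ℝ] HNegHalf := PairSob.snd ∘L upperG η ∘L injX₁
/-- See `G₁₁`. -/
def G₂₂ : HHalf →L[ℝ] HNegHalf := PairSob.snd ∘L upperG η ∘L injX₂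

/-- The lower Dirichlet–Neumann operator restricted to `H^{1/2}`. -/
def Glow : HHalf →L[ℝ] HNegHalf := inclDotNeg ∘L lowerG η ∘L inclHalfDot

/-- `B(η) = G₁₁(η) + ρ G(η)`, with the lower Dirichlet–Neumann operator `G(η)`. -/
def opB (ρ : ℝ) : HHalf →L[ℝ] HNegHalf := G₁₁ η + ρ • Glow η

/-- The first row of the matrix defining the combined operator on `(H^{1/2})²`. -/
def row₁ (ρ : ℝ) (ξ : HHalf × HHalf) : HNegHalf :=
  Glow η ((opB η ρ).inverse (G₁₁ η ξ.1)) - Glow η ((opB η ρ).inverse (G₁₂ η ξ.2))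

/-- The second row of the matrix defining the combined operator on `(H^{1/2})²`. -/
def row₂ (ρ : ℝ) (ξ : HHalf × HHalf) : HNegHalf :=
  -G₂₁ η ((opB η ρ).inverse (Glow η ξ.1)) +
    (ρ⁻¹ • G₂₂ η ξ.2 - ρ⁻¹ • G₂₁ η ((opB η ρ).inverse (G₁₂ η ξ.2)))

end Entries

/-- The inclusion of `(H^{1/2})²` in `X̃`. -/
def inclXt : HHalf × HHalf →L[ℝ] SpXt :=
  PairSob.lift (inclHalfStar ∘L ContinuousLinearMap.fst ℝ HHalf HHalf)
    (inclHalfStar ∘L ContinuousLinearMap.snd ℝ HHalf HHalf)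
    (inclHalfDot ∘L (ContinuousLinearMap.snd ℝ HHalf HHalf + ContinuousLinearMap.fst ℝ HHalf HHalf))
    (fun x => by
      show (x.2 : FreqFun) + (1 : ℝ) • (x.1 : FreqFun) = (x.2 : FreqFun) + (x.1 : FreqFun)
      simp)

/-- `G` is a bounded extension to `X̃ → Ỹ` of the matrix operator on `(H^{1/2})²`. -/
def IsCombinedDNO (η : (ℝ → ℝ) × (ℝ → ℝ)) (ρ : ℝ) (G : SpXt →L[ℝ] SpYt) : Prop :=
  ∀ ξ : HHalf × HHalf, (G (inclXt ξ) : FreqFun × FreqFun) =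
    ((row₁ η ρ ξ : FreqFun), (row₂ η ρ ξ : FreqFun))

/-- The combined operator `G(η) : X̃ → Ỹ`. -/
def combinedG (η : (ℝ → ℝ) × (ℝ → ℝ)) (ρ : ℝ) : SpXt →L[ℝ] SpYt := theOperator (IsCombinedDNO η ρ)

/-! ## The operators `N(η)` and `K(η)` -/

/-- `(ζ₁, ζ₂) ↦ (ζ₁, -ζ₂)`, from `Ỹ` to `Y`. -/
def flipSign : SpYt →L[ℝ] SpY :=
  PairSob.lift (inclDotNeg ∘L PairSob.fst) (-(inclDotNeg ∘L PairSob.snd)) (-PairSob.comb) (fun x => by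
    show -(x.1.2 : FreqFun) + (1 : ℝ) • (x.1.1 : FreqFun) = -(x.1.2 + (-1 : ℝ) • x.1.1)
    rw [negOne_smul, one_smul]
    abel)

/-- The matrix operator
`N(η) = (ρ N₁₁ + N_low, -ρ N₁₂; -ρ N₂₁, ρ N₂₂)`, where `N_low` and `(Nᵢⱼ)` are the lower and upper
Neumann–Dirichlet operators. On `Ỹ` the combinations `N_{i1} ζ₁ - N_{i2} ζ₂` are the components of
the upper Neumann–Dirichlet operator at `(ζ₁, -ζ₂) ∈ Y`. -/
def combinedN (η : (ℝ → ℝ) × (ℝ → ℝ)) (ρ : ℝ) : SpYt →L[ℝ] SpXt :=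
  PairSob.lift
    (ρ • (PairSob.fst ∘L upperN η ∘L flipSign) + inclDotStar ∘L lowerN η ∘L PairSob.fst)
    (-(ρ • (PairSob.snd ∘L upperN η ∘L flipSign)))
    (-(ρ • (inclHalfDot ∘L PairSob.comb ∘L upperN η ∘L flipSign)) + lowerN η ∘L PairSob.fst)
    (fun x => by
      set y := upperN η (flipSign x)
      set z := lowerN η (PairSob.fst x)
      show -(ρ • y.1.2) + (1 : ℝ) • (ρ • y.1.1 + (z : FreqFun))
        = -(ρ • (y.1.2 + (-1 : ℝ) • y.1.1)) + (z : FreqFun)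
      rw [one_smul, negOne_smul, ← sub_eq_add_neg, smul_sub]
      abel)

theorem deriv_dot (k : ℝ) (hk : k ≠ 0) : k ^ 2 * |k|⁻¹ = |k| := by
  rw [← sq_abs, sq, mul_assoc, mul_inv_cancel₀ (abs_ne_zero.2 hk), mul_one]

theorem deriv_half (k : ℝ) (hk : k ≠ 0) : k ^ 2 * (bracket k * (k ^ 2)⁻¹) = bracket k := by
  field_simp

theorem deriv_star (k : ℝ) (_ : k ≠ 0) : k ^ 2 * (bracket k)⁻¹ = (bracket k)⁻¹ * k ^ 2 :=
  mul_comm _ _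

/-- `∂ₓ : X̆ → Ỹ`, componentwise. -/
def derivXb : SpXb →L[ℝ] SpYt :=
  PairSob.lift (Sob.deriv wDotHalf wDotNegHalf deriv_dot ∘L PairSob.fst)
    (Sob.deriv wDotHalf wDotNegHalf deriv_dot ∘L PairSob.snd)
    (Sob.deriv wHalf wStarNegHalf deriv_half ∘L PairSob.comb) (fun x => by
      show freqDeriv x.1.2 + (-1 : ℝ) • freqDeriv x.1.1 = freqDeriv (x.1.2 + (-1 : ℝ) • x.1.1)
      rw [map_add, map_smul])

/-- `∂ₓ : X̃ → Y̆`, componentwise. -/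
def derivXt : SpXt →L[ℝ] SpYb :=
  PairSob.lift (Sob.deriv wStarHalf wNegHalf deriv_star ∘L PairSob.fst)
    (Sob.deriv wStarHalf wNegHalf deriv_star ∘L PairSob.snd)
    (Sob.deriv wDotHalf wDotNegHalf deriv_dot ∘L PairSob.comb) (fun x => by
      show freqDeriv x.1.2 + (1 : ℝ) • freqDeriv x.1.1 = freqDeriv (x.1.2 + (1 : ℝ) • x.1.1)
      rw [map_add, map_smul])

/-- `K(η) = -∂ₓ N(η) ∂ₓ`. -/
def opK (η : (ℝ → ℝ) × (ℝ → ℝ)) (ρ : ℝ) : SpXb →L[ℝ] SpYb :=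
  -(derivXt ∘L combinedN η ρ ∘L derivXb)

end TwoLayer

end

/-! Everything rests on one analytic fact: the lower and upper Dirichlet–Neumann operators exist and
their Dirichlet forms are coercive, ⟨GΦ,Φ⟩ ≥ c‖Φ‖², on Ḣ^{1/2} and on X. The rest is Hilbert space
algebra.

Algebra. By Lax–Milgram both operators are isomorphisms, and their inverses are again coercive. For
ζ ∈ Ỹ and ζ' = (ζ₁, -ζ₂) ∈ Y the pairing ⟨Nζ,ζ⟩ splits into ρ times the upper form at ζ' plus the
lower form at ζ₁ (`pairXtYt_combinedN`). The first controls ζ₂ - ζ₁ in H_⋆^{-1/2}, the second ζ₁ in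
Ḣ^{-1/2}; together they control ζ in Ỹ, so N is an isomorphism. For ξ ∈ (H^{1/2})² the matrix output
ζ solves Nζ = ξ (`exists_combinedN_eq`); since (H^{1/2})² is dense in X̃, the inverse of N is the
only bounded extension G. Finally ∂ₓ is a skew-adjoint isometry X̆ → Ỹ, so ⟨Kξ,ξ⟩ = ⟨N∂ₓξ,∂ₓξ⟩ is
coercive on X̆.

Analysis. Consider the closed relation in L²(Ω) × (trace space) generated by the pairs (∇u, trace of
u), u Schwartz. A Dirichlet–Neumann operator exists and is coercive as soon as (i) traces are
bounded by the gradient norm, and (ii) a dense set of traces has lifts bounded by the trace norm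
(`existsUnique_dirichletNeumann`). Condition (ii) implies (i). If ψ is a lift depending on x alone
near the boundary, then ∫(u_x ψ_y - u_y ψ_x) equals, up to sign, the boundary pairing of u with the
x-derivative of the datum of ψ, and is at most ‖∇u‖‖∇ψ‖ (`integral_rot`, `sq_integral_rot_le`).
Since ∂ₓ carries Ḣ^{1/2}, H^{1/2}, H_⋆^{1/2} to Ḣ^{-1/2}, H_⋆^{-1/2}, H^{-1/2} isometrically, this
bounds the trace by duality.

Lifts. Data are transforms φ, smooth and compactly supported away from k = 0. The function with
transform φ(k) l(k)⁻¹ m(τ/l(k)) in the plane extends the datum from the line, with energy controlled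
by ∫ l|φ|². It is composed with a flattened vertical distance to a smooth approximation of the
Lipschitz graph, so that the lift is smooth and has exactly the prescribed trace on the rough graph
(`exists_layer_lift`). Below, l = |k| suffices. In the upper layer the part φ/⟨k⟩ of the interface
datum is carried through the whole depth as a function of x alone, and the remainder and the jump Φ₂
- Φ₁ lie in H^{1/2} and are lifted in cut-off layers with l = ⟨k⟩ (`exists_upper_lift`). -/

noncomputable section

namespace TwoLayer

open scoped ComplexConjugate

/-! ### Fourier multipliers between weighted spaces -/

/-- `μ` is a Hermitian symbol with `v |μ|² = w`, so that multiplication by `μ` is an isometry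
from `Sob w` onto `Sob v`. -/
structure IsMultiplier (μ : ℝ → ℂ) (w v : Weight) : Prop where
  meas : Measurable μ
  herm : ∀ k, μ (-k) = conj (μ k)
  weight : ∀ k, k ≠ 0 → v k * ‖μ k‖ ^ 2 = w k

/-- The class of a measurable function multiplied by an element of `FreqFun`. -/
def symbolMul (μ : ℝ → ℂ) (hμ : Measurable μ) (f : FreqFun) : FreqFun :=
  AEEqFun.mk μ hμ.aestronglyMeasurable * f

theorem symbolMul_ae {μ : ℝ → ℂ} (hμ : Measurable μ) (f : FreqFun) :
    ∀ᵐ k : ℝ, symbolMul μ hμ f k = μ k * f k := by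
  filter_upwards [AEEqFun.coeFn_mul (AEEqFun.mk μ hμ.aestronglyMeasurable) f,
    AEEqFun.coeFn_mk μ (hμ.aestronglyMeasurable (μ := (volume : Measure ℝ)))] with k h1 h2
  rw [symbolMul, h1, Pi.mul_apply, h2]

theorem symbolMul_add {μ : ℝ → ℂ} (hμ : Measurable μ) (f g : FreqFun) :
    symbolMul μ hμ (f + g) = symbolMul μ hμ f + symbolMul μ hμ g := by
  refine AEEqFun.ext ?_
  filter_upwards [symbolMul_ae hμ f, symbolMul_ae hμ g, symbolMul_ae hμ (f + g),
    AEEqFun.coeFn_add f g, AEEqFun.coeFn_add (symbolMul μ hμ f) (symbolMul μ hμ g)]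
    with k h1 h2 h3 h4 h5
  rw [h3, h5, h4, Pi.add_apply, Pi.add_apply, h1, h2, mul_add]

theorem symbolMul_smul {μ : ℝ → ℂ} (hμ : Measurable μ) (c : ℝ) (f : FreqFun) :
    symbolMul μ hμ (c • f) = c • symbolMul μ hμ f := by
  refine AEEqFun.ext ?_
  filter_upwards [symbolMul_ae hμ f, symbolMul_ae hμ (c • f), AEEqFun.coeFn_smul c f,
    AEEqFun.coeFn_smul c (symbolMul μ hμ f)] with k h1 h2 h3 h4
  rw [h2, h4, h3, Pi.smul_apply, Pi.smul_apply, h1, mul_smul_comm]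

theorem Sob.coe_add_ae {w : Weight} (f g : Sob w) :
    ∀ᵐ k : ℝ, ((f + g : Sob w) : FreqFun) k = (f : FreqFun) k + (g : FreqFun) k :=
  AEEqFun.coeFn_add (f : FreqFun) (g : FreqFun)

theorem Sob.coe_smul_ae {w : Weight} (c : ℝ) (f : Sob w) :
    ∀ᵐ k : ℝ, ((c • f : Sob w) : FreqFun) k = c • (f : FreqFun) k :=
  AEEqFun.coeFn_smul c (f : FreqFun)

theorem Sob.ext_ae {w : Weight} {f g : Sob w}
    (h : ∀ᵐ k : ℝ, (f : FreqFun) k = (g : FreqFun) k) : f = g :=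
  Subtype.ext (AEEqFun.ext h)

section Multiplier

variable {μ : ℝ → ℂ} {w v : Weight}

theorem IsMultiplier.weight_ae (h : IsMultiplier μ w v) (f : FreqFun) :
    (fun k => v k * ‖symbolMul μ h.meas f k‖ ^ 2) =ᵐ[volume] fun k => w k * ‖f k‖ ^ 2 := by
  filter_upwards [symbolMul_ae h.meas f, ae_ne_zero] with k h1 hk
  rw [h1, ← h.weight k hk, norm_mul]
  ring

/-- Multiplication by a symbol, as an isometry. -/
def Sob.mul (h : IsMultiplier μ w v) : Sob w →ₗᵢ[ℝ] Sob v where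
  toFun f := ⟨symbolMul μ h.meas f, by
    filter_upwards [symbolMul_ae h.meas (f : FreqFun), ae_neg (symbolMul_ae h.meas (f : FreqFun)),
      f.2.1] with k h1 h2 h3
    rw [h1, h2, h3, h.herm, map_mul], f.2.2.congr (h.weight_ae _).symm⟩
  map_add' f g := Subtype.ext (symbolMul_add h.meas (f : FreqFun) (g : FreqFun))
  map_smul' c f := Subtype.ext (symbolMul_smul h.meas c (f : FreqFun))
  norm_map' f := by
    rw [← sq_eq_sq₀ (norm_nonneg _) (norm_nonneg _), Sob.norm_sq, Sob.norm_sq]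
    exact integral_congr_ae (h.weight_ae _)

theorem Sob.mul_ae (h : IsMultiplier μ w v) (f : Sob w) :
    ∀ᵐ k : ℝ, (Sob.mul h f : FreqFun) k = μ k * (f : FreqFun) k :=
  symbolMul_ae h.meas _

theorem IsMultiplier.ne_zero (h : IsMultiplier μ w v) {k : ℝ} (hk : k ≠ 0) : μ k ≠ 0 := by
  intro h0
  have := h.weight k hk
  rw [h0] at this
  have := w.pos k hk
  simp_all

theorem IsMultiplier.inv (h : IsMultiplier μ w v) : IsMultiplier (fun k => (μ k)⁻¹) v w where
  meas := h.meas.inv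
  herm k := by rw [h.herm, map_inv₀]
  weight k hk := by
    have := norm_ne_zero_iff.2 (h.ne_zero hk)
    rw [← h.weight k hk, norm_inv]
    field_simp

theorem Sob.mul_mul_inv (h : IsMultiplier μ w v) (f : Sob v) :
    Sob.mul h (Sob.mul h.inv f) = f := by
  refine Sob.ext_ae ?_
  filter_upwards [Sob.mul_ae h.inv f, Sob.mul_ae h (Sob.mul h.inv f), ae_ne_zero] with k h1 h2 hk
  rw [h2, h1, mul_inv_cancel_left₀ (h.ne_zero hk)]

end Multiplier

/-! ### Completeness -/

theorem Sob.memLp (w : Weight) (f : Sob w) :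
    MemLp (fun k => (√(w k) : ℂ) * (f : FreqFun) k) 2 := by
  have hm : AEStronglyMeasurable (fun k => (√(w k) : ℂ) * (f : FreqFun) k) volume := by
    have := w.meas
    refine (AEMeasurable.mul ?_ (f : FreqFun).aemeasurable).aestronglyMeasurable
    exact (Complex.measurable_ofReal.comp (Real.continuous_sqrt.measurable.comp this)).aemeasurable
  rw [memLp_two_iff_integrable_sq_norm hm]
  refine f.2.2.congr ?_
  filter_upwards [w.ae_pos] with k hk
  rw [norm_mul, mul_pow, Complex.norm_real, Real.norm_eq_abs, sq_abs, Real.sq_sqrt hk.le]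

/-- The isometry `f ↦ √w f` into `L²`. -/
def Sob.toL2 (w : Weight) : Sob w →ₗᵢ[ℝ] Lp ℂ 2 (volume : Measure ℝ) where
  toFun f := (Sob.memLp w f).toLp _
  map_add' f g := by
    rw [← MemLp.toLp_add]
    refine MemLp.toLp_congr _ _ ?_
    filter_upwards [Sob.coe_add_ae f g] with k hk
    rw [hk, Pi.add_apply, mul_add]
  map_smul' c f := by
    rw [RingHom.id_apply, ← MemLp.toLp_const_smul]
    refine MemLp.toLp_congr _ _ ?_
    filter_upwards [Sob.coe_smul_ae c f] with k hk
    rw [hk, Pi.smul_apply, mul_smul_comm]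
  norm_map' f := by
    rw [← sq_eq_sq₀ (norm_nonneg _) (norm_nonneg _), Sob.norm_sq]
    have h1 : ‖(Sob.memLp w f).toLp _‖ ^ 2 = ∫ k, ‖(Sob.memLp w f).toLp _ k‖ ^ 2 := by
      rw [← real_inner_self_eq_norm_sq, L2.inner_def]
      simp only [real_inner_self_eq_norm_sq]
    refine Eq.trans h1 (integral_congr_ae ?_)
    filter_upwards [w.ae_pos, (Sob.memLp w f).coeFn_toLp] with k hk h2
    rw [h2, norm_mul, mul_pow, Complex.norm_real, Real.norm_eq_abs, sq_abs, Real.sq_sqrt hk.le]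

theorem Sob.toL2_ae (w : Weight) (f : Sob w) :
    ∀ᵐ k : ℝ, Sob.toL2 w f k = (√(w k) : ℂ) * (f : FreqFun) k := (Sob.memLp w f).coeFn_toLp

/-- `Sob.toL2` is an isometry, so it suffices that its range is closed. A limit in L² is an a.e.
limit along a subsequence; dividing by √w gives the candidate, and Hermitian symmetry survives
pointwise limits. -/
instance (w : Weight) : CompleteSpace (Sob w) := by
  rw [completeSpace_iff_isComplete_range (Sob.toL2 w).isometry.isUniformInducing]
  refine IsClosed.isComplete (isClosed_of_closure_subset fun g hg => ?_)
  obtain ⟨F, hF, hlim⟩ := mem_closure_iff_seq_limit.1 hg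
  choose f hf using hF
  obtain ⟨ns, -, hns⟩ := (tendstoInMeasure_of_tendsto_Lp hlim).exists_seq_tendsto_ae
  have hfn : ∀ᵐ k : ℝ, ∀ n, F n k = (√(w k) : ℂ) * (f n : FreqFun) k :=
    ae_all_iff.2 fun n => by rw [← hf n]; exact Sob.toL2_ae w (f n)
  have hinv : Measurable fun k => ((√(w k) : ℂ))⁻¹ :=
    (Complex.measurable_ofReal.comp (Real.continuous_sqrt.measurable.comp w.meas)).inv
  set h : FreqFun := symbolMul _ hinv (g : FreqFun)
  have hlimf : ∀ᵐ k : ℝ, Tendsto (fun n => (f (ns n) : FreqFun) k) atTop (𝓝 (h k)) := by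
    filter_upwards [hns, hfn, w.ae_pos, symbolMul_ae hinv (g : FreqFun)] with k h1 h2 h3 h4
    rw [h4]
    have h5 : ((√(w k) : ℝ) : ℂ) ≠ 0 := Complex.ofReal_ne_zero.2 (Real.sqrt_pos.2 h3).ne'
    refine (h1.const_mul _).congr fun n => ?_
    rw [h2, inv_mul_cancel_left₀ h5]
  have hherm : IsHermitian h := by
    have h6 : ∀ᵐ k : ℝ, ∀ n, (f n : FreqFun) (-k) = conj ((f n : FreqFun) k) :=
      ae_all_iff.2 fun n => (f n).2.1
    filter_upwards [hlimf, ae_neg hlimf, h6] with k h1 h2 h3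
    refine tendsto_nhds_unique h2 ?_
    simp only [h3]
    exact (Complex.continuous_conj.tendsto _).comp h1
  have hgh : ∀ᵐ k : ℝ, g k = (√(w k) : ℂ) * h k := by
    filter_upwards [w.ae_pos, symbolMul_ae hinv (g : FreqFun)] with k h3 h4
    have h5 : ((√(w k) : ℝ) : ℂ) ≠ 0 := Complex.ofReal_ne_zero.2 (Real.sqrt_pos.2 h3).ne'
    rw [h4, mul_inv_cancel_left₀ h5]
  have hint : Integrable fun k => w k * ‖h k‖ ^ 2 := by
    refine ((memLp_two_iff_integrable_sq_norm (Lp.aestronglyMeasurable g)).1 (Lp.memLp g)).congr ?_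
    filter_upwards [hgh, w.ae_pos] with k h1 hk
    rw [h1, norm_mul, mul_pow, Complex.norm_real, Real.norm_eq_abs, sq_abs, Real.sq_sqrt hk.le]
  refine ⟨⟨h, hherm, hint⟩, Lp.ext ?_⟩
  filter_upwards [Sob.toL2_ae w ⟨h, hherm, hint⟩, hgh] with k h1 h2
  rw [h1, h2]

/-! ### Duality -/

/-- The weights `w` and `v` are even and reciprocal. -/
structure DualWeights (w v : Weight) : Prop where
  even : ∀ k, w (-k) = w k
  mul : ∀ k, k ≠ 0 → v k * w k = 1

theorem bracket_neg (k : ℝ) : bracket (-k) = bracket k := by simp [bracket]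

theorem dualWeights_dot : DualWeights wDotHalf wDotNegHalf where
  even k := abs_neg k
  mul _ hk := inv_mul_cancel₀ (abs_ne_zero.2 hk)

theorem dualWeights_half : DualWeights wHalf wNegHalf where
  even k := bracket_neg k
  mul _ _ := inv_mul_cancel₀ (bracket_pos _).ne'

theorem dualWeights_star : DualWeights wStarHalf wStarNegHalf where
  even k := by
    show (bracket (-k))⁻¹ * (-k) ^ 2 = (bracket k)⁻¹ * k ^ 2
    rw [bracket_neg, neg_sq]
  mul k hk := by
    show bracket k * (k ^ 2)⁻¹ * ((bracket k)⁻¹ * k ^ 2) = 1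
    have := (bracket_pos k).ne'
    field_simp

section Dual

variable {w v : Weight}

theorem DualWeights.multiplier (h : DualWeights w v) :
    IsMultiplier (fun k => (w k : ℂ)) w v where
  meas := Complex.measurable_ofReal.comp w.meas
  herm k := by rw [h.even, Complex.conj_ofReal]
  weight k hk := by
    have := h.mul k hk
    rw [Complex.norm_real, Real.norm_eq_abs, sq_abs, sq, ← mul_assoc, this, one_mul]

theorem inner_eq_dual (h : DualWeights w v) (f g : Sob w) :
    inner ℝ f g = dual (Sob.mul h.multiplier f) g := by
  show ∫ k, w k * ((f : FreqFun) k * (starRingEnd ℂ) ((g : FreqFun) k)).re = _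
  refine integral_congr_ae ?_
  filter_upwards [Sob.mul_ae h.multiplier f] with k hk
  rw [hk, mul_assoc, Complex.re_ofReal_mul]

theorem dual_eq_inner (h : DualWeights w v) (f : Sob v) (g : Sob w) :
    dual f g = inner ℝ (Sob.mul h.multiplier.inv f) g := by
  rw [inner_eq_dual h, Sob.mul_mul_inv]

/-- The duality pairing as a bounded bilinear form. -/
def dualL (h : DualWeights w v) : Sob v →L[ℝ] Sob w →L[ℝ] ℝ :=
  (innerSL ℝ : Sob w →L[ℝ] Sob w →L[ℝ] ℝ) ∘L (Sob.mul h.multiplier.inv).toContinuousLinearMap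

theorem dualL_apply (h : DualWeights w v) (f : Sob v) (g : Sob w) : dualL h f g = dual f g :=
  (dual_eq_inner h f g).symm

theorem dual_comm (f g : FreqFun) : dual f g = dual g f := by
  unfold dual
  congr 1
  ext k
  simp only [Complex.mul_re, Complex.conj_re, Complex.conj_im]
  ring

/-- Pairing f with its Riesz representative w⁻¹f returns ‖f‖². -/
theorem dualL_injective (h : DualWeights w v) : Function.Injective (dualL h) := by
  rw [injective_iff_map_eq_zero]
  intro f hf
  have h1 := dual_eq_inner h f (Sob.mul h.multiplier.inv f)
  rw [← dualL_apply h, hf, real_inner_self_eq_norm_sq, LinearIsometry.norm_map] at h1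
  simpa using h1.symm

theorem dualL_surjective (h : DualWeights w v) : Function.Surjective (dualL h) := by
  intro ℓ
  refine ⟨Sob.mul h.multiplier ((InnerProductSpace.toDual ℝ (Sob w)).symm ℓ), ?_⟩
  ext g
  rw [dualL_apply, ← inner_eq_dual h, InnerProductSpace.toDual_symm_apply]

end Dual

/-! ### Spaces of pairs as products -/

section Pair

variable {w v : Weight} {s : ℝ}

/-- A pair `(a, b)` is determined by `a` and `b + s a`. -/
def PairSob.equivProd (h : ∀ k, k ≠ 0 → w k ≤ v k) : PairSob w s v ≃L[ℝ] Sob w × Sob v :=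
  ContinuousLinearEquiv.equivOfInverse (PairSob.fst.prod PairSob.comb)
    (PairSob.lift (ContinuousLinearMap.fst ℝ _ _)
      (Sob.incl h ∘L ContinuousLinearMap.snd ℝ _ _ - s • ContinuousLinearMap.fst ℝ _ _)
      (ContinuousLinearMap.snd ℝ _ _) (fun x => by
        show (x.2 : FreqFun) - s • (x.1 : FreqFun) + s • (x.1 : FreqFun) = x.2
        abel))
    (fun p => Subtype.ext (Prod.ext rfl (by
      show p.1.2 + s • p.1.1 - s • p.1.1 = p.1.2
      abel)))
    (fun x => Prod.ext rfl (Subtype.ext (by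
      show (x.2 : FreqFun) - s • (x.1 : FreqFun) + s • (x.1 : FreqFun) = x.2
      abel)))

theorem PairSob.equivProd_apply (h : ∀ k, k ≠ 0 → w k ≤ v k) (p : PairSob w s v) :
    PairSob.equivProd h p = (PairSob.fst p, PairSob.comb p) := rfl

theorem PairSob.completeSpace (h : ∀ k, k ≠ 0 → w k ≤ v k) : CompleteSpace (PairSob w s v) :=
  (completeSpace_congr (e := (PairSob.equivProd h).toEquiv)
    (PairSob.equivProd h).isUniformEmbedding).2 inferInstance

theorem PairSob.norm_sq_eq (p : PairSob w s v) : ‖p‖ ^ 2 =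
    ‖PairSob.fst p‖ ^ 2 + ‖PairSob.snd p‖ ^ 2 + ‖PairSob.comb p‖ ^ 2 := PairSob.norm_sq p

end Pair

theorem one_le_bracket (k : ℝ) : 1 ≤ bracket k :=
  Real.one_le_sqrt.2 (by nlinarith [sq_nonneg k])

theorem wDotHalf_le_wHalf (k : ℝ) (_ : k ≠ 0) : wDotHalf k ≤ wHalf k := abs_le_bracket k

theorem wStarHalf_le_wDotHalf (k : ℝ) (_ : k ≠ 0) : wStarHalf k ≤ wDotHalf k := star_le_dot k

theorem wStarHalf_le_wHalf (k : ℝ) (hk : k ≠ 0) : wStarHalf k ≤ wHalf k :=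
  (wStarHalf_le_wDotHalf k hk).trans (wDotHalf_le_wHalf k hk)

theorem DualWeights.anti {w v w' v' : Weight} (h : DualWeights w v) (h' : DualWeights w' v')
    (hle : ∀ k, k ≠ 0 → w k ≤ w' k) (k : ℝ) (hk : k ≠ 0) : v' k ≤ v k := by
  have h1 := h.mul k hk
  have h2 := h'.mul k hk
  have h3 := hle k hk
  rw [eq_inv_of_mul_eq_one_left h1, eq_inv_of_mul_eq_one_left h2]
  exact inv_anti₀ (w.pos k hk) h3

theorem wDotNegHalf_le_wStarNegHalf : ∀ k, k ≠ 0 → wDotNegHalf k ≤ wStarNegHalf k :=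
  dualWeights_star.anti dualWeights_dot wStarHalf_le_wDotHalf

theorem wNegHalf_le_wDotNegHalf : ∀ k, k ≠ 0 → wNegHalf k ≤ wDotNegHalf k :=
  dualWeights_dot.anti dualWeights_half wDotHalf_le_wHalf

theorem wNegHalf_le_wStarNegHalf : ∀ k, k ≠ 0 → wNegHalf k ≤ wStarNegHalf k :=
  dualWeights_star.anti dualWeights_half wStarHalf_le_wHalf

instance : CompleteSpace SpX := PairSob.completeSpace wStarHalf_le_wHalf
instance : CompleteSpace SpY := PairSob.completeSpace wNegHalf_le_wStarNegHalf
instance : CompleteSpace SpXt := PairSob.completeSpace wStarHalf_le_wDotHalf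
instance : CompleteSpace SpYt := PairSob.completeSpace wDotNegHalf_le_wStarNegHalf
instance : CompleteSpace SpXb := PairSob.completeSpace wDotHalf_le_wHalf
instance : CompleteSpace SpYb := PairSob.completeSpace wNegHalf_le_wDotNegHalf

end TwoLayer
end

/-! ### Density of smooth transforms supported away from zero frequency. -/

noncomputable section

namespace TwoLayer

open scoped ComplexConjugate ContDiff

/-! ### Test functions on the frequency side -/

/-- Smooth Hermitian functions with compact support away from the origin. -/
structure IsTest (φ : ℝ → ℂ) : Prop where
  smooth : ContDiff ℝ ∞ φ
  compact : HasCompactSupport φ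
  zero_notMem : (0 : ℝ) ∉ tsupport φ
  herm : ∀ k, φ (-k) = conj (φ k)

theorem contDiff_mul_of_zero_notMem {φ g : ℝ → ℂ} (hφ : ContDiff ℝ ∞ φ)
    (h0 : (0 : ℝ) ∉ tsupport φ) (hg : ∀ k, k ≠ 0 → ContDiffAt ℝ ∞ g k) :
    ContDiff ℝ ∞ fun k => g k * φ k := by
  rw [contDiff_iff_contDiffAt]
  intro k
  by_cases hk : k ∈ tsupport φ
  · exact (hg k (fun h => h0 (h ▸ hk))).mul hφ.contDiffAt
  · refine (contDiffAt_const (c := (0 : ℂ))).congr_of_eventuallyEq ?_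
    filter_upwards [notMem_tsupport_iff_eventuallyEq.1 hk] with x hx
    rw [hx, Pi.zero_apply, mul_zero]

theorem IsTest.mul {φ g : ℝ → ℂ} (hφ : IsTest φ) (hg : ∀ k, k ≠ 0 → ContDiffAt ℝ ∞ g k)
    (hh : ∀ k, g (-k) = conj (g k)) : IsTest fun k => g k * φ k where
  smooth := contDiff_mul_of_zero_notMem hφ.smooth hφ.zero_notMem hg
  compact := hφ.compact.mul_left
  zero_notMem h := hφ.zero_notMem (closure_mono (Function.support_mul_subset_right g φ) h)
  herm k := by rw [hh, hφ.herm, map_mul]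

theorem IsTest.zero : IsTest (fun _ => 0) where
  smooth := contDiff_const
  compact := HasCompactSupport.zero
  zero_notMem := by simp [tsupport]
  herm k := by simp

theorem IsTest.add {φ ψ : ℝ → ℂ} (hφ : IsTest φ) (hψ : IsTest ψ) :
    IsTest fun k => φ k + ψ k where
  smooth := hφ.smooth.add hψ.smooth
  compact := hφ.compact.add hψ.compact
  zero_notMem h := by
    rcases tsupport_add φ ψ h with h | h
    exacts [hφ.zero_notMem h, hψ.zero_notMem h]
  herm k := by rw [hφ.herm, hψ.herm, map_add]

theorem IsTest.const_mul {φ : ℝ → ℂ} (hφ : IsTest φ) (c : ℝ) : IsTest fun k => (c : ℂ) * φ k :=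
  hφ.mul (fun _ _ => contDiffAt_const) (fun _ => (Complex.conj_ofReal c).symm)

theorem IsTest.integrable_mul {φ : ℝ → ℂ} (hφ : IsTest φ) {g : ℝ → ℝ}
    (hg : ContinuousOn g {0}ᶜ) : Integrable fun k => g k * ‖φ k‖ ^ 2 := by
  have h1 : Continuous fun k => g k * ‖φ k‖ ^ 2 := by
    rw [continuous_iff_continuousAt]
    intro k
    by_cases hk : k ∈ tsupport φ
    · have hk0 : k ≠ 0 := fun h => hφ.zero_notMem (h ▸ hk)
      exact (hg.continuousAt (isOpen_compl_singleton.mem_nhds hk0)).mul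
        (hφ.smooth.continuous.norm.pow 2).continuousAt
    · refine (continuousAt_const (y := (0 : ℝ))).congr ?_
      filter_upwards [notMem_tsupport_iff_eventuallyEq.1 hk] with x hx
      rw [hx]
      simp
  refine h1.integrable_of_hasCompactSupport ?_
  refine hφ.compact.mono' ?_
  intro k hk
  refine subset_closure fun h0 => hk ?_
  simp [h0]

/-- Even weights that are continuous away from the origin. -/
structure Weight.Regular (w : Weight) : Prop where
  even : ∀ k, w (-k) = w k
  cont : ContinuousOn w {0}ᶜ

theorem contDiff_bracket : ContDiff ℝ ∞ bracket := by
  unfold bracket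
  exact ContDiff.sqrt (by fun_prop) fun k => by positivity

theorem regular_wDotHalf : wDotHalf.Regular := ⟨dualWeights_dot.even, continuous_abs.continuousOn⟩

theorem regular_wHalf : wHalf.Regular :=
  ⟨dualWeights_half.even, contDiff_bracket.continuous.continuousOn⟩

theorem regular_wStarHalf : wStarHalf.Regular :=
  ⟨dualWeights_star.even, ((contDiff_bracket.continuous.inv₀
    fun k => (bracket_pos k).ne').mul (continuous_id.pow 2)).continuousOn⟩

theorem DualWeights.regular {w v : Weight} (h : DualWeights w v) (hw : w.Regular) :
    v.Regular := by
  have hv : ∀ k, k ≠ 0 → v k = (w k)⁻¹ := fun k hk => eq_inv_of_mul_eq_one_left (h.mul k hk)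
  have hc : ContinuousOn v {0}ᶜ :=
    (hw.cont.inv₀ fun k hk => (w.pos k hk).ne').congr fun k hk => hv k hk
  refine ⟨fun k => ?_, hc⟩
  rcases eq_or_ne k 0 with rfl | hk
  · simp
  · rw [hv k hk, hv _ (neg_ne_zero.2 hk), h.even]

theorem regular_wDotNegHalf : wDotNegHalf.Regular := dualWeights_dot.regular regular_wDotHalf
theorem regular_wNegHalf : wNegHalf.Regular := dualWeights_half.regular regular_wHalf
theorem regular_wStarNegHalf : wStarNegHalf.Regular := dualWeights_star.regular regular_wStarHalf

/-- A test function as an element of a weighted space. -/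
def IsTest.toSob {φ : ℝ → ℂ} (hφ : IsTest φ) {w : Weight} (hw : w.Regular) : Sob w :=
  ⟨AEEqFun.mk φ hφ.smooth.continuous.aestronglyMeasurable, by
    have h := AEEqFun.coeFn_mk φ
      (hφ.smooth.continuous.aestronglyMeasurable (μ := (volume : Measure ℝ)))
    refine ⟨?_, ?_⟩
    · filter_upwards [h, ae_neg h] with k h1 h2
      rw [h1, h2, hφ.herm]
    · refine (hφ.integrable_mul hw.cont).congr ?_
      filter_upwards [h] with k h1
      rw [h1]⟩

theorem IsTest.toSob_ae {φ : ℝ → ℂ} (hφ : IsTest φ) {w : Weight} (hw : w.Regular) :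
    ∀ᵐ k : ℝ, (hφ.toSob hw : FreqFun) k = φ k :=
  AEEqFun.coeFn_mk φ (hφ.smooth.continuous.aestronglyMeasurable (μ := (volume : Measure ℝ)))

/-- The test functions in a weighted space. -/
def testSub (w : Weight) : Submodule ℝ (Sob w) where
  carrier := {f | ∃ φ, IsTest φ ∧ ∀ᵐ k : ℝ, (f : FreqFun) k = φ k}
  zero_mem' := ⟨_, IsTest.zero, AEEqFun.coeFn_zero⟩
  add_mem' := by
    rintro f g ⟨φ, hφ, h1⟩ ⟨ψ, hψ, h2⟩
    refine ⟨_, hφ.add hψ, ?_⟩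
    filter_upwards [h1, h2, Sob.coe_add_ae f g] with k h3 h4 h5
    rw [h5, h3, h4]
  smul_mem' := by
    rintro c f ⟨φ, hφ, h1⟩
    refine ⟨_, hφ.const_mul c, ?_⟩
    filter_upwards [h1, Sob.coe_smul_ae c f] with k h3 h5
    rw [h5, h3, Complex.real_smul]

theorem IsTest.toSob_mem {φ : ℝ → ℂ} (hφ : IsTest φ) {w : Weight} (hw : w.Regular) :
    hφ.toSob hw ∈ testSub w := ⟨φ, hφ, hφ.toSob_ae hw⟩

theorem hasCompactSupport_comp_neg {g : ℝ → ℝ} (hg : HasCompactSupport g) :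
    HasCompactSupport fun k => g (-k) :=
  hg.comp_homeomorph (Homeomorph.neg ℝ)

theorem zero_notMem_tsupport_comp_neg {g : ℝ → ℝ} (hg : (0 : ℝ) ∉ tsupport g) :
    (0 : ℝ) ∉ tsupport fun k => g (-k) := by
  rw [notMem_tsupport_iff_eventuallyEq] at hg ⊢
  have : Tendsto (fun k : ℝ => -k) (𝓝 0) (𝓝 0) := by
    simpa using (continuous_neg (G := ℝ)).tendsto 0
  exact this.eventually hg

/-- The Hermitian test functions generated by a real one. -/
theorem isTest_symm {g : ℝ → ℝ} (hg : ContDiff ℝ ∞ g) (hc : HasCompactSupport g)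
    (h0 : (0 : ℝ) ∉ tsupport g) (c : ℂ) :
    IsTest fun k => c * (g k : ℂ) + conj c * (g (-k) : ℂ) where
  smooth := by
    have h1 : ContDiff ℝ ∞ fun k => (g k : ℂ) := Complex.ofRealCLM.contDiff.comp hg
    have h2 : ContDiff ℝ ∞ fun k => (g (-k) : ℂ) := h1.comp contDiff_neg
    exact (contDiff_const.mul h1).add (contDiff_const.mul h2)
  compact := by
    refine HasCompactSupport.add ?_ ?_
    · exact (hc.comp_left (g := fun x : ℝ => c * (x : ℂ)) (by simp))
    · exact ((hasCompactSupport_comp_neg hc).comp_left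
        (g := fun x : ℝ => conj c * (x : ℂ)) (by simp))
  zero_notMem := by
    have h1 := h0
    have h2 := zero_notMem_tsupport_comp_neg h0
    rw [notMem_tsupport_iff_eventuallyEq] at h1 h2 ⊢
    filter_upwards [h1, h2] with k h3 h4
    simp only [Pi.zero_apply] at h3 h4
    simp [h3, h4]
  herm k := by simp [add_comm]

/-- Test functions must be Hermitian, so only symmetrised g are available; against an even F the
symmetrisation does no harm beyond a factor 2. -/
theorem integral_even_mul {F g : ℝ → ℝ} (hF : ∀ᵐ k : ℝ, F (-k) = F k)
    (hi : Integrable fun k => g k * F k) :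
    ∫ k, (g k + g (-k)) * F k = 2 * ∫ k, g k * F k := by
  have h2 : (fun k => g (-k) * F k) =ᵐ[volume] fun k => g (-k) * F (-k) := by
    filter_upwards [hF] with k hk
    rw [hk]
  have h3 : Integrable fun k => g (-k) * F (-k) := hi.comp_neg
  have h4 : ∫ k, g (-k) * F (-k) = ∫ k, g k * F k := integral_neg_eq_self (fun k => g k * F k) _
  simp only [add_mul]
  rw [integral_add hi (h3.congr h2.symm), integral_congr_ae h2, h4]
  ring

theorem integral_odd_mul {F g : ℝ → ℝ} (hF : ∀ᵐ k : ℝ, F (-k) = -F k)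
    (hi : Integrable fun k => g k * F k) :
    ∫ k, (g k - g (-k)) * F k = 2 * ∫ k, g k * F k := by
  have h2 : (fun k => g (-k) * F k) =ᵐ[volume] fun k => -(g (-k) * F (-k)) := by
    filter_upwards [hF] with k hk
    rw [hk, mul_neg, neg_neg]
  have h3 : Integrable fun k => g (-k) * F (-k) := hi.comp_neg
  have h4 : ∫ k, g (-k) * F (-k) = ∫ k, g k * F k := integral_neg_eq_self (fun k => g k * F k) _
  simp only [sub_mul]
  rw [integral_sub hi (h3.neg.congr h2.symm), integral_congr_ae h2, integral_neg, h4]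
  ring

/-- From w|f| ≤ w + w|f|². The origin is removed because some of the weights are not integrable
there. -/
theorem Sob.locallyIntegrableOn {w : Weight} (hw : w.Regular) (f : Sob w) :
    LocallyIntegrableOn (fun k => w k * ‖(f : FreqFun) k‖) {0}ᶜ := by
  have h1 : LocallyIntegrableOn (fun k => w k + w k * ‖(f : FreqFun) k‖ ^ 2) {0}ᶜ :=
    (hw.cont.locallyIntegrableOn isOpen_compl_singleton.measurableSet).add
      (f.2.2.locallyIntegrable.locallyIntegrableOn _)
  refine h1.mono ?_ ?_
  · exact (w.meas.aemeasurable.mul (f : FreqFun).aemeasurable.norm).aestronglyMeasurable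
  · filter_upwards [w.ae_pos] with k hk
    rw [Real.norm_of_nonneg (by positivity), Real.norm_of_nonneg (by positivity)]
    nlinarith [sq_nonneg (‖(f : FreqFun) k‖ - 1), norm_nonneg ((f : FreqFun) k)]

/-- An f orthogonal to all test functions satisfies ∫ g·w·Re f = ∫ g·w·Im f = 0 for every real bump
g supported off the origin, so w f vanishes a.e. by the fundamental lemma of the calculus of
variations. -/
theorem testSub_dense {w : Weight} (hw : w.Regular) : (testSub w).topologicalClosure = ⊤ := by
  rw [Submodule.topologicalClosure_eq_top_iff, Submodule.eq_bot_iff]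
  intro f hf
  rw [Submodule.mem_orthogonal] at hf
  have hU : IsOpen ({0}ᶜ : Set ℝ) := isOpen_compl_singleton
  have hloc := Sob.locallyIntegrableOn hw f
  have hmre : AEStronglyMeasurable (fun k => w k * ((f : FreqFun) k).re) volume :=
    (w.meas.aemeasurable.mul
      (Complex.measurable_re.comp_aemeasurable (f : FreqFun).aemeasurable)).aestronglyMeasurable
  have hmim : AEStronglyMeasurable (fun k => w k * ((f : FreqFun) k).im) volume :=
    (w.meas.aemeasurable.mul
      (Complex.measurable_im.comp_aemeasurable (f : FreqFun).aemeasurable)).aestronglyMeasurable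
  have hlre : LocallyIntegrableOn (fun k => w k * ((f : FreqFun) k).re) {0}ᶜ := by
    refine hloc.mono hmre ?_
    filter_upwards [w.ae_pos] with k hk
    rw [norm_mul, norm_mul, norm_norm]
    exact mul_le_mul_of_nonneg_left (Complex.abs_re_le_norm _) (norm_nonneg _)
  have hlim : LocallyIntegrableOn (fun k => w k * ((f : FreqFun) k).im) {0}ᶜ := by
    refine hloc.mono hmim ?_
    filter_upwards [w.ae_pos] with k hk
    rw [norm_mul, norm_mul, norm_norm]
    exact mul_le_mul_of_nonneg_left (Complex.abs_im_le_norm _) (norm_nonneg _)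
  have hint : ∀ g : ℝ → ℝ, ContDiff ℝ ∞ g → HasCompactSupport g → tsupport g ⊆ {0}ᶜ →
      ∀ F : ℝ → ℝ, LocallyIntegrableOn F {0}ᶜ → Integrable fun k => g k * F k := by
    intro g hg hc hs F hF
    have h1 : IntegrableOn F (tsupport g) := hF.integrableOn_compact_subset hs hc
    have h2 : IntegrableOn (fun k => g k * F k) (tsupport g) :=
      h1.continuousOn_mul hg.continuous.continuousOn hc
    refine (integrableOn_iff_integrable_of_support_subset ?_).1 h2
    exact (Function.support_mul_subset_left _ _).trans subset_closure
  have hinner : ∀ (φ : ℝ → ℂ) (hφ : IsTest φ),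
      ∫ k, w k * (φ k * conj ((f : FreqFun) k)).re = 0 := by
    intro φ hφ
    rw [← hf _ (hφ.toSob_mem hw)]
    refine integral_congr_ae ?_
    filter_upwards [hφ.toSob_ae hw] with k hk
    rw [hk]
  -- The Hermitian test function cg(k) + c̄g(-k) sees the even function w·Re f for c = 1 and, below,
  -- the odd function w·Im f for c = i.
  have hre : ∀ᵐ k : ℝ, k ∈ ({0}ᶜ : Set ℝ) → w k * ((f : FreqFun) k).re = 0 := by
    refine hU.ae_eq_zero_of_integral_contDiff_smul_eq_zero hlre fun g hg hc hs => ?_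
    have h1 := hinner _ (isTest_symm hg hc (fun h => hs h rfl) 1)
    have h2 := integral_even_mul (F := fun k => w k * ((f : FreqFun) k).re) (g := g) (by
      filter_upwards [f.2.1] with k hk
      rw [hk, hw.even, Complex.conj_re]) (hint g hg hc hs _ hlre)
    have h3 : ∫ k, (g k + g (-k)) * (w k * ((f : FreqFun) k).re) = 0 := by
      rw [← h1]
      congr 1
      ext k
      simp
      ring
    simp only [smul_eq_mul]
    linarith
  have him : ∀ᵐ k : ℝ, k ∈ ({0}ᶜ : Set ℝ) → w k * ((f : FreqFun) k).im = 0 := by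
    refine hU.ae_eq_zero_of_integral_contDiff_smul_eq_zero hlim fun g hg hc hs => ?_
    have h1 := hinner _ (isTest_symm hg hc (fun h => hs h rfl) Complex.I)
    have h2 := integral_odd_mul (F := fun k => w k * ((f : FreqFun) k).im) (g := g) (by
      filter_upwards [f.2.1] with k hk
      rw [hk, hw.even, Complex.conj_im]
      ring) (hint g hg hc hs _ hlim)
    have h3 : ∫ k, (g k - g (-k)) * (w k * ((f : FreqFun) k).im) = 0 := by
      rw [← h1]
      congr 1
      ext k
      simp
      ring
    simp only [smul_eq_mul]
    linarith
  refine Sob.ext_ae ?_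
  have h0 : ∀ᵐ k : ℝ, ((0 : Sob w) : FreqFun) k = 0 := AEEqFun.coeFn_zero
  filter_upwards [hre, him, ae_ne_zero, h0] with k h1 h2 hk hz
  have hp := (w.pos k hk).ne'
  rw [hz]
  exact Complex.ext ((mul_eq_zero.1 (h1 hk)).resolve_left hp)
    ((mul_eq_zero.1 (h2 hk)).resolve_left hp)

theorem testSub_denseSet {w : Weight} (hw : w.Regular) : Dense (testSub w : Set (Sob w)) := by
  rw [dense_iff_closure_eq, ← Submodule.topologicalClosure_coe, testSub_dense hw]
  rfl

/-- A norm bound from a bound on the pairing with test functions. -/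
theorem Sob.norm_le_of_dual {w v : Weight} (h : DualWeights w v) (hv : v.Regular) (f : Sob w)
    {M : ℝ} (hM0 : 0 ≤ M) (hM : ∀ q ∈ testSub v, |dual q f| ≤ M * ‖q‖) : ‖f‖ ≤ M := by
  have h1 : ∀ q : Sob v, |dual q f| ≤ M * ‖q‖ := by
    intro q
    have hcl : IsClosed {q : Sob v | |dualL h q f| ≤ M * ‖q‖} :=
      isClosed_le (by fun_prop) (by fun_prop)
    have := (testSub_denseSet hv).induction (P := fun q : Sob v => |dualL h q f| ≤ M * ‖q‖)
      (fun q hq => by rw [dualL_apply]; exact hM q hq) hcl q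
    rwa [dualL_apply] at this
  -- Testing with q = w f, whose norm is ‖f‖ and whose pairing with f is ‖f‖².
  have h2 := h1 (Sob.mul h.multiplier f)
  rw [← inner_eq_dual h, real_inner_self_eq_norm_sq, LinearIsometry.norm_map,
    abs_of_nonneg (by positivity)] at h2
  rcases eq_or_lt_of_le (norm_nonneg f) with h3 | h3
  · rwa [← h3]
  · nlinarith

end TwoLayer
end

/-! ### Lax–Milgram for a pairing, and minimal lifts for a closed trace relation. -/

noncomputable section

namespace TwoLayer

open scoped ComplexConjugate ContDiff

/-! ### Coercive operators -/

section Abstract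

variable {E F : Type*} [NormedAddCommGroup E] [InnerProductSpace ℝ E]

theorem isInvertible_of_bijective {E F : Type*} [NormedAddCommGroup E] [NormedSpace ℝ E]
    [CompleteSpace E] [NormedAddCommGroup F] [NormedSpace ℝ F] [CompleteSpace F]
    {A : E →L[ℝ] F} (h : Function.Bijective A) : A.IsInvertible :=
  ⟨ContinuousLinearEquiv.ofBijective A (LinearMap.ker_eq_bot.2 h.1) (LinearMap.range_eq_top.2 h.2),
    ContinuousLinearEquiv.coe_ofBijective _ _ _⟩

/-- Lax–Milgram for the form p(Ax, w) solves p(Ax) = p(y) in the dual of E, and injectivity of p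
cancels it. Surjectivity of p is not needed. -/
theorem isInvertible_of_coercive [CompleteSpace E] [NormedAddCommGroup F] [NormedSpace ℝ F] [CompleteSpace F]
    (p : F →L[ℝ] E →L[ℝ] ℝ) (hp : Function.Injective p) (A : E →L[ℝ] F) {c : ℝ} (hc : 0 < c)
    (h : ∀ x, c * ‖x‖ ^ 2 ≤ p (A x) x) : A.IsInvertible := by
  have hB : IsCoercive (p ∘L A) := ⟨c, hc, fun x => by
    rw [mul_assoc, ← sq]
    exact h x⟩
  refine isInvertible_of_bijective ⟨?_, ?_⟩
  · rw [injective_iff_map_eq_zero]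
    intro x hx
    have h1 := h x
    rw [hx, map_zero, zero_apply] at h1
    have : ‖x‖ ^ 2 = 0 := le_antisymm (by nlinarith) (sq_nonneg _)
    simpa using this
  · intro y
    refine ⟨hB.continuousLinearEquivOfBilin.symm ((InnerProductSpace.toDual ℝ E).symm (p y)),
      hp ?_⟩
    ext w
    have h1 := hB.continuousLinearEquivOfBilin_apply
      (hB.continuousLinearEquivOfBilin.symm ((InnerProductSpace.toDual ℝ E).symm (p y))) w
    rw [ContinuousLinearEquiv.apply_symm_apply, InnerProductSpace.toDual_symm_apply] at h1
    exact h1.symm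

/-- The inverse of an invertible operator that is coercive for a pairing is coercive. -/
theorem inverse_coercive [NormedAddCommGroup F] [NormedSpace ℝ F]
    (p : F → E → ℝ) (A : E →L[ℝ] F) (hA : A.IsInvertible) {c : ℝ} (hc : 0 < c)
    (h : ∀ x, c * ‖x‖ ^ 2 ≤ p (A x) x) :
    ∃ c' : ℝ, 0 < c' ∧ ∀ y, c' * ‖y‖ ^ 2 ≤ p y (A.inverse y) := by
  refine ⟨c / (‖A‖ + 1) ^ 2, by positivity, fun y => ?_⟩
  have h1 := h (A.inverse y)
  have h2 : A (A.inverse y) = y := hA.self_apply_inverse y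
  rw [h2] at h1
  refine le_trans ?_ h1
  have h3 : ‖y‖ ≤ (‖A‖ + 1) * ‖A.inverse y‖ := by
    have := A.le_opNorm (A.inverse y)
    rw [h2] at this
    nlinarith [norm_nonneg (A.inverse y)]
  rw [div_mul_eq_mul_div, div_le_iff₀ (by positivity), mul_assoc, ← mul_pow]
  refine mul_le_mul_of_nonneg_left (pow_le_pow_left₀ (norm_nonneg _) ?_ 2) hc.le
  rwa [mul_comm]

/-! ### Trace systems -/

/-- `g` is the element of least norm with trace `Φ`. -/
def IsHarmonicLift [NormedAddCommGroup F] [NormedSpace ℝ F] (T : Submodule ℝ (E × F)) (Φ : F)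
    (g : E) : Prop := (g, Φ) ∈ T ∧ ∀ h, (h, (0 : F)) ∈ T → inner ℝ g h = 0

variable [NormedAddCommGroup F] [NormedSpace ℝ F] {T : Submodule ℝ (E × F)}

theorem IsHarmonicLift.unique {Φ : F} {g g' : E} (hg : IsHarmonicLift T Φ g)
    (hg' : IsHarmonicLift T Φ g') : g = g' := by
  have h1 : (g - g', (0 : F)) ∈ T := by
    have := T.sub_mem hg.1 hg'.1
    rwa [Prod.mk_sub_mk, sub_self] at this
  have h2 : inner ℝ (g - g') (g - g') = 0 := by
    rw [inner_sub_left, hg.2 _ h1, hg'.2 _ h1, sub_zero]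
  exact sub_eq_zero.1 (inner_self_eq_zero.1 h2)

theorem IsHarmonicLift.add {Φ Φ' : F} {g g' : E} (hg : IsHarmonicLift T Φ g)
    (hg' : IsHarmonicLift T Φ' g') : IsHarmonicLift T (Φ + Φ') (g + g') :=
  ⟨T.add_mem hg.1 hg'.1, fun h hh => by rw [inner_add_left, hg.2 h hh, hg'.2 h hh, add_zero]⟩

theorem IsHarmonicLift.smul {Φ : F} {g : E} (hg : IsHarmonicLift T Φ g) (c : ℝ) :
    IsHarmonicLift T (c • Φ) (c • g) :=
  ⟨T.smul_mem c hg.1, fun h hh => by rw [real_inner_smul_left, hg.2 h hh, mul_zero]⟩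

/-- Removing from any lift its orthogonal projection onto the closed space of elements with zero
trace leaves the trace unchanged and does not increase the norm: Dirichlet's principle. -/
theorem exists_isHarmonicLift [CompleteSpace E] (hT : IsClosed (T : Set (E × F))) {Φ : F} {g₀ : E}
    (h0 : (g₀, Φ) ∈ T) : ∃ g, IsHarmonicLift T Φ g ∧ ‖g‖ ≤ ‖g₀‖ := by
  set Z : Submodule ℝ E := T.comap (LinearMap.inl ℝ E F)
  have hZ : IsClosed (Z : Set E) :=
    hT.preimage (f := fun h : E => (h, (0 : F))) (by fun_prop)
  have : CompleteSpace Z := hZ.completeSpace_coe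
  refine ⟨g₀ - Z.starProjection g₀, ⟨?_, fun h hh => ?_⟩, ?_⟩
  · have h1 : (Z.starProjection g₀, (0 : F)) ∈ T := Z.starProjection_apply_mem g₀
    have := T.sub_mem h0 h1
    rwa [Prod.mk_sub_mk, sub_zero] at this
  · exact Z.starProjection_inner_eq_zero g₀ h hh
  · have h2 : inner ℝ (g₀ - Z.starProjection g₀) (Z.starProjection g₀) = 0 :=
      Z.starProjection_inner_eq_zero g₀ _ (Z.starProjection_apply_mem g₀)
    have h3 : ‖g₀ - Z.starProjection g₀‖ ^ 2 = inner ℝ (g₀ - Z.starProjection g₀) g₀ := by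
      rw [← real_inner_self_eq_norm_sq, inner_sub_right, h2, sub_zero]
    have h4 := real_inner_le_norm (g₀ - Z.starProjection g₀) g₀
    rcases eq_or_lt_of_le (norm_nonneg (g₀ - Z.starProjection g₀)) with h5 | h5
    · rw [← h5]
      exact norm_nonneg _
    · nlinarith

/-- T is complete, so the successive approximation behind the open mapping theorem turns bounded
lifts on the dense set D into bounded lifts of every Φ. The harmonic lift is the smallest of these;
uniqueness makes it linear, and the trace bound `h1` bounds it from below. -/
theorem harmonicLift_of_dense [CompleteSpace E] [CompleteSpace F]
    (hT : IsClosed (T : Set (E × F)))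
    {C₁ C₂ : ℝ} (hC₂ : 0 < C₂)
    (h1 : ∀ g Φ, (g, Φ) ∈ T → ‖Φ‖ ≤ C₁ * ‖g‖) {D : Submodule ℝ F} (hD : D.topologicalClosure = ⊤)
    (h2 : ∀ Φ ∈ D, ∃ g, (g, Φ) ∈ T ∧ ‖g‖ ≤ C₂ * ‖Φ‖) :
    ∃ H : F →L[ℝ] E, (∀ Φ, IsHarmonicLift T Φ (H Φ)) ∧
      ∃ c : ℝ, 0 < c ∧ ∀ Φ, c * ‖Φ‖ ^ 2 ≤ inner ℝ (H Φ) (H Φ) := by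
  have : CompleteSpace T := hT.completeSpace_coe
  set f : NormedAddGroupHom T F :=
    { toFun := fun τ => τ.1.2
      map_add' := fun _ _ => rfl
      bound' := ⟨1, fun τ => by rw [one_mul]; exact norm_snd_le τ.1⟩ }
  have hsurj : f.SurjectiveOnWith D.toAddSubgroup (C₂ + 1) := by
    intro Φ hΦ
    obtain ⟨g, hg, hn⟩ := h2 Φ hΦ
    refine ⟨⟨(g, Φ), hg⟩, rfl, ?_⟩
    rw [Submodule.coe_norm, Prod.norm_def]
    refine max_le ?_ ?_ <;> nlinarith [norm_nonneg Φ]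
  have hsurj' := controlled_closure_of_complete (by linarith) one_pos hsurj
  have hall : ∀ Φ : F, ∃ g, (g, Φ) ∈ T ∧ ‖g‖ ≤ (C₂ + 1 + 1) * ‖Φ‖ := by
    intro Φ
    have hm : Φ ∈ D.toAddSubgroup.topologicalClosure := by
      have : Φ ∈ D.topologicalClosure := hD ▸ Submodule.mem_top
      exact this
    obtain ⟨⟨⟨g, Φ'⟩, hg⟩, rfl, hn⟩ := hsurj' Φ hm
    exact ⟨g, hg, (norm_fst_le (g, Φ')).trans hn⟩
  have hex : ∀ Φ : F, ∃ g, IsHarmonicLift T Φ g ∧ ‖g‖ ≤ (C₂ + 1 + 1) * ‖Φ‖ := by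
    intro Φ
    obtain ⟨g₀, h0, hn⟩ := hall Φ
    obtain ⟨g, hg, hgn⟩ := exists_isHarmonicLift hT h0
    exact ⟨g, hg, hgn.trans hn⟩
  choose H hH hHn using hex
  refine ⟨LinearMap.mkContinuous
    { toFun := H
      map_add' := fun x y => (hH (x + y)).unique ((hH x).add (hH y))
      map_smul' := fun c x => (hH (c • x)).unique ((hH x).smul c) } _ hHn, hH, ?_⟩
  -- Coercivity is ‖Φ‖ ≤ C₁‖HΦ‖ squared; |C₁| + 1 guards against a nonpositive C₁.
  refine ⟨((|C₁| + 1) ^ 2)⁻¹, by positivity, fun Φ => ?_⟩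
  rw [real_inner_self_eq_norm_sq, inv_mul_le_iff₀ (by positivity), ← mul_pow]
  refine pow_le_pow_left₀ (norm_nonneg _) ?_ 2
  refine (h1 _ _ (hH Φ).1).trans ?_
  refine mul_le_mul_of_nonneg_right ?_ (norm_nonneg _)
  linarith [le_abs_self C₁]

/-- The operator representing the Dirichlet form of a lift, for a perfect pairing. -/
theorem exists_dirichletOperator {F' : Type*} [NormedAddCommGroup F'] [NormedSpace ℝ F']
    [CompleteSpace F'] [CompleteSpace F] (p : F' →L[ℝ] F →L[ℝ] ℝ) (hp : Function.Bijective p)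
    (H : F →L[ℝ] E) : ∃ G : F →L[ℝ] F', ∀ Φ Φ', p (G Φ) Φ' = inner ℝ (H Φ) (H Φ') := by
  obtain ⟨P, hP⟩ := isInvertible_of_bijective hp
  set a : F →L[ℝ] F →L[ℝ] ℝ := (innerSL ℝ : E →L[ℝ] E →L[ℝ] ℝ).bilinearComp H H
  refine ⟨(P.symm : (F →L[ℝ] ℝ) →L[ℝ] F') ∘L a, fun Φ Φ' => ?_⟩
  have : p (P.symm (a Φ)) = a Φ := by
    rw [← hP]
    exact P.apply_symm_apply _
  show p (P.symm (a Φ)) Φ' = _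
  rw [this]
  rfl

end Abstract

end TwoLayer
end

/-! ### Perfect pairings of spaces of pairs; coercivity of B and N. -/

noncomputable section

namespace TwoLayer

open scoped ComplexConjugate ContDiff

/-! ### Pairings between spaces of pairs -/

section Pairings

variable {w v w' v' : Weight}

/-- The pairing `⟨Ψ₂, Φ₂ - Φ₁⟩ + ⟨Ψ₂ + Ψ₁, Φ₁⟩` as a bounded bilinear form. -/
def dualPairL (h₁ : DualWeights w v') (h₂ : DualWeights v w') :
    PairSob w' 1 v' →L[ℝ] PairSob w (-1) v →L[ℝ] ℝ :=
  (dualL h₂).bilinearComp PairSob.snd PairSob.comb +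
    (dualL h₁).bilinearComp PairSob.comb PairSob.fst

theorem dualPair_eq (Ψ : PairSob w' 1 v') (Φ : PairSob w (-1) v) :
    dualPair Ψ Φ = dual (PairSob.snd Ψ) (PairSob.comb Φ) +
      dual (PairSob.comb Ψ) (PairSob.fst Φ) := by
  show dual Ψ.1.2 (Φ.1.2 - Φ.1.1) + dual (Ψ.1.2 + Ψ.1.1) Φ.1.1 =
    dual Ψ.1.2 (Φ.1.2 + (-1 : ℝ) • Φ.1.1) + dual (Ψ.1.2 + (1 : ℝ) • Ψ.1.1) Φ.1.1
  rw [negOne_smul, ← sub_eq_add_neg, one_smul]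

theorem dualPairL_apply (h₁ : DualWeights w v') (h₂ : DualWeights v w')
    (Ψ : PairSob w' 1 v') (Φ : PairSob w (-1) v) : dualPairL h₁ h₂ Ψ Φ = dualPair Ψ Φ := by
  rw [dualPair_eq, ← dualL_apply h₂, ← dualL_apply h₁]
  rfl

/-- In the coordinates Φ₁ and Φ₂ - Φ₁, which vary independently over `Sob w` and `Sob v`, the
pairing is a sum of two nondegenerate scalar pairings. -/
theorem dualPairL_injective (h₁ : DualWeights w v') (h₂ : DualWeights v w')
    (hw : ∀ k, k ≠ 0 → w k ≤ v k) : Function.Injective (dualPairL h₁ h₂) := by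
  rw [injective_iff_map_eq_zero]
  intro Ψ hΨ
  have key : ∀ (a : Sob w) (b : Sob v),
      dualL h₂ (PairSob.snd Ψ) b + dualL h₁ (PairSob.comb Ψ) a = 0 := by
    intro a b
    have h3 : dualPairL h₁ h₂ Ψ ((PairSob.equivProd hw).symm (a, b)) = 0 := by rw [hΨ]; rfl
    have h4 := (PairSob.equivProd (s := -1) hw).apply_symm_apply (a, b)
    rw [PairSob.equivProd_apply] at h4
    have h5 := congrArg Prod.fst h4
    have h6 := congrArg Prod.snd h4
    simp only at h5 h6
    rw [dualPairL_apply, dualPair_eq, h5, h6] at h3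
    rwa [dualL_apply, dualL_apply]
  have h2 : PairSob.snd Ψ = 0 := dualL_injective h₂ (by
    ext b
    simpa using key 0 b)
  have h1 : PairSob.comb Ψ = 0 := dualL_injective h₁ (by
    ext a
    simpa using key a 0)
  have h3 : (Ψ.1.2 : FreqFun) = 0 := congrArg Subtype.val h2
  have h4 : (Ψ.1.2 + (1 : ℝ) • Ψ.1.1 : FreqFun) = 0 := congrArg Subtype.val h1
  rw [h3, zero_add, one_smul] at h4
  exact Subtype.ext (Prod.ext h4 h3)

/-- Riesz representatives S and R of ℓ in the coordinates Φ₁ and Φ₂ - Φ₁ must be Ψ₁ + Ψ₂ and Ψ₂,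
which forces Ψ = (S - R, R). -/
theorem dualPairL_surjective (h₁ : DualWeights w v') (h₂ : DualWeights v w')
    (hw : ∀ k, k ≠ 0 → w k ≤ v k) (hw' : ∀ k, k ≠ 0 → w' k ≤ v' k) :
    Function.Surjective (dualPairL h₁ h₂) := by
  intro ℓ
  set e := PairSob.equivProd (s := -1) hw
  obtain ⟨S, hS⟩ := dualL_surjective h₁
    (ℓ ∘L (e.symm : Sob w × Sob v →L[ℝ] _) ∘L ContinuousLinearMap.inl ℝ _ _)
  obtain ⟨R, hR⟩ := dualL_surjective h₂
    (ℓ ∘L (e.symm : Sob w × Sob v →L[ℝ] _) ∘L ContinuousLinearMap.inr ℝ _ _)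
  refine ⟨⟨((S : FreqFun) - R, R), ?_, ?_, ?_⟩, ?_⟩
  · exact (Sob w').sub_mem (Sob.incl hw' S).2 R.2
  · exact R.2
  · show (R : FreqFun) + (1 : ℝ) • ((S : FreqFun) - R) ∈ Sob v'
    rw [one_smul, add_sub_cancel]
    exact S.2
  · ext Φ
    have h3 : ℓ Φ = ℓ (e.symm (PairSob.fst Φ, 0)) + ℓ (e.symm (0, PairSob.comb Φ)) := by
      rw [← map_add, ← map_add, Prod.mk_add_mk, add_zero, zero_add]
      exact congrArg ℓ (e.symm_apply_apply Φ).symm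
    have h4 : dual S (PairSob.fst Φ) = ℓ (e.symm (PairSob.fst Φ, 0)) := by
      rw [← dualL_apply h₁, hS]
      rfl
    have h5 : dual R (PairSob.comb Φ) = ℓ (e.symm (0, PairSob.comb Φ)) := by
      rw [← dualL_apply h₂, hR]
      rfl
    rw [dualPairL_apply, dualPair_eq, h3, ← h4, ← h5, add_comm]
    congr 2
    show (R : FreqFun) + (1 : ℝ) • ((S : FreqFun) - R) = S
    rw [one_smul, add_sub_cancel]

end Pairings

/-- The pairing of `Y` and `X`. -/
def pairYX : SpY →L[ℝ] SpX →L[ℝ] ℝ := dualPairL dualWeights_star dualWeights_half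

/-- The pairing of `Y̆` and `X̆`. -/
def pairYbXb : SpYb →L[ℝ] SpXb →L[ℝ] ℝ := dualPairL dualWeights_dot dualWeights_half

theorem pairYX_bijective : Function.Bijective pairYX :=
  ⟨dualPairL_injective _ _ wStarHalf_le_wHalf,
    dualPairL_surjective _ _ wStarHalf_le_wHalf wNegHalf_le_wStarNegHalf⟩

theorem pairYbXb_injective : Function.Injective pairYbXb :=
  dualPairL_injective _ _ wDotHalf_le_wHalf

theorem dualWeights_dot_symm : DualWeights wDotNegHalf wDotHalf where
  even := regular_wDotNegHalf.even
  mul k hk := by rw [mul_comm]; exact dualWeights_dot.mul k hk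

theorem dualWeights_star_symm : DualWeights wStarNegHalf wStarHalf where
  even := regular_wStarNegHalf.even
  mul k hk := by rw [mul_comm]; exact dualWeights_star.mul k hk

/-- The pairing of `X̃` and `Ỹ`, formally `⟨ξ₁, ζ₁⟩ + ⟨ξ₂, ζ₂⟩`. -/
def pairXtYt : SpXt →L[ℝ] SpYt →L[ℝ] ℝ :=
  dualPairL dualWeights_dot_symm dualWeights_star_symm

theorem pairXtYt_injective : Function.Injective pairXtYt :=
  dualPairL_injective _ _ wDotNegHalf_le_wStarNegHalf

/-! ### Coercivity of the interface operators -/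

theorem PairSob.lift_comb_coe {w v : Weight} {s : ℝ} {E : Type} [NormedAddCommGroup E]
    [NormedSpace ℝ E] (A B : E →L[ℝ] Sob w) (C : E →L[ℝ] Sob v)
    (h : ∀ x, (B x : FreqFun) + s • (A x : FreqFun) = C x) (x : E) :
    (PairSob.comb (PairSob.lift A B C h x) : FreqFun) = C x := h x

section Operators

variable (η : (ℝ → ℝ) × (ℝ → ℝ)) (ρ : ℝ)

theorem dualPair_injX₁ (Ψ : SpY) (g : HHalf) : dualPair Ψ (injX₁ g) = dual (PairSob.fst Ψ) g := by
  have h1 : dualPair Ψ (injX₁ g) = pairYX Ψ (injX₁ g) := (dualPairL_apply _ _ _ _).symm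
  rw [dualPair_eq]
  have h2 : PairSob.comb (injX₁ g) = -g := Subtype.ext (by
    show (0 : FreqFun) + (-1 : ℝ) • (g : FreqFun) = -(g : FreqFun)
    rw [negOne_smul, zero_add])
  have h3 : dual (PairSob.comb Ψ) (PairSob.fst (injX₁ g)) =
      dual (Sob.incl wNegHalf_le_wStarNegHalf (PairSob.comb Ψ)) g := rfl
  have h4 : Sob.incl wNegHalf_le_wStarNegHalf (PairSob.comb Ψ) =
      PairSob.snd Ψ + PairSob.fst Ψ := Subtype.ext (by
    show Ψ.1.2 + (1 : ℝ) • Ψ.1.1 = Ψ.1.2 + Ψ.1.1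
    rw [one_smul])
  rw [h2, h3, h4, ← dualL_apply dualWeights_half, ← dualL_apply dualWeights_half,
    ← dualL_apply dualWeights_half, map_neg, map_add, add_apply]
  ring

variable {η ρ}

/-- ⟨Bf,f⟩ is the upper form at (f, 0) plus ρ times the lower form at f. The X-norm of (f, 0)
already dominates ‖f‖ in H^{1/2} through its difference component, so the upper form alone gives
coercivity. -/
theorem opB_isInvertible (hρ : 0 < ρ) {cA cU : ℝ} (hcA : 0 < cA) (hcU : 0 < cU)
    (hA : ∀ Φ, cA * ‖Φ‖ ^ 2 ≤ dual (lowerG η Φ) Φ)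
    (hU : ∀ Φ, cU * ‖Φ‖ ^ 2 ≤ dualPair (upperG η Φ) Φ) : (opB η ρ).IsInvertible := by
  refine isInvertible_of_coercive (dualL dualWeights_half) (dualL_injective _) _ hcU fun f => ?_
  have h1 : dualL dualWeights_half (opB η ρ f) f =
      dualPair (upperG η (injX₁ f)) (injX₁ f) + ρ * dual (lowerG η (inclHalfDot f))
        (inclHalfDot f) := by
    have e : opB η ρ f = G₁₁ η f + ρ • Glow η f := rfl
    rw [e, map_add, map_smul, add_apply, smul_apply, dualL_apply, dualL_apply, smul_eq_mul,
      dualPair_injX₁]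
    rfl
  have h2 : ‖f‖ ^ 2 ≤ ‖injX₁ f‖ ^ 2 := by
    have h3 : PairSob.comb (injX₁ f) = -f := Subtype.ext (by
      show (0 : FreqFun) + (-1 : ℝ) • (f : FreqFun) = -(f : FreqFun)
      rw [negOne_smul, zero_add])
    rw [PairSob.norm_sq_eq, h3, norm_neg]
    nlinarith [sq_nonneg ‖PairSob.fst (injX₁ f)‖, sq_nonneg ‖PairSob.snd (injX₁ f)‖]
  rw [h1]
  have h4 := hA (inclHalfDot f)
  have h5 := hU (injX₁ f)
  have h6 : 0 ≤ ρ * dual (lowerG η (inclHalfDot f)) (inclHalfDot f) :=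
    mul_nonneg hρ.le (le_trans (by positivity) h4)
  nlinarith

theorem Sob.norm_incl_le {v w : Weight} (h : ∀ k, k ≠ 0 → w k ≤ v k) (f : Sob v) :
    ‖Sob.incl h f‖ ≤ ‖f‖ := by
  refine le_of_sq_le_sq ?_ (norm_nonneg _)
  rw [Sob.norm_sq, Sob.norm_sq]
  refine integral_mono_of_nonneg ?_ f.2.2 ?_
  · filter_upwards [w.ae_pos] with k hk
    show (0 : ℝ) ≤ _
    positivity
  filter_upwards [ae_ne_zero] with k hk
  exact mul_le_mul_of_nonneg_right (h k hk) (by positivity)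

/-- The formal identity is immediate from the matrix of N, but the entrywise products are not
defined on these spaces. Each component is therefore expanded through ζ₁, κ = ζ₂ - ζ₁, y₁ and d = y₂
- y₁, after which only genuine dual pairings occur and the terms match. -/
theorem pairXtYt_combinedN (ζ : SpYt) : pairXtYt (combinedN η ρ ζ) ζ =
    ρ * dualPair (flipSign ζ) (upperN η (flipSign ζ)) +
      dual (PairSob.fst ζ) (lowerN η (PairSob.fst ζ)) := by
  set y := upperN η (flipSign ζ) with hy
  set z := lowerN η (PairSob.fst ζ) with hz
  set ζ₁ : DotNegHalf := PairSob.fst ζ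
  set ζ₂ : DotNegHalf := PairSob.snd ζ
  set κ : StarNegHalf := PairSob.comb ζ
  set d : HHalf := PairSob.comb y
  set y₁ : StarHalf := PairSob.fst y
  have e1 : PairSob.snd (combinedN η ρ ζ) = -(ρ • PairSob.snd y) := rfl
  have e2 : PairSob.comb (combinedN η ρ ζ) = -(ρ • inclHalfDot d) + z :=
    Subtype.ext (PairSob.lift_comb_coe _ _ _ _ _)
  have e3 : PairSob.snd y = inclHalfStar d + y₁ := Subtype.ext (by
    show y.1.2 = (y.1.2 + (-1 : ℝ) • y.1.1) + y.1.1
    rw [negOne_smul]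
    abel)
  have e4 : PairSob.snd (flipSign ζ) = -inclDotNeg ζ₂ := rfl
  have e5 : PairSob.comb (flipSign ζ) = -κ := Subtype.ext (PairSob.lift_comb_coe _ _ _ _ _)
  have e6 : ζ₂ = Sob.incl wDotNegHalf_le_wStarNegHalf κ + ζ₁ := Subtype.ext (by
    show ζ.1.2 = (ζ.1.2 + (-1 : ℝ) • ζ.1.1) + ζ.1.1
    rw [negOne_smul]
    abel)
  have h1 : pairXtYt (combinedN η ρ ζ) ζ =
      dualL dualWeights_star_symm (PairSob.snd (combinedN η ρ ζ)) κ +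
      dualL dualWeights_dot_symm (PairSob.comb (combinedN η ρ ζ)) ζ₁ := rfl
  have h2 : dualPair (flipSign ζ) y =
      dualL dualWeights_half (PairSob.snd (flipSign ζ)) d +
      dualL dualWeights_star (PairSob.comb (flipSign ζ)) y₁ :=
    (dualPairL_apply dualWeights_star dualWeights_half _ _).symm
  rw [h1, h2, e1, e2, e3, e4, e5, e6]
  simp only [map_add, map_neg, map_smul, add_apply, neg_apply, smul_apply, smul_eq_mul,
    dualL_apply]
  have c1 : dual (inclHalfStar d) κ =
      dual (inclDotNeg (Sob.incl wDotNegHalf_le_wStarNegHalf κ)) d := dual_comm _ _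
  have c2 : dual y₁ κ = dual κ y₁ := dual_comm _ _
  have c3 : dual (inclHalfDot d) ζ₁ = dual (inclDotNeg ζ₁) d := dual_comm _ _
  have c4 : dual z ζ₁ = dual ζ₁ z := dual_comm _ _
  rw [c1, c2, c3, c4]
  ring

/-- The upper form controls ζ₂ - ζ₁ in H_⋆^{-1/2} and the lower one ζ₁ in Ḣ^{-1/2}. The norm of ζ₂
follows from ζ₂ = (ζ₂ - ζ₁) + ζ₁, whence ‖ζ‖² ≤ 3(‖ζ₂ - ζ₁‖² + ‖ζ₁‖²) and the factor 1/3. -/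
theorem combinedN_coercive (hρ : 0 < ρ) {cA cU : ℝ} (hcA : 0 < cA) (hcU : 0 < cU)
    (hA : ∀ ψ : DotNegHalf, cA * ‖ψ‖ ^ 2 ≤ dual ψ (lowerN η ψ))
    (hU : ∀ Ψ : SpY, cU * ‖Ψ‖ ^ 2 ≤ dualPair Ψ (upperN η Ψ)) :
    ∃ c : ℝ, 0 < c ∧ ∀ ζ, c * ‖ζ‖ ^ 2 ≤ pairXtYt (combinedN η ρ ζ) ζ := by
  refine ⟨min (ρ * cU) cA / 3, by positivity, fun ζ => ?_⟩
  set m := min (ρ * cU) cA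
  have hm : 0 < m := by positivity
  have hm1 : m ≤ ρ * cU := min_le_left _ _
  have hm2 : m ≤ cA := min_le_right _ _
  rw [pairXtYt_combinedN]
  have h1 := hA (PairSob.fst ζ)
  have h2 := hU (flipSign ζ)
  have h3 : ‖PairSob.comb ζ‖ ^ 2 ≤ ‖flipSign ζ‖ ^ 2 := by
    have e5 : PairSob.comb (flipSign ζ) = -PairSob.comb ζ :=
      Subtype.ext (PairSob.lift_comb_coe _ _ _ _ _)
    rw [PairSob.norm_sq_eq (flipSign ζ), e5, norm_neg]
    nlinarith [sq_nonneg ‖PairSob.fst (flipSign ζ)‖, sq_nonneg ‖PairSob.snd (flipSign ζ)‖]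
  have h4 : ‖PairSob.snd ζ‖ ≤ ‖PairSob.comb ζ‖ + ‖PairSob.fst ζ‖ := by
    have e6 : PairSob.snd ζ = Sob.incl wDotNegHalf_le_wStarNegHalf (PairSob.comb ζ)
        + PairSob.fst ζ := Subtype.ext (by
      show ζ.1.2 = (ζ.1.2 + (-1 : ℝ) • ζ.1.1) + ζ.1.1
      rw [negOne_smul]
      abel)
    rw [e6]
    refine (norm_add_le _ _).trans ?_
    gcongr
    exact Sob.norm_incl_le _ _
  have h5 : ‖PairSob.snd ζ‖ ^ 2 ≤ 2 * ‖PairSob.comb ζ‖ ^ 2 + 2 * ‖PairSob.fst ζ‖ ^ 2 := by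
    nlinarith [sq_nonneg (‖PairSob.comb ζ‖ - ‖PairSob.fst ζ‖), norm_nonneg (PairSob.snd ζ)]
  have h6 : ‖ζ‖ ^ 2 ≤ 3 * (‖PairSob.comb ζ‖ ^ 2 + ‖PairSob.fst ζ‖ ^ 2) := by
    rw [PairSob.norm_sq_eq ζ]
    linarith
  have h7 : m * ‖PairSob.comb ζ‖ ^ 2 ≤ ρ * dualPair (flipSign ζ) (upperN η (flipSign ζ)) := by
    calc m * ‖PairSob.comb ζ‖ ^ 2 ≤ (ρ * cU) * ‖flipSign ζ‖ ^ 2 := by gcongr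
      _ = ρ * (cU * ‖flipSign ζ‖ ^ 2) := by ring
      _ ≤ _ := by gcongr
  have h8 : m * ‖PairSob.fst ζ‖ ^ 2 ≤ cA * ‖PairSob.fst ζ‖ ^ 2 := by gcongr
  nlinarith

end Operators

end TwoLayer
end

/-! ### Identification of G with the inverse of N, and coercivity of K. -/

noncomputable section

namespace TwoLayer

open scoped ComplexConjugate ContDiff

/-! ### The combined operators -/

section Combined

variable {η : (ℝ → ℝ) × (ℝ → ℝ)} {ρ : ℝ}

/-- With ξ = (a, b), the equation Bf = G₁₁a - G₁₂b says that the upper operator applied to Φ = (a -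
f, -b) has first component ρ times the lower operator at f: the fluxes through the interface match.
Then (ζ₁, -ζ₂) = ρ⁻¹Ψ, where Ψ is the image of Φ, so applying N only undoes the two operators and
returns (a - f + f, b). -/
theorem exists_combinedN_eq (hρ : 0 < ρ) (hA : (lowerG η).IsInvertible)
    (hU : (upperG η).IsInvertible) (hB : (opB η ρ).IsInvertible) (ξ : HHalf × HHalf) :
    ∃ ζ : SpYt, (ζ : FreqFun × FreqFun) = ((row₁ η ρ ξ : FreqFun), (row₂ η ρ ξ : FreqFun)) ∧
      combinedN η ρ ζ = inclXt ξ := by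
  obtain ⟨a, b⟩ := ξ
  have hBinv : ∀ x, opB η ρ ((opB η ρ).inverse x) = x := fun x => hB.self_apply_inverse x
  have hBinv' : ∀ x, (opB η ρ).inverse (opB η ρ x) = x := fun x => hB.inverse_apply_self x
  set f := (opB η ρ).inverse (G₁₁ η a - G₁₂ η b) with hf
  set e := a - f with he
  set Φ : SpX := injX₁ e - injX₂ b with hΦ
  set Ψ : SpY := upperG η Φ with hΨ
  have hf1 : opB η ρ f = G₁₁ η a - G₁₂ η b := hBinv _
  have hB2 : ∀ x, opB η ρ x = G₁₁ η x + ρ • Glow η x := fun x => rfl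
  have hΨ1 : PairSob.fst Ψ = ρ • Glow η f := by
    have h1 : PairSob.fst Ψ = G₁₁ η e - G₁₂ η b := by
      rw [hΨ, hΦ, map_sub, map_sub]
      rfl
    rw [h1, he, map_sub, sub_right_comm, ← hf1, hB2]
    abel
  have hΨ2 : PairSob.snd Ψ = G₂₁ η e - G₂₂ η b := by
    rw [hΨ, hΦ, map_sub, map_sub]
    rfl
  have hrow1 : row₁ η ρ (a, b) = Glow η f := by
    simp only [row₁]
    rw [hf, map_sub, map_sub]
  have hrow2 : row₂ η ρ (a, b) = -(ρ⁻¹ • PairSob.snd Ψ) := by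
    -- The second row contains B⁻¹ composed with the lower operator, which is eliminated through
    -- ρ·(lower operator) = B - G₁₁.
    have h1 : (opB η ρ).inverse (Glow η a) = ρ⁻¹ • (a - (opB η ρ).inverse (G₁₁ η a)) := by
      have h2 : Glow η a = ρ⁻¹ • (opB η ρ a - G₁₁ η a) := by
        rw [hB2, add_sub_cancel_left, inv_smul_smul₀ hρ.ne']
      rw [h2, map_smul, map_sub, hBinv']
    simp only [row₂]
    rw [hΨ2, h1, he, hf]
    simp only [map_sub, map_smul, smul_sub]
    abel
  set f' := inclHalfDot f
  set κ : StarNegHalf := -(ρ⁻¹ • PairSob.comb Ψ) with hκ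
  -- The rows are only known to lie in H^{-1/2}. Membership in Ỹ holds because ζ₁ is a value of the
  -- lower operator and ζ₂ - ζ₁ = -ρ⁻¹(Ψ₁ + Ψ₂) lies in H_⋆^{-1/2}, as Ψ ∈ Y.
  set ζ : SpYt := (PairSob.equivProd wDotNegHalf_le_wStarNegHalf).symm (lowerG η f', κ)
  have hζ1 : PairSob.fst ζ = lowerG η f' := rfl
  have hΨ1' : Ψ.1.1 = ρ • (lowerG η f' : FreqFun) := congrArg Subtype.val hΨ1
  have hζ2 : ζ.1.2 = -(ρ⁻¹ • Ψ.1.2) := by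
    show -(ρ⁻¹ • (Ψ.1.2 + (1 : ℝ) • Ψ.1.1)) - (-1 : ℝ) • (lowerG η f' : FreqFun) = _
    rw [negOne_smul, hΨ1', one_smul, smul_add, inv_smul_smul₀ hρ.ne']
    abel
  have hflip : flipSign ζ = ρ⁻¹ • Ψ := by
    refine Subtype.ext (Prod.ext ?_ ?_)
    · show (lowerG η f' : FreqFun) = ρ⁻¹ • Ψ.1.1
      rw [hΨ1', inv_smul_smul₀ hρ.ne']
    · show -ζ.1.2 = ρ⁻¹ • Ψ.1.2
      rw [hζ2, neg_neg]
  have hN : upperN η (flipSign ζ) = ρ⁻¹ • Φ := by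
    rw [hflip, map_smul]
    congr 1
    exact hU.inverse_apply_self Φ
  have hNl : lowerN η (PairSob.fst ζ) = f' := by
    rw [hζ1]
    exact hA.inverse_apply_self f'
  refine ⟨ζ, Prod.ext ?_ ?_, ?_⟩
  · rw [hrow1]
    rfl
  · rw [hrow2]
    exact hζ2
  · refine Subtype.ext (Prod.ext ?_ ?_)
    · show ρ • (upperN η (flipSign ζ)).1.1 + (lowerN η (PairSob.fst ζ) : FreqFun) = (a : FreqFun)
      rw [hN, hNl]
      show ρ • (ρ⁻¹ • (((a : FreqFun) - f) - 0)) + (f : FreqFun) = a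
      rw [smul_inv_smul₀ hρ.ne']
      abel
    · show -(ρ • (upperN η (flipSign ζ)).1.2) = (b : FreqFun)
      rw [hN]
      show -(ρ • (ρ⁻¹ • ((0 : FreqFun) - b))) = (b : FreqFun)
      rw [smul_inv_smul₀ hρ.ne']
      abel

theorem theOperator_spec {E F : Type} [NormedAddCommGroup E] [NormedSpace ℝ E]
    [NormedAddCommGroup F] [NormedSpace ℝ F] {P : (E →L[ℝ] F) → Prop} (h : ∃ G, P G) :
    P (theOperator P) := by
  unfold theOperator
  rw [dif_pos h]
  exact h.choose_spec

theorem denseRange_incl {v w : Weight} (h : ∀ k, k ≠ 0 → w k ≤ v k) (hv : v.Regular)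
    (hw : w.Regular) : DenseRange (Sob.incl h) := by
  refine (testSub_denseSet hw).mono ?_
  rintro f ⟨φ, hφ, hf⟩
  refine ⟨hφ.toSob hv, Sob.ext_ae ?_⟩
  filter_upwards [hf, hφ.toSob_ae hv] with k h1 h2
  rw [h1, ← h2]
  rfl

/-- In the coordinates (ξ₁, ξ₁ + ξ₂) the inclusion becomes a product of two dense inclusions of
H^{1/2}. -/
theorem denseRange_inclXt : DenseRange inclXt := by
  set e := PairSob.equivProd (s := 1) wStarHalf_le_wDotHalf
  have h1 : DenseRange (Prod.map (Sob.incl wStarHalf_le_wHalf) (Sob.incl wDotHalf_le_wHalf)) :=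
    (denseRange_incl wStarHalf_le_wHalf regular_wHalf regular_wStarHalf).prodMap
      (denseRange_incl wDotHalf_le_wHalf regular_wHalf regular_wDotHalf)
  have h2 : DenseRange (e.symm ∘ Prod.map (Sob.incl wStarHalf_le_wHalf)
      (Sob.incl wDotHalf_le_wHalf)) :=
    e.symm.surjective.denseRange.comp h1 e.symm.continuous
  refine h2.mono ?_
  rintro _ ⟨⟨a, c⟩, rfl⟩
  refine ⟨(a, c - a), e.injective ?_⟩
  rw [Function.comp_apply, e.apply_symm_apply]
  refine Prod.ext rfl (Subtype.ext ?_)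
  show ((c : FreqFun) - a) + (1 : ℝ) • (a : FreqFun) = c
  rw [one_smul]
  abel

theorem existsUnique_isCombinedDNO (hρ : 0 < ρ) (hA : (lowerG η).IsInvertible)
    (hU : (upperG η).IsInvertible) (hB : (opB η ρ).IsInvertible)
    (hN : (combinedN η ρ).IsInvertible) : ∃! G, IsCombinedDNO η ρ G := by
  refine ⟨(combinedN η ρ).inverse, fun ξ => ?_, fun G hG => ?_⟩
  · obtain ⟨ζ, h1, h2⟩ := exists_combinedN_eq hρ hA hU hB ξ
    rw [← h2, hN.inverse_apply_self, h1]
  · refine ContinuousLinearMap.ext fun x => ?_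
    refine congrFun (denseRange_inclXt.equalizer G.continuous
      (combinedN η ρ).inverse.continuous (funext fun ξ => ?_)) x
    obtain ⟨ζ, h1, h2⟩ := exists_combinedN_eq hρ hA hU hB ξ
    rw [Function.comp_apply, Function.comp_apply, ← h2, hN.inverse_apply_self, h2]
    exact Subtype.ext ((hG ξ).trans h1.symm)

theorem combinedG_eq (hρ : 0 < ρ) (hA : (lowerG η).IsInvertible)
    (hU : (upperG η).IsInvertible) (hB : (opB η ρ).IsInvertible)
    (hN : (combinedN η ρ).IsInvertible) : combinedG η ρ = (combinedN η ρ).inverse := by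
  obtain ⟨G, hG, huniq⟩ := existsUnique_isCombinedDNO hρ hA hU hB hN
  have h1 : IsCombinedDNO η ρ (combinedG η ρ) := theOperator_spec ⟨G, hG⟩
  have h2 : IsCombinedDNO η ρ (combinedN η ρ).inverse := fun ξ => by
    obtain ⟨ζ, h1, h2⟩ := exists_combinedN_eq hρ hA hU hB ξ
    rw [← h2, hN.inverse_apply_self, h1]
  rw [huniq _ h1, huniq _ h2]

theorem dual_neg_freqDeriv (f g : FreqFun) : dual (-freqDeriv f) g = dual f (freqDeriv g) := by
  refine integral_congr_ae ?_
  filter_upwards [derivSymbol_mul f, derivSymbol_mul g, AEEqFun.coeFn_neg (freqDeriv f)]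
    with k h1 h2 h3
  have h1' : freqDeriv f k = Complex.I * (k : ℂ) * f k := h1
  have h2' : freqDeriv g k = Complex.I * (k : ℂ) * g k := h2
  rw [h3, Pi.neg_apply, h1', h2']
  simp only [map_mul, Complex.conj_I, Complex.conj_ofReal]
  congr 1
  ring

theorem norm_deriv (v w : Weight) (h : ∀ k, k ≠ 0 → k ^ 2 * w k = v k) (f : Sob v) :
    ‖Sob.deriv v w h f‖ = ‖f‖ := by
  rw [← sq_eq_sq₀ (norm_nonneg _) (norm_nonneg _), Sob.norm_sq, Sob.norm_sq]
  refine integral_congr_ae ?_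
  filter_upwards [derivSymbol_mul (f : FreqFun), ae_ne_zero] with k h1 hk
  have h1' : (Sob.deriv v w h f : FreqFun) k = Complex.I * (k : ℂ) * (f : FreqFun) k := h1
  rw [h1', ← h k hk]
  simp only [norm_mul, Complex.norm_I, Complex.norm_real, Real.norm_eq_abs, one_mul, mul_pow,
    sq_abs]
  ring

theorem norm_derivXb (ξ : SpXb) : ‖derivXb ξ‖ = ‖ξ‖ := by
  have n1 : ‖PairSob.fst (derivXb ξ)‖ = ‖PairSob.fst ξ‖ := norm_deriv _ _ deriv_dot _
  have n2 : ‖PairSob.snd (derivXb ξ)‖ = ‖PairSob.snd ξ‖ := norm_deriv _ _ deriv_dot _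
  have n3 : ‖PairSob.comb (derivXb ξ)‖ = ‖PairSob.comb ξ‖ := by
    have e3 : PairSob.comb (derivXb ξ) = Sob.deriv wHalf wStarNegHalf deriv_half (PairSob.comb ξ) :=
      Subtype.ext (PairSob.lift_comb_coe _ _ _ _ _)
    exact (congrArg norm e3).trans (norm_deriv _ _ deriv_half _)
  rw [← sq_eq_sq₀ (norm_nonneg _) (norm_nonneg _), PairSob.norm_sq_eq, PairSob.norm_sq_eq ξ,
    n1, n2, n3]

/-- ∂ₓ is skew for the scalar pairing, because conj(ik) = -ik, and commutes with forming sums and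
differences of components. -/
theorem dualPair_opK (ξ : SpXb) : dualPair (opK η ρ ξ) ξ =
    pairXtYt (combinedN η ρ (derivXb ξ)) (derivXb ξ) := by
  set χ := combinedN η ρ (derivXb ξ)
  have e3 : (PairSob.comb (derivXb ξ) : FreqFun) = freqDeriv (PairSob.comb ξ) :=
    PairSob.lift_comb_coe _ _ _ _ _
  have e4 : (PairSob.comb (opK η ρ ξ) : FreqFun) = -freqDeriv (PairSob.comb χ) := by
    show -freqDeriv χ.1.2 + (1 : ℝ) • -freqDeriv χ.1.1 = -freqDeriv (χ.1.2 + (1 : ℝ) • χ.1.1)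
    rw [map_add, one_smul, one_smul]
    abel
  have h1 : pairXtYt χ (derivXb ξ) = dual (PairSob.snd χ) (PairSob.comb (derivXb ξ)) +
      dual (PairSob.comb χ) (PairSob.fst (derivXb ξ)) := by
    rw [← dualL_apply dualWeights_star_symm, ← dualL_apply dualWeights_dot_symm]
    rfl
  have h2 : dual (PairSob.snd (opK η ρ ξ)) (PairSob.comb ξ) =
      dual (-freqDeriv (PairSob.snd χ)) (PairSob.comb ξ) := rfl
  rw [h1, dualPair_eq, e4, h2, dual_neg_freqDeriv, dual_neg_freqDeriv, e3]
  rfl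

/-- The conclusions of the main theorem, given coercive Dirichlet–Neumann operators. -/
theorem interface_operators (hρ : 0 < ρ) {cA cU : ℝ} (hcA : 0 < cA) (hcU : 0 < cU)
    (hA : ∀ Φ, cA * ‖Φ‖ ^ 2 ≤ dual (lowerG η Φ) Φ)
    (hU : ∀ Φ, cU * ‖Φ‖ ^ 2 ≤ dualPair (upperG η Φ) Φ) :
    (lowerG η).IsInvertible ∧ (upperG η).IsInvertible ∧ (opB η ρ).IsInvertible ∧
    (∃! G, IsCombinedDNO η ρ G) ∧ (combinedG η ρ).IsInvertible ∧
    (combinedG η ρ).inverse = combinedN η ρ ∧ (opK η ρ).IsInvertible ∧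
    ∃ c : ℝ, 0 < c ∧ ∀ ξ : SpXb, c * ‖ξ‖ ^ 2 ≤ dualPair (opK η ρ ξ) ξ := by
  have hAinv : (lowerG η).IsInvertible :=
    isInvertible_of_coercive (dualL dualWeights_dot) (dualL_injective _) _ hcA fun Φ => by
      rw [dualL_apply]
      exact hA Φ
  have hUinv : (upperG η).IsInvertible :=
    isInvertible_of_coercive pairYX pairYX_bijective.1 _ hcU fun Φ => by
      rw [pairYX, dualPairL_apply]
      exact hU Φ
  have hB := opB_isInvertible hρ hcA hcU hA hU
  obtain ⟨cA', hcA', hA'⟩ := inverse_coercive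
    (fun (f : DotNegHalf) (g : DotHalf) => dual f g) _ hAinv hcA hA
  obtain ⟨cU', hcU', hU'⟩ := inverse_coercive
    (fun (f : SpY) (g : SpX) => dualPair f g) _ hUinv hcU hU
  obtain ⟨c, hc, hN⟩ := combinedN_coercive hρ hcA' hcU' hA' hU'
  have hNinv : (combinedN η ρ).IsInvertible :=
    isInvertible_of_coercive pairXtYt pairXtYt_injective _ hc hN
  have hG := combinedG_eq hρ hAinv hUinv hB hNinv
  have hK : ∀ ξ : SpXb, c * ‖ξ‖ ^ 2 ≤ dualPair (opK η ρ ξ) ξ := fun ξ => by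
    rw [dualPair_opK, ← norm_derivXb]
    exact hN _
  refine ⟨hAinv, hUinv, hB, existsUnique_isCombinedDNO hρ hAinv hUinv hB hNinv, ?_, ?_, ?_,
    c, hc, hK⟩
  · rw [hG]
    exact hNinv.inverse
  · rw [hG]
    exact hNinv.inverse_inverse
  · exact isInvertible_of_coercive pairYbXb pairYbXb_injective _ hc fun ξ => by
      rw [pairYbXb, dualPairL_apply]
      exact hK ξ

end Combined

end TwoLayer
end

/-! ### Schwartz functions with prescribed transform; Plancherel and Parseval. -/

noncomputable section

namespace TwoLayer

open scoped ComplexConjugate ContDiff SchwartzMap FourierTransform LineDeriv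

/-! ### Real parts of inverse Fourier transforms -/

section RealInv

variable {V D : Type*} [NormedAddCommGroup V] [InnerProductSpace ℝ V] [FiniteDimensional ℝ V]
  [MeasurableSpace V] [BorelSpace V] [NormedAddCommGroup D] [NormedSpace ℝ D]

/-- The function `p ↦ (2π)^{-1/2} Re ∫ exp(2πi ⟨v, g p⟩) S(v) dv`. -/
def realInv (g : D ≃L[ℝ] V) (S : 𝓢(V, ℂ)) : 𝓢(D, ℝ) :=
  SchwartzMap.postcompCLM (𝕜 := ℝ) Complex.reCLM
    (SchwartzMap.compCLMOfContinuousLinearEquiv ℝ g ((√(2 * Real.pi))⁻¹ • 𝓕⁻ S))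

theorem realInv_apply (g : D ≃L[ℝ] V) (S : 𝓢(V, ℂ)) (p : D) :
    realInv g S p = (√(2 * Real.pi))⁻¹ * (𝓕⁻ S (g p)).re := by
  simp [realInv, SchwartzMap.postcompCLM_apply]

theorem lineDerivOp_realInv (g : D ≃L[ℝ] V) (S : 𝓢(V, ℂ)) (m : D) (S' : 𝓢(V, ℂ))
    (hS' : ∀ v, S' v = 2 * Real.pi * Complex.I * (inner ℝ v (g m) : ℝ) * S v) :
    ∂_{m} (realInv g S) = realInv g S' := by
  have h1 : (fun v : V => (inner ℝ v (g m) : ℝ)).HasTemperateGrowth :=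
    ((innerSL ℝ).flip (g m)).hasTemperateGrowth
  have h2 : S' = (2 * Real.pi * Complex.I) • SchwartzMap.smulLeftCLM ℂ (inner ℝ · (g m)) S := by
    ext v
    rw [hS', smul_apply, SchwartzMap.smulLeftCLM_apply_apply h1, Complex.real_smul, smul_eq_mul]
    ring
  ext p
  rw [realInv_apply, h2, ← SchwartzMap.lineDerivOp_fourierInv_eq]
  set R := 𝓕⁻ S
  have h3 : HasFDerivAt (fun p => realInv g S p)
      ((√(2 * Real.pi))⁻¹ • (Complex.reCLM ∘L (fderiv ℝ R (g p)) ∘L (g : D →L[ℝ] V))) p := by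
    have h4 : (fun p => realInv g S p) =
        fun p => (√(2 * Real.pi))⁻¹ • Complex.reCLM (R (g p)) := by
      ext p
      exact realInv_apply g S p
    rw [h4]
    exact ((Complex.reCLM.hasFDerivAt.comp p ((R.hasFDerivAt (g p)).comp p g.hasFDerivAt))).const_smul
      ((√(2 * Real.pi))⁻¹)
  rw [SchwartzMap.lineDerivOp_apply_eq_fderiv, h3.fderiv]
  rfl

theorem integral_norm_sq_fourierInv (S : 𝓢(V, ℂ)) : ∫ v, ‖𝓕⁻ S v‖ ^ 2 = ∫ v, ‖S v‖ ^ 2 := by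
  rw [← SchwartzMap.integral_norm_sq_fourier (𝓕⁻ S), FourierTransform.fourier_fourierInv_eq]

theorem integrable_norm_sq {E F : Type*} [NormedAddCommGroup E] [NormedSpace ℝ E]
    [MeasurableSpace E] [BorelSpace E] [SecondCountableTopology E] [NormedAddCommGroup F]
    [NormedSpace ℝ F] {μ : Measure E} [μ.HasTemperateGrowth] (S : 𝓢(E, F)) :
    Integrable (fun v => ‖S v‖ ^ 2) μ :=
  (memLp_two_iff_integrable_sq_norm (S.memLp 2 μ).1).1 (S.memLp 2 μ)

/-- Plancherel together with |Re z| ≤ |z|, so no symmetry of S is needed. The number κ is the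
inverse Jacobian of the rescaling that absorbs the 2π of the Fourier convention: 2π on the line,
(2π)² in the plane. -/
theorem integral_realInv_sq_le [MeasureSpace D] [BorelSpace D] [SecondCountableTopology D]
    (g : D ≃L[ℝ] V) {κ : ℝ}
    (hg : ∀ F : V → ℝ, Integrable F → Integrable (F ∘ g) ∧ ∫ p, F (g p) = κ * ∫ v, F v)
    (S : 𝓢(V, ℂ)) :
    ∫ p, realInv g S p ^ 2 ≤ (2 * Real.pi)⁻¹ * κ * ∫ v, ‖S v‖ ^ 2 := by
  have h1 := hg _ (integrable_norm_sq (μ := volume) (𝓕⁻ S))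
  rw [← integral_norm_sq_fourierInv, mul_assoc, ← h1.2, ← integral_const_mul]
  refine integral_mono_of_nonneg (Eventually.of_forall fun p => sq_nonneg _)
    (h1.1.const_mul _) (Eventually.of_forall fun p => ?_)
  show realInv g S p ^ 2 ≤ (2 * Real.pi)⁻¹ * ‖𝓕⁻ S (g p)‖ ^ 2
  rw [realInv_apply, mul_pow, inv_pow, Real.sq_sqrt (by positivity)]
  refine mul_le_mul_of_nonneg_left ?_ (by positivity)
  rw [← sq_abs]
  exact pow_le_pow_left₀ (abs_nonneg _) (Complex.abs_re_le_norm _) 2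

end RealInv

/-! ### Scalings -/

/-- `x ↦ x / (2π)`. -/
def scaleR : ℝ ≃L[ℝ] ℝ :=
  ContinuousLinearEquiv.smulLeft (Units.mk0 (2 * Real.pi)⁻¹ (by positivity))

/-- `(x, s) ↦ (x + i s) / (2π)`. -/
def scaleC : (ℝ × ℝ) ≃L[ℝ] ℂ :=
  Complex.equivRealProdCLM.symm.trans
    (ContinuousLinearEquiv.smulLeft (Units.mk0 (2 * Real.pi)⁻¹ (by positivity)))

theorem scaleR_apply (x : ℝ) : scaleR x = (2 * Real.pi)⁻¹ * x := rfl

theorem scaleC_apply (p : ℝ × ℝ) : scaleC p = ((2 * Real.pi)⁻¹ : ℝ) • (⟨p.1, p.2⟩ : ℂ) := by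
  have : Complex.equivRealProdCLM.symm p = ⟨p.1, p.2⟩ := by
    apply Complex.ext <;> simp
  show ((2 * Real.pi)⁻¹ : ℝ) • (Complex.equivRealProdCLM.symm p) = _
  rw [this]

theorem scaleR_integral (F : ℝ → ℝ) (hF : Integrable F) :
    Integrable (F ∘ scaleR) ∧ ∫ p, F (scaleR p) = (2 * Real.pi) * ∫ v, F v := by
  refine ⟨hF.comp_mul_left' (R := (2 * Real.pi)⁻¹) (by positivity), ?_⟩
  simp only [scaleR_apply]
  rw [Measure.integral_comp_mul_left, inv_inv, abs_of_pos (by positivity), smul_eq_mul]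

theorem integral_complex (F : ℂ → ℝ) : ∫ z, F z = ∫ p : ℝ × ℝ, F ⟨p.1, p.2⟩ :=
  (Complex.volume_preserving_equiv_real_prod.symm.integral_comp
    Complex.measurableEquivRealProd.symm.measurableEmbedding F).symm

theorem integrable_complex {E : Type*} [NormedAddCommGroup E] {F : ℂ → E} (hF : Integrable F) :
    Integrable fun p : ℝ × ℝ => F ⟨p.1, p.2⟩ :=
  (Complex.volume_preserving_equiv_real_prod.symm.integrable_comp_emb
    Complex.measurableEquivRealProd.symm.measurableEmbedding).2 hF

theorem scaleC_integral (F : ℂ → ℝ) (hF : Integrable F) :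
    Integrable (F ∘ scaleC) ∧ ∫ p, F (scaleC p) = (2 * Real.pi) ^ 2 * ∫ v, F v := by
  have h1 : Integrable fun z : ℂ => F ((2 * Real.pi)⁻¹ • z) := 
    hF.comp_smul (R := (2 * Real.pi)⁻¹) (by positivity)
  refine ⟨?_, ?_⟩
  · refine (integrable_complex h1).congr (Eventually.of_forall fun p => ?_)
    rw [Function.comp_apply, scaleC_apply]
  · simp only [scaleC_apply]
    rw [← integral_complex fun z => F ((2 * Real.pi)⁻¹ • z), Measure.integral_comp_smul,
      Complex.finrank_real_complex, smul_eq_mul, abs_of_pos (by positivity)]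
    congr 1
    rw [inv_pow, inv_inv]

/-! ### Functions with prescribed Fourier transform -/

/-- A test function as a Schwartz function. -/
def IsTest.toSchwartz {φ : ℝ → ℂ} (hφ : IsTest φ) : 𝓢(ℝ, ℂ) :=
  hφ.compact.toSchwartzMap hφ.smooth

theorem IsTest.toSchwartz_apply {φ : ℝ → ℂ} (hφ : IsTest φ) (k : ℝ) : hφ.toSchwartz k = φ k := rfl

/-- The real-valued function with Fourier transform `φ`. -/
def IsTest.phys {φ : ℝ → ℂ} (hφ : IsTest φ) : 𝓢(ℝ, ℝ) := realInv scaleR hφ.toSchwartz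

theorem IsTest.fourierInv_eq {φ : ℝ → ℂ} (hφ : IsTest φ) (x : ℝ) :
    𝓕⁻ hφ.toSchwartz (scaleR x) = ∫ k : ℝ, Complex.exp (Complex.I * k * x) * φ k := by
  rw [SchwartzMap.fourierInv_coe, Real.fourierInv_eq']
  congr 1
  ext k
  rw [smul_eq_mul, hφ.toSchwartz_apply, scaleR_apply]
  congr 2
  have : (2 * Real.pi * inner ℝ k ((2 * Real.pi)⁻¹ * x) : ℝ) = k * x := by
    simp only [RCLike.inner_apply, conj_trivial]
    have := Real.pi_pos
    field_simp
  rw [this]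
  push_cast
  ring

theorem IsTest.phys_apply {φ : ℝ → ℂ} (hφ : IsTest φ) (x : ℝ) :
    hφ.phys x = (√(2 * Real.pi))⁻¹ * (∫ k : ℝ, Complex.exp (Complex.I * k * x) * φ k).re := by
  rw [IsTest.phys, realInv_apply, hφ.fourierInv_eq]

/-- Hermitian symmetry of φ makes the inverse transform real, so taking the real part in `realInv`
loses nothing. -/
theorem IsTest.phys_ofReal {φ : ℝ → ℂ} (hφ : IsTest φ) (x : ℝ) :
    (hφ.phys x : ℂ) = ((√(2 * Real.pi))⁻¹ : ℝ) * 𝓕⁻ hφ.toSchwartz (scaleR x) := by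
  have h1 : conj (𝓕⁻ hφ.toSchwartz (scaleR x)) = 𝓕⁻ hφ.toSchwartz (scaleR x) := by
    rw [hφ.fourierInv_eq, ← integral_conj, ← integral_neg_eq_self]
    congr 1
    ext k
    rw [map_mul, ← Complex.exp_conj, ← hφ.herm, neg_neg]
    simp
  rw [IsTest.phys, realInv_apply, Complex.ofReal_mul, Complex.conj_eq_iff_re.1 h1]

theorem IsTest.fourier_phys {φ : ℝ → ℂ} (hφ : IsTest φ) (k : ℝ) : fourier hφ.phys k = φ k := by
  have h1 : 𝓕 (𝓕⁻ hφ.toSchwartz) k = φ k := by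
    rw [FourierTransform.fourier_fourierInv_eq]
    rfl
  rw [SchwartzMap.fourier_coe, Real.fourier_eq'] at h1
  have h2 : ∫ x : ℝ, Complex.exp (-(Complex.I * k * x)) * (hφ.phys x : ℂ) =
      ((√(2 * Real.pi))⁻¹ : ℝ) * (2 * Real.pi * φ k) := by
    have h3 : (fun x : ℝ => Complex.exp (-(Complex.I * k * x)) * (hφ.phys x : ℂ)) =
        fun x : ℝ => ((√(2 * Real.pi))⁻¹ : ℝ) *
          (fun y : ℝ => Complex.exp ((-2 * Real.pi * inner ℝ y k : ℝ) * Complex.I) •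
            𝓕⁻ hφ.toSchwartz y) ((2 * Real.pi)⁻¹ * x) := by
      ext x
      rw [hφ.phys_ofReal, scaleR_apply]
      simp only [smul_eq_mul]
      have : (-2 * Real.pi * inner ℝ ((2 * Real.pi)⁻¹ * x) k : ℝ) = -(k * x) := by
        simp only [RCLike.inner_apply, conj_trivial]
        have := Real.pi_pos
        field_simp
      rw [this, mul_left_comm]
      congr 3
      push_cast
      ring
    rw [h3, integral_const_mul, Measure.integral_comp_mul_left (fun y : ℝ =>
      Complex.exp ((-2 * Real.pi * inner ℝ y k : ℝ) * Complex.I) • 𝓕⁻ hφ.toSchwartz y), h1, inv_inv,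
      abs_of_pos (by positivity), Complex.real_smul]
    push_cast
    ring
  rw [fourier, h2, ← mul_assoc, ← mul_assoc]
  have h4 : (((√(2 * Real.pi))⁻¹ : ℝ) : ℂ) * ((√(2 * Real.pi))⁻¹ : ℝ) * (2 * Real.pi) = 1 := by
    have h5 : (√(2 * Real.pi))⁻¹ * (√(2 * Real.pi))⁻¹ * (2 * Real.pi) = 1 := by
      rw [← mul_inv, Real.mul_self_sqrt (by positivity)]
      have := Real.pi_pos
      field_simp
    exact_mod_cast congrArg (fun x : ℝ => (x : ℂ)) h5
  rw [h4, one_mul]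

/-- The transform of the derivative. -/
theorem IsTest.deriv {φ : ℝ → ℂ} (hφ : IsTest φ) :
    IsTest fun k => Complex.I * (k : ℂ) * φ k :=
  hφ.mul (g := fun k => Complex.I * (k : ℂ))
    (fun _ _ => contDiffAt_const.mul Complex.ofRealCLM.contDiff.contDiffAt) (by simp)

theorem IsTest.hasDerivAt_phys {φ : ℝ → ℂ} (hφ : IsTest φ) (x : ℝ) :
    HasDerivAt hφ.phys (hφ.deriv.phys x) x := by
  have h1 : ∂_{(1 : ℝ)} hφ.phys = hφ.deriv.phys := by
    refine lineDerivOp_realInv _ _ _ _ fun k => ?_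
    rw [hφ.toSchwartz_apply, hφ.deriv.toSchwartz_apply, scaleR_apply]
    simp only [RCLike.inner_apply, conj_trivial]
    have : (Real.pi : ℂ) ≠ 0 := by exact_mod_cast Real.pi_ne_zero
    push_cast
    field_simp
  rw [← h1]
  exact (hφ.phys.hasFDerivAt x).hasDerivAt

theorem IsTest.integral_phys_sq_le {φ : ℝ → ℂ} (hφ : IsTest φ) :
    ∫ x, hφ.phys x ^ 2 ≤ ∫ k, ‖φ k‖ ^ 2 := by
  have h1 := integral_realInv_sq_le scaleR scaleR_integral hφ.toSchwartz
  rwa [inv_mul_cancel₀ (by positivity), one_mul] at h1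

/-- Parseval's identity against a test function. -/
theorem IsTest.integral_mul_phys {φ : ℝ → ℂ} (hφ : IsTest φ) {g : ℝ → ℝ} (hg : Integrable g) :
    ∫ x, g x * hφ.phys x = ∫ k, (fourier g k * conj (φ k)).re := by
  set c := (√(2 * Real.pi))⁻¹
  have hI : Integrable (fun p : ℝ × ℝ => Complex.exp (Complex.I * p.2 * p.1) *
      ((g p.1 : ℂ) * φ p.2)) (volume.prod volume) := by
    have h1 : Integrable (fun p : ℝ × ℝ => (g p.1 : ℂ) * φ p.2) (volume.prod volume) :=
      hg.ofReal.mul_prod hφ.toSchwartz.integrable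
    refine h1.bdd_mul (c := 1) ?_ (Eventually.of_forall fun p => ?_)
    · exact Continuous.aestronglyMeasurable (by fun_prop)
    · rw [Complex.norm_exp]
      simp
  have h1 : ∀ x, (g x * hφ.phys x : ℝ) =
      c * (∫ k : ℝ, Complex.exp (Complex.I * k * x) * ((g x : ℂ) * φ k)).re := by
    intro x
    rw [hφ.phys_apply]
    have : (fun k : ℝ => Complex.exp (Complex.I * k * x) * ((g x : ℂ) * φ k)) =
        fun k : ℝ => (g x : ℂ) * (Complex.exp (Complex.I * k * x) * φ k) := by
      ext k
      ring
    rw [this, integral_const_mul, Complex.re_ofReal_mul]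
    ring
  have h2 : ∀ k, (fourier g k * conj (φ k)).re =
      c * (∫ x : ℝ, Complex.exp (Complex.I * k * x) * ((g x : ℂ) * φ k)).re := by
    intro k
    rw [fourier, mul_assoc, Complex.re_ofReal_mul, ← integral_mul_const, ← Complex.conj_re,
      ← integral_conj]
    congr 3
    ext x
    rw [map_mul, map_mul, ← Complex.exp_conj, Complex.conj_conj, Complex.conj_ofReal]
    simp
    ring
  simp only [h1, h2]
  rw [integral_const_mul, integral_const_mul]
  congr 1
  -- Fubini applies because g and φ are integrable; no square integrability of g is used.
  have h3 := integral_integral_swap (f := fun (x k : ℝ) =>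
    Complex.exp (Complex.I * k * x) * ((g x : ℂ) * φ k)) hI
  have h4 : ∀ F : ℝ → ℂ, Integrable F → ∫ x, (F x).re = (∫ x, F x).re := fun F hF =>
    integral_re hF
  rw [h4 _ hI.integral_prod_left, h4 _ hI.integral_prod_right, h3]

end TwoLayer
end

/-! ### Extension from the line to the plane with frequency-dependent thickness. -/

noncomputable section

namespace TwoLayer

open scoped ComplexConjugate ContDiff SchwartzMap FourierTransform LineDeriv

/-! ### Extension of functions on the line to the plane -/

/-- A fixed bump function supported in `[-1, 1]`. -/
def mollBump : ContDiffBump (0 : ℝ) := ⟨1 / 2, 1, by norm_num, by norm_num⟩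

/-- A fixed mollifier supported in `[-1, 1]`. -/
def moll : ℝ → ℝ := mollBump.normed volume

theorem contDiff_moll : ContDiff ℝ ∞ moll := mollBump.contDiff_normed

theorem integral_moll : ∫ z, moll z = 1 := mollBump.integral_normed

theorem hasCompactSupport_moll : HasCompactSupport moll := mollBump.hasCompactSupport_normed

theorem moll_eq_zero {z : ℝ} (hz : 1 ≤ |z|) : moll z = 0 := by
  by_contra h
  have h1 : z ∈ Function.support moll := h
  rw [moll, mollBump.support_normed_eq, mem_ball_zero_iff] at h1
  exact absurd h1 (not_lt.2 hz)

theorem integrable_moll_sq : Integrable fun z => moll z ^ 2 := by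
  have h : Integrable fun z => moll z * moll z :=
    (contDiff_moll.continuous.mul contDiff_moll.continuous).integrable_of_hasCompactSupport
      hasCompactSupport_moll.mul_right
  simpa only [sq] using h

/-- Positive functions that are smooth away from the origin. -/
structure IsScale (l : ℝ → ℝ) : Prop where
  pos : ∀ k, k ≠ 0 → 0 < l k
  smooth : ∀ k, k ≠ 0 → ContDiffAt ℝ ∞ l k

theorem isScale_abs : IsScale fun k => |k| :=
  ⟨fun _ hk => abs_pos.2 hk, fun _ hk => contDiffAt_abs hk⟩

theorem isScale_bracket : IsScale bracket :=
  ⟨fun k _ => bracket_pos k, fun _ _ => contDiff_bracket.contDiffAt⟩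

theorem IsScale.continuousOn {l : ℝ → ℝ} (hl : IsScale l) : ContinuousOn l {0}ᶜ :=
  fun k hk => (hl.smooth k hk).continuousAt.continuousWithinAt

section Extension

variable {φ : ℝ → ℂ} {l : ℝ → ℝ}

/-- The Fourier transform in the plane of an extension of the function with transform `φ`. -/
def extSymbol (φ : ℝ → ℂ) (l : ℝ → ℝ) (z : ℂ) : ℂ :=
  φ z.re * (((l z.re)⁻¹ * moll (z.im / l z.re) : ℝ) : ℂ)

theorem contDiff_extSymbol (hφ : IsTest φ) (hl : IsScale l) : ContDiff ℝ ∞ (extSymbol φ l) := by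
  rw [contDiff_iff_contDiffAt]
  intro z
  by_cases hz : z.re ∈ tsupport φ
  · have h0 : z.re ≠ 0 := fun h => hφ.zero_notMem (h ▸ hz)
    have hre : ContDiffAt ℝ ∞ (fun z : ℂ => z.re) z := Complex.reCLM.contDiff.contDiffAt
    have him : ContDiffAt ℝ ∞ (fun z : ℂ => z.im) z := Complex.imCLM.contDiff.contDiffAt
    have hlz : ContDiffAt ℝ ∞ (fun z : ℂ => l z.re) z := (hl.smooth _ h0).comp z hre
    have hinv : ContDiffAt ℝ ∞ (fun z : ℂ => (l z.re)⁻¹) z := hlz.inv (hl.pos _ h0).ne'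
    have hm : ContDiffAt ℝ ∞ (fun z : ℂ => moll (z.im / l z.re)) z :=
      contDiff_moll.contDiffAt.comp z (him.div hlz (hl.pos _ h0).ne')
    exact (hφ.smooth.contDiffAt.comp z hre).mul
      (Complex.ofRealCLM.contDiff.contDiffAt.comp z (hinv.mul hm))
  · refine (contDiffAt_const (c := (0 : ℂ))).congr_of_eventuallyEq ?_
    have h1 := Complex.continuous_re.continuousAt.eventually (notMem_tsupport_iff_eventuallyEq.1 hz)
    filter_upwards [h1] with x hx
    rw [extSymbol, hx, Pi.zero_apply, zero_mul]

/-- On the support of φ, a compact set avoiding 0, the scale l is bounded, and the mollifier forces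
|τ| < l(k). -/
theorem hasCompactSupport_extSymbol (hφ : IsTest φ) (hl : IsScale l) :
    HasCompactSupport (extSymbol φ l) := by
  have hsub : tsupport φ ⊆ {0}ᶜ := fun k hk h => hφ.zero_notMem (by rwa [← Set.mem_singleton_iff.1 h])
  obtain ⟨M, hM⟩ := IsCompact.exists_bound_of_continuousOn hφ.compact (hl.continuousOn.mono hsub)
  have hK : IsCompact (Complex.equivRealProdCLM.toHomeomorph ⁻¹'
      (tsupport φ ×ˢ Set.Icc (-M) M)) :=
    Complex.equivRealProdCLM.toHomeomorph.isCompact_preimage.2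
      (IsCompact.prod hφ.compact isCompact_Icc)
  refine HasCompactSupport.intro hK fun z hz => ?_
  by_cases h1 : z.re ∈ tsupport φ
  · have h0 : z.re ≠ 0 := fun h => hφ.zero_notMem (h ▸ h1)
    have hp := hl.pos _ h0
    have h2 : M < |z.im| := by
      by_contra hle
      exact hz ⟨h1, abs_le.1 (not_lt.1 hle)⟩
    have h3 := hM _ h1
    rw [Real.norm_of_nonneg hp.le] at h3
    have h4 : moll (z.im / l z.re) = 0 := by
      refine moll_eq_zero ?_
      rw [abs_div, abs_of_pos hp, one_le_div hp]
      linarith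
    rw [extSymbol, h4, mul_zero, Complex.ofReal_zero, mul_zero]
  · rw [extSymbol, image_eq_zero_of_notMem_tsupport h1, zero_mul]

/-- `extSymbol` as a Schwartz function. -/
def extS (hφ : IsTest φ) (hl : IsScale l) : 𝓢(ℂ, ℂ) :=
  (hasCompactSupport_extSymbol hφ hl).toSchwartzMap (contDiff_extSymbol hφ hl)

theorem extS_apply (hφ : IsTest φ) (hl : IsScale l) (z : ℂ) : extS hφ hl z = extSymbol φ l z := rfl

/-- An extension to the plane of the function on the line with Fourier transform `φ`. -/
def extend (hφ : IsTest φ) (hl : IsScale l) : 𝓢(ℝ × ℝ, ℝ) := realInv scaleC (extS hφ hl)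

theorem integral_moll_div {c : ℝ} (hc : 0 < c) : ∫ τ, c⁻¹ * moll (τ / c) = 1 := by
  rw [integral_const_mul, Measure.integral_comp_div moll c, integral_moll, abs_of_pos hc,
    smul_eq_mul, mul_one, inv_mul_cancel₀ hc.ne']

/-- Setting s = 0 integrates the symbol over τ, and l⁻¹m(τ/l) has integral 1 for every k ≠ 0. -/
theorem extend_zero (hφ : IsTest φ) (hl : IsScale l) (x : ℝ) :
    extend hφ hl (x, 0) = hφ.phys x := by
  rw [extend, realInv_apply, hφ.phys_apply, SchwartzMap.fourierInv_coe, Real.fourierInv_eq']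
  congr 2
  set F : ℂ → ℂ := fun v => Complex.exp (((2 * Real.pi * inner ℝ v (scaleC (x, 0)) : ℝ)) *
    Complex.I) • extS hφ hl v
  have hF : Integrable F := by
    refine ((extS hφ hl).integrable (μ := volume)).bdd_mul (c := 1) ?_
      (Eventually.of_forall fun p => ?_)
    · exact Continuous.aestronglyMeasurable (by fun_prop)
    · rw [Complex.norm_exp]
      simp
  have h1 : ∫ z, F z = ∫ p : ℝ × ℝ, F ⟨p.1, p.2⟩ :=
    (Complex.volume_preserving_equiv_real_prod.symm.integral_comp
      Complex.measurableEquivRealProd.symm.measurableEmbedding F).symm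
  have h2 : ∫ p : ℝ × ℝ, F ⟨p.1, p.2⟩ = ∫ k : ℝ, ∫ τ : ℝ, F ⟨k, τ⟩ :=
    integral_prod (fun p : ℝ × ℝ => F ⟨p.1, p.2⟩) (integrable_complex hF)
  refine (h1.trans h2).trans (integral_congr_ae ?_)
  filter_upwards [ae_ne_zero] with k hk
  have h3 : ∀ τ : ℝ, F ⟨k, τ⟩ = (Complex.exp (Complex.I * k * x) * φ k) *
      (((l k)⁻¹ * moll (τ / l k) : ℝ) : ℂ) := by
    intro τ
    have h4 : (2 * Real.pi * inner ℝ (⟨k, τ⟩ : ℂ) (scaleC (x, 0)) : ℝ) = k * x := by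
      rw [scaleC_apply, inner_smul_right, Complex.inner]
      simp
      have := Real.pi_pos
      field_simp
    simp only [F, smul_eq_mul]
    rw [h4, extS_apply, extSymbol, mul_assoc]
    congr 2
    push_cast
    ring
  simp only [h3]
  rw [integral_const_mul, integral_complex_ofReal, integral_moll_div (hl.pos k hk)]
  simp

/-- On each slice k = const the substitution τ = l(k)σ turns l⁻²∫m(τ/l)² dτ into l⁻¹∫m². It is used
with b = 1, |k| and l, for the function and its two derivatives. -/
theorem integral_norm_sq_extS_le (hφ : IsTest φ) (hl : IsScale l) (S : 𝓢(ℂ, ℂ)) {b : ℝ → ℝ}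
    (hb : ContinuousOn b {0}ᶜ)
    (hS : ∀ z : ℂ, z.re ≠ 0 → ‖S z‖ ≤ b z.re * ‖extSymbol φ l z‖) :
    ∫ z, ‖S z‖ ^ 2 ≤ (∫ z, moll z ^ 2) * ∫ k, b k ^ 2 * (l k)⁻¹ * ‖φ k‖ ^ 2 := by
  have hint : Integrable fun p : ℝ × ℝ => ‖S ⟨p.1, p.2⟩‖ ^ 2 :=
    integrable_complex (F := fun z => ‖S z‖ ^ 2) (integrable_norm_sq (μ := volume) S)
  have h1 : ∫ p : ℝ × ℝ, ‖S ⟨p.1, p.2⟩‖ ^ 2 = ∫ k : ℝ, ∫ τ : ℝ, ‖S ⟨k, τ⟩‖ ^ 2 :=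
    integral_prod (fun p : ℝ × ℝ => ‖S ⟨p.1, p.2⟩‖ ^ 2) hint
  rw [integral_complex fun z => ‖S z‖ ^ 2, h1, ← integral_const_mul]
  refine integral_mono_ae hint.integral_prod_left ?_ ?_
  · exact (hφ.integrable_mul ((hb.pow 2).mul (hl.continuousOn.inv₀
      fun k hk => (hl.pos k hk).ne'))).const_mul _
  · filter_upwards [ae_ne_zero] with k hk
    have hp := hl.pos k hk
    have h2 : ∀ τ : ℝ, ‖S ⟨k, τ⟩‖ ^ 2 ≤
        (b k ^ 2 * ‖φ k‖ ^ 2 * ((l k)⁻¹) ^ 2) * moll (τ / l k) ^ 2 := by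
      intro τ
      refine (pow_le_pow_left₀ (norm_nonneg _) (hS ⟨k, τ⟩ hk) 2).trans (le_of_eq ?_)
      rw [extSymbol, norm_mul, Complex.norm_real, Real.norm_eq_abs]
      rw [mul_pow, mul_pow, sq_abs, mul_pow]
      ring
    calc ∫ τ : ℝ, ‖S ⟨k, τ⟩‖ ^ 2
        ≤ ∫ τ : ℝ, (b k ^ 2 * ‖φ k‖ ^ 2 * ((l k)⁻¹) ^ 2) * moll (τ / l k) ^ 2 :=
          integral_mono_of_nonneg (Eventually.of_forall fun τ => by positivity)
            ((integrable_moll_sq.comp_div hp.ne').const_mul _) (Eventually.of_forall h2)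
      _ = (∫ z, moll z ^ 2) * (b k ^ 2 * (l k)⁻¹ * ‖φ k‖ ^ 2) := by
          rw [integral_const_mul, Measure.integral_comp_div (fun z => moll z ^ 2), abs_of_pos hp,
            smul_eq_mul]
          field_simp

/-- The constant in the bounds for extensions. -/
def extConst : ℝ := 2 * Real.pi * ∫ z, moll z ^ 2

theorem extConst_nonneg : 0 ≤ extConst :=
  mul_nonneg (by positivity) (integral_nonneg fun _ => sq_nonneg _)

theorem integral_realInv_extS_le (hφ : IsTest φ) (hl : IsScale l) (S : 𝓢(ℂ, ℂ)) {b : ℝ → ℝ}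
    (hb : ContinuousOn b {0}ᶜ)
    (hS : ∀ z : ℂ, z.re ≠ 0 → ‖S z‖ ≤ b z.re * ‖extSymbol φ l z‖) :
    ∫ p, realInv scaleC S p ^ 2 ≤ extConst * ∫ k, b k ^ 2 * (l k)⁻¹ * ‖φ k‖ ^ 2 := by
  refine (integral_realInv_sq_le scaleC scaleC_integral S).trans ?_
  have h1 := integral_norm_sq_extS_le hφ hl S hb hS
  have h2 : (2 * Real.pi)⁻¹ * (2 * Real.pi) ^ 2 = 2 * Real.pi := by
    have := Real.pi_pos
    field_simp
  rw [h2, extConst, mul_assoc (2 * Real.pi)]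
  exact mul_le_mul_of_nonneg_left h1 (by positivity)

theorem integral_extend_sq_le (hφ : IsTest φ) (hl : IsScale l) :
    ∫ p, extend hφ hl p ^ 2 ≤ extConst * ∫ k, (l k)⁻¹ * ‖φ k‖ ^ 2 := by
  have h1 := integral_realInv_extS_le hφ hl (extS hφ hl) (b := fun _ => 1) continuousOn_const
    (fun z _ => by rw [one_mul, extS_apply])
  simpa [extend] using h1

theorem lineDerivOp_extend (hφ : IsTest φ) (hl : IsScale l) (L : ℂ →L[ℝ] ℝ) (m : ℝ × ℝ)
    (hm : ∀ z : ℂ, 2 * Real.pi * inner ℝ z (scaleC m) = L z) :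
    ∂_{m} (extend hφ hl) =
      realInv scaleC (Complex.I • SchwartzMap.smulLeftCLM ℂ (fun z => L z) (extS hφ hl)) := by
  refine lineDerivOp_realInv _ _ _ _ fun z => ?_
  rw [smul_apply, SchwartzMap.smulLeftCLM_apply_apply L.hasTemperateGrowth,
    Complex.real_smul, smul_eq_mul, ← hm]
  push_cast
  ring

theorem norm_smul_smulLeft_extS (hφ : IsTest φ) (hl : IsScale l) (L : ℂ →L[ℝ] ℝ) (z : ℂ) :
    ‖(Complex.I • SchwartzMap.smulLeftCLM ℂ (fun z => L z) (extS hφ hl)) z‖ =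
      |L z| * ‖extSymbol φ l z‖ := by
  rw [smul_apply, SchwartzMap.smulLeftCLM_apply_apply L.hasTemperateGrowth,
    norm_smul, norm_smul, Complex.norm_I, one_mul, Real.norm_eq_abs, extS_apply]

theorem integral_extend_x_sq_le (hφ : IsTest φ) (hl : IsScale l) :
    ∫ p, (∂_{((1 : ℝ), (0 : ℝ))} (extend hφ hl)) p ^ 2 ≤
      extConst * ∫ k, k ^ 2 * (l k)⁻¹ * ‖φ k‖ ^ 2 := by
  rw [lineDerivOp_extend hφ hl Complex.reCLM _ fun z => ?_]
  · have h1 := integral_realInv_extS_le hφ hl _ (b := fun k => |k|) continuous_abs.continuousOn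
      (fun z _ => (norm_smul_smulLeft_extS hφ hl Complex.reCLM z).le)
    simpa only [sq_abs] using h1
  · rw [scaleC_apply, inner_smul_right, Complex.inner]
    have := Real.pi_pos
    simp
    field_simp

theorem integral_extend_y_sq_le (hφ : IsTest φ) (hl : IsScale l) :
    ∫ p, (∂_{((0 : ℝ), (1 : ℝ))} (extend hφ hl)) p ^ 2 ≤
      extConst * ∫ k, l k * ‖φ k‖ ^ 2 := by
  rw [lineDerivOp_extend hφ hl Complex.imCLM _ fun z => ?_]
  · have h1 := integral_realInv_extS_le hφ hl
      (Complex.I • SchwartzMap.smulLeftCLM ℂ (fun z => Complex.imCLM z) (extS hφ hl))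
      (b := l) hl.continuousOn
      (fun z hz => by
        rw [norm_smul_smulLeft_extS hφ hl Complex.imCLM z]
        have hp := hl.pos _ hz
        -- The factor |τ| from ∂_y is at most l(k) wherever the symbol is nonzero.
        by_cases hle : |z.im| ≤ l z.re
        · exact mul_le_mul_of_nonneg_right hle (norm_nonneg _)
        · have h4 : moll (z.im / l z.re) = 0 := by
            refine moll_eq_zero ?_
            rw [abs_div, abs_of_pos hp, one_le_div hp]
            linarith
          rw [extSymbol, h4]
          simp)
    refine h1.trans (le_of_eq ?_)
    congr 1
    refine integral_congr_ae ?_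
    filter_upwards [ae_ne_zero] with k hk
    have := (hl.pos k hk).ne'
    field_simp
  · rw [scaleC_apply, inner_smul_right, Complex.inner]
    have := Real.pi_pos
    simp
    field_simp

end Extension

end TwoLayer
end

/-! ### Mollified graphs and the flattened distance. -/

noncomputable section

namespace TwoLayer

open scoped ComplexConjugate ContDiff SchwartzMap FourierTransform LineDeriv

/-! ### Smooth approximation of Lipschitz functions -/

open Convolution in
theorem iteratedDeriv_convolution {g f : ℝ → ℝ} (hg : ContDiff ℝ ∞ g) (hc : HasCompactSupport g)
    (hf : Continuous f) (n : ℕ) :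
    iteratedDeriv n (g ⋆[ContinuousLinearMap.lsmul ℝ ℝ, volume] f) =
      iteratedDeriv n g ⋆[ContinuousLinearMap.lsmul ℝ ℝ, volume] f := by
  induction n with
  | zero => simp
  | succ n ih =>
    have h1 : HasCompactSupport (iteratedDeriv n g) := by
      clear ih
      induction n with
      | zero => simpa using hc
      | succ n ih => rw [iteratedDeriv_succ]; exact ih.deriv
    have h2 : ContDiff ℝ 1 (iteratedDeriv n g) := by
      refine ContDiff.iterate_deriv' 1 n ?_ |> fun h => by rwa [iteratedDeriv_eq_iterate]
      exact hg.of_le (by exact_mod_cast le_top)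
    rw [iteratedDeriv_succ, ih, iteratedDeriv_succ]
    ext x
    exact (h1.hasDerivAt_convolution_left _ h2 hf.locallyIntegrable x).deriv

open Convolution in
-- Mollification at radius r = ε/(L+1) moves f by at most Lr ≤ ε and preserves the Lipschitz
-- constant. All derivatives fall on the mollifier, so boundedness of f gives bounded derivatives of
-- every order.
theorem exists_smooth_approx {f : ℝ → ℝ} {C : ℝ} {L : NNReal} (hC : ∀ x, |f x| ≤ C)
    (hL : LipschitzWith L f) {ε : ℝ} (hε : 0 < ε) :
    ∃ a : ℝ → ℝ, a.HasTemperateGrowth ∧ (∀ x, |a x - f x| ≤ ε) ∧ ∀ x, |deriv a x| ≤ L := by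
  set r : ℝ := ε / (L + 1)
  have hr : 0 < r := by positivity
  set b : ContDiffBump (0 : ℝ) := ⟨r / 2, r, by positivity, by linarith⟩
  set g : ℝ → ℝ := b.normed volume
  have hg : ContDiff ℝ ∞ g := b.contDiff_normed
  have hgc : HasCompactSupport g := b.hasCompactSupport_normed
  set a : ℝ → ℝ := g ⋆[ContinuousLinearMap.lsmul ℝ ℝ, volume] f
  have ha : ContDiff ℝ ∞ a :=
    hgc.contDiff_convolution_left _ hg hL.continuous.locallyIntegrable
  have haeq : ∀ x, a x = ∫ t, g t * f (x - t) := fun x => by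
    simp [a, convolution_def]
  have hgf : ∀ x, Integrable fun t => g t * f (x - t) := fun x =>
    ((hg.continuous.mul (hL.continuous.comp (by fun_prop))).integrable_of_hasCompactSupport
      hgc.mul_right)
  refine ⟨a, ⟨ha, fun n => ?_⟩, fun x => ?_, fun x => ?_⟩
  · have h1 : HasCompactSupport (iteratedDeriv n g) := by
      induction n with
      | zero => simpa using hgc
      | succ n ih => rw [iteratedDeriv_succ]; exact ih.deriv
    have h2 : Continuous (iteratedDeriv n g) := hg.continuous_iteratedDeriv n (by exact_mod_cast le_top)
    refine ⟨0, ∫ t, |iteratedDeriv n g t| * C, fun x => ?_⟩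
    rw [norm_iteratedFDeriv_eq_norm_iteratedDeriv, iteratedDeriv_convolution hg hgc hL.continuous,
      pow_zero, mul_one, convolution_def]
    refine norm_integral_le_of_norm_le
      ((h2.abs.integrable_of_hasCompactSupport h1.abs).mul_const C)
      (Eventually.of_forall fun t => ?_)
    simp only [ContinuousLinearMap.lsmul_apply, smul_eq_mul, norm_mul, Real.norm_eq_abs]
    exact mul_le_mul_of_nonneg_left (hC _) (abs_nonneg _)
  · rw [← Real.dist_eq]
    refine b.dist_normed_convolution_le hL.continuous.aestronglyMeasurable fun y hy => ?_
    refine (hL.dist_le_mul y x).trans ?_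
    have h1 : dist y x ≤ r := (Metric.mem_ball.1 hy).le
    calc (L : ℝ) * dist y x ≤ (L + 1) * r := by gcongr; linarith
      _ = ε := by simp only [r]; field_simp
  · have hLa : LipschitzWith L a := by
      refine LipschitzWith.of_dist_le_mul fun x y => ?_
      rw [Real.dist_eq, haeq, haeq, ← integral_sub (hgf x) (hgf y)]
      have h1 : ∀ t, ‖g t * f (x - t) - g t * f (y - t)‖ ≤ g t * (L * dist x y) := by
        intro t
        rw [← mul_sub, norm_mul, Real.norm_of_nonneg (b.nonneg_normed t), ← dist_eq_norm]
        refine mul_le_mul_of_nonneg_left ?_ (b.nonneg_normed t)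
        simpa using hL.dist_le_mul (x - t) (y - t)
      refine (norm_integral_le_of_norm_le (b.integrable_normed.mul_const _)
        (Eventually.of_forall h1)).trans (le_of_eq ?_)
      rw [integral_mul_const, b.integral_normed, one_mul]
    exact norm_deriv_le_of_lipschitz hLa

/-! ### Cutoff functions -/

/-- A bump function equal to `1` on `[-1, 1]`, supported in `[-2, 2]`. -/
def cutBump : ContDiffBump (0 : ℝ) := ⟨1, 2, one_pos, one_lt_two⟩

/-- A cutoff function equal to `1` on `[-1, 1]`, supported in `[-2, 2]`. -/
def cutoff (s : ℝ) : ℝ := cutBump s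

theorem contDiff_cutoff : ContDiff ℝ ∞ cutoff := cutBump.contDiff

theorem cutoff_eq_one {s : ℝ} (hs : |s| ≤ 1) : cutoff s = 1 :=
  cutBump.one_of_mem_closedBall (by simpa [cutBump] using hs)

theorem cutoff_eq_zero {s : ℝ} (hs : 2 ≤ |s|) : cutoff s = 0 :=
  cutBump.zero_of_le_dist (by simpa [cutBump] using hs)

theorem hasCompactSupport_cutoff : HasCompactSupport cutoff := cutBump.hasCompactSupport

theorem cutoff_nonneg (s : ℝ) : 0 ≤ cutoff s := cutBump.nonneg

theorem cutoff_le_one (s : ℝ) : cutoff s ≤ 1 := cutBump.le_one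

theorem hasTemperateGrowth_cutoff : cutoff.HasTemperateGrowth :=
  hasCompactSupport_cutoff.hasTemperateGrowth contDiff_cutoff

theorem exists_bound_deriv_cutoff : ∃ K, 0 ≤ K ∧ ∀ s, |deriv cutoff s| ≤ K := by
  obtain ⟨K, hK⟩ := hasCompactSupport_cutoff.deriv.exists_bound_of_continuous
    (contDiff_cutoff.continuous_deriv (by exact_mod_cast le_top))
  exact ⟨K, (norm_nonneg _).trans (hK 0), hK⟩

/-- The identity, flattened near the origin. -/
def flat (s : ℝ) : ℝ := s - s * cutoff s

theorem contDiff_flat : ContDiff ℝ ∞ flat := contDiff_id.sub (contDiff_id.mul contDiff_cutoff)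

theorem hasTemperateGrowth_flat : flat.HasTemperateGrowth :=
  .sub (f := fun s : ℝ => s) .id' (.mul .id' hasTemperateGrowth_cutoff)

theorem exists_bound_deriv_flat : ∃ K, 0 ≤ K ∧ ∀ s, |deriv flat s| ≤ K := by
  have h1 : ContDiff ℝ ∞ fun s => s * cutoff s := contDiff_id.mul contDiff_cutoff
  obtain ⟨K, hK⟩ := (hasCompactSupport_cutoff.mul_left (f := fun s => s)).deriv.exists_bound_of_continuous
    (h1.continuous_deriv (by exact_mod_cast le_top))
  refine ⟨1 + K, by linarith [(norm_nonneg _).trans (hK 0)], fun s => ?_⟩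
  have h2 : deriv flat s = 1 - deriv (fun s => s * cutoff s) s :=
    ((hasDerivAt_id s).sub (h1.differentiable (by simp) s).hasDerivAt).deriv
  rw [h2]
  refine (abs_sub _ _).trans ?_
  rw [abs_one]
  exact add_le_add le_rfl (hK s)

theorem flat_eq_zero {s : ℝ} (hs : |s| ≤ 1) : flat s = 0 := by
  rw [flat, cutoff_eq_one hs]
  ring

theorem flat_eq_self {s : ℝ} (hs : 2 ≤ |s|) : flat s = s := by
  rw [flat, cutoff_eq_zero hs]
  ring

/-- The rescaling of `flat` vanishing on `[-ε, ε]`. -/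
def flatAt (ε s : ℝ) : ℝ := ε * flat (s / ε)

section FlatAt

variable {ε : ℝ}

theorem hasTemperateGrowth_scale {f : ℝ → ℝ} (hf : f.HasTemperateGrowth) (ε : ℝ) :
    (fun s => f (s / ε)).HasTemperateGrowth := by
  have h1 : (fun s : ℝ => s * ε⁻¹).HasTemperateGrowth := .mul .id' (.const _)
  simp only [div_eq_mul_inv]
  exact hf.comp h1

theorem hasTemperateGrowth_flatAt (ε : ℝ) : (flatAt ε).HasTemperateGrowth :=
  .mul (.const ε) (hasTemperateGrowth_scale hasTemperateGrowth_flat ε)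

theorem hasDerivAt_flatAt (hε : 0 < ε) (s : ℝ) : HasDerivAt (flatAt ε) (deriv flat (s / ε)) s := by
  have h1 : HasDerivAt flat (deriv flat (s / ε)) (s / ε) :=
    (contDiff_flat.differentiable (by simp) _).hasDerivAt
  have h2 := (h1.comp s ((hasDerivAt_id s).div_const ε)).const_mul ε
  rwa [mul_one_div, mul_div_cancel₀ _ hε.ne'] at h2

theorem flatAt_eq_zero (hε : 0 < ε) {s : ℝ} (hs : |s| ≤ ε) : flatAt ε s = 0 := by
  rw [flatAt, flat_eq_zero, mul_zero]
  rwa [abs_div, abs_of_pos hε, div_le_one hε]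

theorem flatAt_eq_self (hε : 0 < ε) {s : ℝ} (hs : 2 * ε ≤ |s|) : flatAt ε s = s := by
  rw [flatAt, flat_eq_self, mul_div_cancel₀ _ hε.ne']
  rwa [abs_div, abs_of_pos hε, le_div_iff₀ hε]

theorem abs_le_flatAt (hε : 0 < ε) (s : ℝ) : |s| ≤ |flatAt ε s| + 2 * ε := by
  by_cases h : 2 * ε ≤ |s|
  · rw [flatAt_eq_self hε h]
    linarith
  · linarith [abs_nonneg (flatAt ε s)]

end FlatAt

end TwoLayer
end

/-! ### Layers around a graph: Schwartz decay and energy. -/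

noncomputable section

namespace TwoLayer

open scoped ComplexConjugate ContDiff SchwartzMap FourierTransform LineDeriv

/-! ### Functions of the distance to a graph -/

theorem hasTemperateGrowth_fst : (fun p : ℝ × ℝ => p.1).HasTemperateGrowth :=
  (ContinuousLinearMap.fst ℝ ℝ ℝ).hasTemperateGrowth

theorem hasTemperateGrowth_snd : (fun p : ℝ × ℝ => p.2).HasTemperateGrowth :=
  (ContinuousLinearMap.snd ℝ ℝ ℝ).hasTemperateGrowth

theorem hasTemperateGrowth_prodMk {f g : ℝ × ℝ → ℝ} (hf : f.HasTemperateGrowth)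
    (hg : g.HasTemperateGrowth) : (fun p => (f p, g p)).HasTemperateGrowth := by
  have h1 := ((ContinuousLinearMap.inl ℝ ℝ ℝ).hasTemperateGrowth.comp hf).add
    ((ContinuousLinearMap.inr ℝ ℝ ℝ).hasTemperateGrowth.comp hg)
  convert h1 using 1
  ext p <;> simp

section Layer

variable {a κ θ : ℝ → ℝ}

/-- Composition keeps E Schwartz because the inner map has temperate growth and is proper with
linear control: |y| is bounded by |θ(y - a(x))| plus constants, by `hc` and the boundedness of a. -/
theorem exists_layer (E : 𝓢(ℝ × ℝ, ℝ)) (ha : a.HasTemperateGrowth) {A : ℝ} (hA : ∀ x, |a x| ≤ A)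
    (hκ : κ.HasTemperateGrowth) (hθ : θ.HasTemperateGrowth) {c : ℝ} (hc : ∀ s, |s| ≤ |θ s| + c) :
    ∃ ψ : 𝓢(ℝ × ℝ, ℝ), ∀ x y, ψ (x, y) = κ (y - a x) * E (x, θ (y - a x)) := by
  have h1 : (fun p : ℝ × ℝ => p.2 - a p.1).HasTemperateGrowth :=
    hasTemperateGrowth_snd.sub (ha.comp hasTemperateGrowth_fst)
  have hm : (fun p : ℝ × ℝ => (p.1, θ (p.2 - a p.1))).HasTemperateGrowth :=
    hasTemperateGrowth_prodMk hasTemperateGrowth_fst (hθ.comp h1)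
  have hk : (fun p : ℝ × ℝ => κ (p.2 - a p.1)).HasTemperateGrowth := hκ.comp h1
  have hA0 : 0 ≤ A := (abs_nonneg _).trans (hA 0)
  have hub : ∃ (k : ℕ) (C : ℝ), ∀ p : ℝ × ℝ, ‖p‖ ≤ C * (1 + ‖(p.1, θ (p.2 - a p.1))‖) ^ k := by
    refine ⟨1, 1 + |c| + A, fun p => ?_⟩
    rw [pow_one]
    set q := (p.1, θ (p.2 - a p.1))
    have h2 : |p.1| ≤ ‖q‖ := norm_fst_le q
    have h3 : |θ (p.2 - a p.1)| ≤ ‖q‖ := norm_snd_le q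
    have h4 := hc (p.2 - a p.1)
    have h5 : |p.2| ≤ |p.2 - a p.1| + |a p.1| := by
      simpa using abs_add_le (p.2 - a p.1) (a p.1)
    have h6 := hA p.1
    have h7 : 0 ≤ (|c| + A) * ‖q‖ := by positivity
    have h8 := le_abs_self c
    have h9 := abs_nonneg c
    refine max_le ?_ ?_
    · rw [Real.norm_eq_abs]
      nlinarith [norm_nonneg q]
    · rw [Real.norm_eq_abs]
      nlinarith [norm_nonneg q]
  refine ⟨SchwartzMap.smulLeftCLM ℝ (fun p : ℝ × ℝ => κ (p.2 - a p.1))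
    (SchwartzMap.compCLM ℝ hm hub E), fun x y => ?_⟩
  rw [SchwartzMap.smulLeftCLM_apply_apply hk, SchwartzMap.compCLM_apply]
  rfl

theorem hasDerivAt_schwartz_fst (ψ : 𝓢(ℝ × ℝ, ℝ)) (x y : ℝ) :
    HasDerivAt (fun t => ψ (t, y)) (fderiv ℝ ψ (x, y) (1, 0)) x := by
  have h1 := (ψ.hasFDerivAt (x, y)).comp_hasDerivAt (f := fun t : ℝ => (t, y)) x
    ((hasDerivAt_id x).prodMk (hasDerivAt_const x y))
  exact h1

theorem hasDerivAt_schwartz_snd (ψ : 𝓢(ℝ × ℝ, ℝ)) (x y : ℝ) :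
    HasDerivAt (fun t => ψ (x, t)) (fderiv ℝ ψ (x, y) (0, 1)) y := by
  have h1 := (ψ.hasFDerivAt (x, y)).comp_hasDerivAt (f := fun t : ℝ => (x, t)) y
    ((hasDerivAt_const y x).prodMk (hasDerivAt_id y))
  exact h1

theorem fderiv_apply_prod (E : 𝓢(ℝ × ℝ, ℝ)) (q : ℝ × ℝ) (b c : ℝ) :
    fderiv ℝ E q (b, c) = b * fderiv ℝ E q (1, 0) + c * fderiv ℝ E q (0, 1) := by
  have h1 : ((b, c) : ℝ × ℝ) = b • (1, 0) + c • (0, 1) := by simp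
  rw [h1, map_add, map_smul, map_smul, smul_eq_mul, smul_eq_mul]

variable {E ψ : 𝓢(ℝ × ℝ, ℝ)} {κ' θ' a' : ℝ → ℝ}

theorem layer_fderiv_snd (hψ : ∀ x y, ψ (x, y) = κ (y - a x) * E (x, θ (y - a x)))
    (hκ : ∀ s, HasDerivAt κ (κ' s) s) (hθ : ∀ s, HasDerivAt θ (θ' s) s) (x y : ℝ) :
    fderiv ℝ ψ (x, y) (0, 1) = κ' (y - a x) * E (x, θ (y - a x)) +
      κ (y - a x) * (θ' (y - a x) * fderiv ℝ E (x, θ (y - a x)) (0, 1)) := by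
  have h0 : HasDerivAt (fun t => t - a x) 1 y := (hasDerivAt_id y).sub_const _
  have h1 := (hκ (y - a x)).comp y h0
  have h2 := (hθ (y - a x)).comp y h0
  have h3 := (E.hasFDerivAt (x, θ (y - a x))).comp_hasDerivAt
    (f := fun t : ℝ => (x, θ (t - a x))) y ((hasDerivAt_const y x).prodMk h2)
  have h4 := h1.mul h3
  have h5 := hasDerivAt_schwartz_snd ψ x y
  have h6 : (fun t => ψ (x, t)) = fun t => κ (t - a x) * E (x, θ (t - a x)) := by
    ext t
    exact hψ x t
  rw [h6] at h5
  rw [h5.unique h4, fderiv_apply_prod]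
  simp

theorem layer_fderiv_fst (hψ : ∀ x y, ψ (x, y) = κ (y - a x) * E (x, θ (y - a x)))
    (hκ : ∀ s, HasDerivAt κ (κ' s) s) (hθ : ∀ s, HasDerivAt θ (θ' s) s)
    (ha : ∀ s, HasDerivAt a (a' s) s) (x y : ℝ) :
    fderiv ℝ ψ (x, y) (1, 0) = κ (y - a x) * fderiv ℝ E (x, θ (y - a x)) (1, 0) -
      a' x * fderiv ℝ ψ (x, y) (0, 1) := by
  have h0 : HasDerivAt (fun t => y - a t) (-a' x) x := (ha x).const_sub y
  have h1 := (hκ (y - a x)).comp x h0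
  have h2 := (hθ (y - a x)).comp x h0
  have h3 := (E.hasFDerivAt (x, θ (y - a x))).comp_hasDerivAt
    (f := fun t : ℝ => (t, θ (y - a t))) x ((hasDerivAt_id x).prodMk h2)
  have h4 := h1.mul h3
  have h5 := hasDerivAt_schwartz_fst ψ x y
  have h6 : (fun t => ψ (t, y)) = fun t => κ (y - a t) * E (t, θ (y - a t)) := by
    ext t
    exact hψ t y
  rw [h6] at h5
  rw [h5.unique h4, fderiv_apply_prod, layer_fderiv_snd hψ hκ hθ]
  simp
  ring

/-- By the chain rule ψ_y = κ'E + κθ'E_y and ψ_x = κE_x - a'ψ_y. Only bounds on first derivatives of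
a, κ, θ enter, so the estimate does not deteriorate as the smoothing parameter tends to 0. -/
theorem layer_grad_sq_le (hψ : ∀ x y, ψ (x, y) = κ (y - a x) * E (x, θ (y - a x)))
    (hκ : ∀ s, HasDerivAt κ (κ' s) s) (hθ : ∀ s, HasDerivAt θ (θ' s) s)
    (ha : ∀ s, HasDerivAt a (a' s) s) {K T L : ℝ} (hκ1 : ∀ s, |κ s| ≤ 1) (hκK : ∀ s, |κ' s| ≤ K)
    (hθT : ∀ s, |θ' s| ≤ T) (haL : ∀ s, |a' s| ≤ L) (p : ℝ × ℝ) :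
    fderiv ℝ ψ p (1, 0) ^ 2 + fderiv ℝ ψ p (0, 1) ^ 2 ≤
      2 * fderiv ℝ E (p.1, θ (p.2 - a p.1)) (1, 0) ^ 2 + (1 + 2 * L ^ 2) *
        (2 * K ^ 2 * E (p.1, θ (p.2 - a p.1)) ^ 2 +
          2 * T ^ 2 * fderiv ℝ E (p.1, θ (p.2 - a p.1)) (0, 1) ^ 2) := by
  obtain ⟨x, y⟩ := p
  dsimp only
  rw [layer_fderiv_fst hψ hκ hθ ha x y]
  set Y := fderiv ℝ ψ (x, y) (0, 1) with hY
  have h1 := layer_fderiv_snd hψ hκ hθ x y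
  rw [← hY] at h1
  set s := y - a x
  set e := E (x, θ s)
  set e1 := fderiv ℝ E (x, θ s) (1, 0)
  set e2 := fderiv ℝ E (x, θ s) (0, 1)
  have sqb : ∀ {u v : ℝ}, |u| ≤ v → u ^ 2 ≤ v ^ 2 := fun {u v} h => by
    rw [← sq_abs u]; exact pow_le_pow_left₀ (abs_nonneg _) h 2
  have k1 : κ s ^ 2 ≤ 1 := by simpa using sqb (hκ1 s)
  have k2 := sqb (hκK s)
  have k3 := sqb (hθT s)
  have k4 := sqb (haL x)
  have k5 : κ s ^ 2 * θ' s ^ 2 ≤ T ^ 2 := by nlinarith [sq_nonneg (κ s), sq_nonneg (θ' s)]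
  have hYb : Y ^ 2 ≤ 2 * K ^ 2 * e ^ 2 + 2 * T ^ 2 * e2 ^ 2 := by
    have : Y ^ 2 ≤ 2 * (κ' s ^ 2 * e ^ 2) + 2 * (κ s ^ 2 * θ' s ^ 2 * e2 ^ 2) := by
      rw [h1]
      nlinarith [sq_nonneg (κ' s * e - κ s * (θ' s * e2))]
    nlinarith [mul_le_mul_of_nonneg_right k2 (sq_nonneg e),
      mul_le_mul_of_nonneg_right k5 (sq_nonneg e2)]
  have h2 : (κ s * e1 - a' x * Y) ^ 2 ≤ 2 * e1 ^ 2 + 2 * L ^ 2 * Y ^ 2 := by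
    have : (κ s * e1 - a' x * Y) ^ 2 ≤ 2 * (κ s ^ 2 * e1 ^ 2) + 2 * (a' x ^ 2 * Y ^ 2) := by
      nlinarith [sq_nonneg (κ s * e1 + a' x * Y)]
    nlinarith [mul_le_mul_of_nonneg_right k1 (sq_nonneg e1),
      mul_le_mul_of_nonneg_right k4 (sq_nonneg Y)]
  nlinarith [mul_le_mul_of_nonneg_left hYb (by positivity : 0 ≤ 1 + 2 * L ^ 2)]

end Layer

/-! ### Energy of a layer -/

theorem measurePreserving_shear {a : ℝ → ℝ} (ha : Measurable a) :
    MeasurePreserving (fun p : ℝ × ℝ => (p.1, p.2 - a p.1)) := by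
  refine (MeasurePreserving.id (volume : Measure ℝ)).skew_product (g := fun x y => y - a x)
    (by fun_prop) (Eventually.of_forall fun x => ?_)
  exact (measurePreserving_sub_right volume (a x)).map_eq

theorem exists_decay_sq (F : 𝓢(ℝ × ℝ, ℝ)) : ∃ c, 0 ≤ c ∧ ∀ x s, F (x, s) ^ 2 ≤ c * (1 + x ^ 2)⁻¹ := by
  obtain ⟨c0, -, h0⟩ := F.decay 0 0
  obtain ⟨c1, -, h1⟩ := F.decay 1 0
  refine ⟨c0 ^ 2 + c1 ^ 2, by positivity, fun x s => ?_⟩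
  have h2 := h0 (x, s)
  have h3 := h1 (x, s)
  rw [norm_iteratedFDeriv_zero, Real.norm_eq_abs] at h2 h3
  rw [pow_zero, one_mul] at h2
  rw [pow_one] at h3
  have h4 : |x| ≤ ‖(x, s)‖ := norm_fst_le (x, s)
  have h5 : |x| * |F (x, s)| ≤ c1 := (mul_le_mul_of_nonneg_right h4 (abs_nonneg _)).trans h3
  have h6 := pow_le_pow_left₀ (abs_nonneg _) h2 2
  have h7 := pow_le_pow_left₀ (by positivity) h5 2
  rw [mul_pow, sq_abs, sq_abs] at h7
  rw [sq_abs] at h6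
  rw [← div_eq_mul_inv, le_div_iff₀ (by positivity)]
  linarith

/-- A shear preserves area, so a may be taken to be 0. Flattening then alters F only in the strip
|s| < 2ε, where F² ≤ c/(1 + x²). The threshold ε₀ does not depend on a, which lets the approximation
of the graph be chosen after ε. -/
theorem integral_layer_sq_le (F : 𝓢(ℝ × ℝ, ℝ)) {δ : ℝ} (hδ : 0 < δ) :
    ∃ ε₀, 0 < ε₀ ∧ ∀ ε, 0 < ε → ε ≤ ε₀ → ∀ a : ℝ → ℝ, Continuous a →
      Integrable (fun p : ℝ × ℝ => F (p.1, flatAt ε (p.2 - a p.1)) ^ 2) ∧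
      ∫ p : ℝ × ℝ, F (p.1, flatAt ε (p.2 - a p.1)) ^ 2 ≤ (∫ p, F p ^ 2) + δ := by
  obtain ⟨c, hc0, hc⟩ := exists_decay_sq F
  -- The strip contributes at most 4ε·cπ, where ∫(1 + x²)⁻¹ = π.
  refine ⟨δ / (4 * (c + 1) * Real.pi), by have := Real.pi_pos; positivity,
    fun ε hε hle a ha => ?_⟩
  have hfl : Continuous (flatAt ε) := (hasTemperateGrowth_flatAt ε).1.continuous
  set B : ℝ × ℝ → ℝ := fun p => c * (1 + p.1 ^ 2)⁻¹ *
    (Set.Icc (-(2 * ε)) (2 * ε)).indicator (fun _ => 1) p.2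
  have hB : Integrable B := (integrable_inv_one_add_sq.const_mul c).mul_prod
    ((integrable_indicator_iff measurableSet_Icc).2 (integrableOn_const (by simp)))
  have hBi : ∫ p, B p = c * Real.pi * (4 * ε) := by
    have h1 := integral_prod_mul (μ := (volume : Measure ℝ)) (ν := (volume : Measure ℝ))
      (fun x : ℝ => c * (1 + x ^ 2)⁻¹) ((Set.Icc (-(2 * ε)) (2 * ε)).indicator (fun _ => (1 : ℝ)))
    refine h1.trans ?_
    rw [integral_const_mul, integral_univ_inv_one_add_sq, integral_indicator measurableSet_Icc]
    simp [Measure.real]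
    rw [ENNReal.toReal_ofReal (by linarith)]
    ring_nf
    simp
  have hF : Integrable fun p => F p ^ 2 := by
    simpa using integrable_norm_sq (μ := (volume : Measure (ℝ × ℝ))) F
  have hpt : ∀ p : ℝ × ℝ, F (p.1, flatAt ε p.2) ^ 2 ≤ F p ^ 2 + B p := by
    rintro ⟨x, s⟩
    by_cases h : 2 * ε ≤ |s|
    · have : 0 ≤ B (x, s) := by
        refine mul_nonneg (by positivity) (Set.indicator_nonneg (fun _ _ => zero_le_one) _)
      dsimp only
      rw [flatAt_eq_self hε h]
      linarith
    · have hs : s ∈ Set.Icc (-(2 * ε)) (2 * ε) := abs_le.1 (not_le.1 h).le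
      have h2 : B (x, s) = c * (1 + x ^ 2)⁻¹ := by simp only [B, Set.indicator_of_mem hs, mul_one]
      rw [h2]
      linarith [hc x (flatAt ε s), sq_nonneg (F (x, s))]
  have hcont : Continuous fun p : ℝ × ℝ => F (p.1, flatAt ε p.2) ^ 2 := by
    have := F.continuous
    fun_prop
  have hint : Integrable fun p : ℝ × ℝ => F (p.1, flatAt ε p.2) ^ 2 :=
    (hF.add hB).mono' hcont.aestronglyMeasurable (Eventually.of_forall fun p => by
      rw [Real.norm_of_nonneg (sq_nonneg _)]
      exact hpt p)
  have hmp := measurePreserving_shear ha.measurable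
  refine ⟨(hmp.integrable_comp hcont.aestronglyMeasurable).2 hint, ?_⟩
  have h1 : ∫ p : ℝ × ℝ, F (p.1, flatAt ε (p.2 - a p.1)) ^ 2 =
      ∫ p : ℝ × ℝ, F (p.1, flatAt ε p.2) ^ 2 := by
    conv_rhs => rw [← hmp.map_eq]
    rw [integral_map hmp.measurable.aemeasurable hcont.aestronglyMeasurable]
  rw [h1]
  refine (integral_mono hint (hF.add hB) hpt).trans ?_
  rw [integral_add' hF hB, hBi]
  refine add_le_add le_rfl ?_
  have hpi := Real.pi_pos
  rw [le_div_iff₀ (by positivity)] at hle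
  nlinarith [mul_pos hε hpi]

end TwoLayer
end

/-! ### Lifts near a single graph, and the geometry of the domains. -/

noncomputable section

namespace TwoLayer

open scoped ComplexConjugate ContDiff SchwartzMap FourierTransform LineDeriv

/-! ### Lifts of test data -/

/-- The squared length of the gradient. -/
def gradSq (u : ℝ × ℝ → ℝ) (p : ℝ × ℝ) : ℝ := fderiv ℝ u p (1, 0) ^ 2 + fderiv ℝ u p (0, 1) ^ 2

theorem gradSq_nonneg (u : ℝ × ℝ → ℝ) (p : ℝ × ℝ) : 0 ≤ gradSq u p :=
  add_nonneg (sq_nonneg _) (sq_nonneg _)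

theorem integrable_sq (F : 𝓢(ℝ × ℝ, ℝ)) : Integrable fun p => F p ^ 2 := by
  simpa using integrable_norm_sq (μ := (volume : Measure (ℝ × ℝ))) F

theorem integrable_gradSq (ψ : 𝓢(ℝ × ℝ, ℝ)) : Integrable (gradSq ψ) :=
  (integrable_sq (∂_{((1 : ℝ), (0 : ℝ))} ψ)).add (integrable_sq (∂_{((0 : ℝ), (1 : ℝ))} ψ))

theorem IsTest.eq_zero_of_integral {φ : ℝ → ℂ} (hφ : IsTest φ) {l : ℝ → ℝ} (hl : IsScale l)
    (h : ∫ k, l k * ‖φ k‖ ^ 2 ≤ 0) (x : ℝ) : hφ.phys x = 0 := by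
  have h0 : 0 ≤ᵐ[volume] fun k => l k * ‖φ k‖ ^ 2 := by
    filter_upwards [ae_ne_zero] with k hk
    have := hl.pos k hk
    show (0 : ℝ) ≤ _
    positivity
  have h1 := (integral_eq_zero_iff_of_nonneg_ae h0 (hφ.integrable_mul hl.continuousOn)).1
    (le_antisymm h (integral_nonneg_of_ae h0))
  rw [hφ.phys_apply, integral_eq_zero_of_ae, Complex.zero_re, mul_zero]
  filter_upwards [h1, ae_ne_zero] with k hk hk0
  have h2 := (mul_eq_zero.1 hk).resolve_left (hl.pos k hk0).ne'
  have h3 : φ k = 0 := by simpa using h2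
  rw [h3, mul_zero]
  rfl

/-- The lift is κ(s)E(x, θ(s)), with s the vertical distance to a smooth a within ε/2 of f, E the
planar extension and θ vanishing for |s| ≤ ε. On |y - f| ≤ ε/2 it thus equals the datum exactly and
does not depend on y. Hypothesis `hC₀` makes k²/l and K²/l at most C₀l, so all terms of the energy
reduce to ∫ l|φ|². -/
theorem exists_layer_lift {f κ κ' l : ℝ → ℝ} {A K r C₀ : ℝ} {L : NNReal} (hA : ∀ x, |f x| ≤ A)
    (hL : LipschitzWith L f) (hκ : κ.HasTemperateGrowth) (hκ' : ∀ s, HasDerivAt κ (κ' s) s)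
    (hκ1 : ∀ s, |κ s| ≤ 1) (hκK : ∀ s, |κ' s| ≤ K) (hr : 0 < r) (hκr : ∀ s, |s| ≤ r → κ s = 1)
    (hl : IsScale l) (hC₀ : ∀ k, k ≠ 0 → k ^ 2 + K ^ 2 ≤ C₀ * l k ^ 2) :
    ∃ C, 0 ≤ C ∧ ∀ (φ : ℝ → ℂ) (hφ : IsTest φ), ∃ (ψ : 𝓢(ℝ × ℝ, ℝ)) (ε : ℝ), 0 < ε ∧
      (∀ x y, |y - f x| ≤ ε → ψ (x, y) = hφ.phys x) ∧
      (∀ x y, (∀ s, |s - (y - f x)| ≤ r → κ s = 0) → ψ (x, y) = 0) ∧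
      ∫ p, gradSq ψ p ≤ C * ∫ k, l k * ‖φ k‖ ^ 2 := by
  obtain ⟨T, hT0, hT⟩ := exists_bound_deriv_flat
  have hec := extConst_nonneg
  have hC₀0 : 0 ≤ C₀ := by
    have h1 := hC₀ 1 one_ne_zero
    have h2 := hl.pos 1 one_ne_zero
    by_contra h
    nlinarith [sq_nonneg K, mul_pos h2 h2]
  refine ⟨2 * (extConst * C₀ + 1) + (1 + 2 * (L : ℝ) ^ 2) *
    (2 * (extConst * C₀ + K ^ 2) + 2 * T ^ 2 * (extConst + 1)), by positivity, fun φ hφ => ?_⟩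
  set J := ∫ k, l k * ‖φ k‖ ^ 2 with hJ
  -- The flattening error is allowed to be as large as J itself, which requires J > 0. If J = 0 the
  -- datum vanishes and ψ = 0 serves.
  rcases le_or_gt J 0 with h0 | hJ0
  · have h1 := hφ.eq_zero_of_integral hl h0
    have hJe : J = 0 := le_antisymm h0 (integral_nonneg_of_ae (by
      filter_upwards [ae_ne_zero] with k hk
      have := hl.pos k hk
      show (0 : ℝ) ≤ _
      positivity))
    refine ⟨0, 1, one_pos, fun x y _ => (h1 x).symm, fun _ _ _ => rfl, ?_⟩
    rw [hJe, mul_zero]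
    have h2 : ⇑(0 : 𝓢(ℝ × ℝ, ℝ)) = fun _ => 0 := rfl
    rw [h2]
    simp [gradSq]
  have hlc := hl.continuousOn
  have hli : ContinuousOn (fun k => (l k)⁻¹) {0}ᶜ := hlc.inv₀ fun k hk => (hl.pos k hk).ne'
  set E := extend hφ hl
  obtain ⟨e0, he0, H0⟩ := integral_layer_sq_le E hJ0
  obtain ⟨e1, he1, H1⟩ := integral_layer_sq_le (∂_{((1 : ℝ), (0 : ℝ))} E) hJ0
  obtain ⟨e2, he2, H2⟩ := integral_layer_sq_le (∂_{((0 : ℝ), (1 : ℝ))} E) hJ0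
  set ε := min (min e0 e1) (min e2 r)
  have hε : 0 < ε := lt_min (lt_min he0 he1) (lt_min he2 hr)
  have hεr : ε ≤ r := (min_le_right _ _).trans (min_le_right _ _)
  -- ε comes first, from the extension alone; the graph is then approximated to within ε/2.
  obtain ⟨a, ha, hae, haL⟩ := exists_smooth_approx hA hL (half_pos hε)
  have hac : Continuous a := ha.1.continuous
  have had : ∀ x, HasDerivAt a (deriv a x) x := fun x =>
    (ha.1.differentiable (by simp) x).hasDerivAt
  have haA : ∀ x, |a x| ≤ A + ε := fun x => by
    have h1 := abs_add_le (a x - f x) (f x)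
    rw [sub_add_cancel] at h1
    linarith [hae x, hA x]
  obtain ⟨ψ, hψ⟩ := exists_layer E ha haA hκ (hasTemperateGrowth_flatAt ε)
    (abs_le_flatAt hε)
  refine ⟨ψ, ε / 2, half_pos hε, fun x y h => ?_, fun x y h => ?_, ?_⟩
  · have h1 : |y - a x| ≤ ε := by
      have h2 := abs_sub_le y (f x) (a x)
      rw [abs_sub_comm (f x)] at h2
      linarith [hae x]
    rw [hψ, hκr _ (h1.trans hεr), flatAt_eq_zero hε h1, one_mul]
    exact extend_zero hφ hl x
  · rw [hψ, h, zero_mul]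
    have h1 : y - a x - (y - f x) = -(a x - f x) := by ring
    rw [h1, abs_neg]
    linarith [hae x]
  · obtain ⟨I0, B0⟩ := H0 ε hε ((min_le_left _ _).trans (min_le_left _ _)) a hac
    obtain ⟨I1, B1⟩ := H1 ε hε ((min_le_left _ _).trans (min_le_right _ _)) a hac
    obtain ⟨I2, B2⟩ := H2 ε hε ((min_le_right _ _).trans (min_le_left _ _)) a hac
    have hb := integral_mono (integrable_gradSq ψ)
      ((I1.const_mul 2).add (((I0.const_mul (2 * K ^ 2)).add
        (I2.const_mul (2 * T ^ 2))).const_mul (1 + 2 * (L : ℝ) ^ 2)))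
      (fun p => layer_grad_sq_le hψ hκ' (hasDerivAt_flatAt hε) had hκ1 hκK (fun s => hT _) haL p)
    refine hb.trans ?_
    rw [integral_add' (I1.const_mul 2) (((I0.const_mul (2 * K ^ 2)).add
        (I2.const_mul (2 * T ^ 2))).const_mul (1 + 2 * (L : ℝ) ^ 2)), integral_const_mul,
      integral_const_mul, integral_add' (I0.const_mul (2 * K ^ 2)) (I2.const_mul (2 * T ^ 2)),
      integral_const_mul, integral_const_mul]
    have M1 : ∫ k, k ^ 2 * (l k)⁻¹ * ‖φ k‖ ^ 2 ≤ C₀ * J := by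
      rw [hJ, ← integral_const_mul]
      refine integral_mono_ae (hφ.integrable_mul ((continuous_pow 2).continuousOn.mul hli))
        ((hφ.integrable_mul hlc).const_mul _) ?_
      filter_upwards [ae_ne_zero] with k hk
      have h1 := hl.pos k hk
      have h2 : k ^ 2 * (l k)⁻¹ ≤ C₀ * l k := by
        rw [← div_eq_mul_inv, div_le_iff₀ h1]
        linarith [hC₀ k hk, sq_nonneg K]
      rw [← mul_assoc]
      exact mul_le_mul_of_nonneg_right h2 (sq_nonneg _)
    have M0 : K ^ 2 * ∫ k, (l k)⁻¹ * ‖φ k‖ ^ 2 ≤ C₀ * J := by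
      rw [hJ, ← integral_const_mul, ← integral_const_mul]
      refine integral_mono_ae ((hφ.integrable_mul hli).const_mul _)
        ((hφ.integrable_mul hlc).const_mul _) ?_
      filter_upwards [ae_ne_zero] with k hk
      have h1 := hl.pos k hk
      have h2 : K ^ 2 * (l k)⁻¹ ≤ C₀ * l k := by
        rw [← div_eq_mul_inv, div_le_iff₀ h1]
        linarith [hC₀ k hk, sq_nonneg k]
      rw [← mul_assoc, ← mul_assoc]
      exact mul_le_mul_of_nonneg_right h2 (sq_nonneg _)
    have N0 : K ^ 2 * ∫ p, E p ^ 2 ≤ extConst * C₀ * J := by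
      have h1 := mul_le_mul_of_nonneg_left (integral_extend_sq_le hφ hl) (sq_nonneg K)
      nlinarith [mul_le_mul_of_nonneg_left M0 hec]
    have N1 := (integral_extend_x_sq_le hφ hl).trans (mul_le_mul_of_nonneg_left M1 hec)
    have N2 := integral_extend_y_sq_le hφ hl
    have Q1 := B1.trans (add_le_add_left N1 J)
    have Q2 := mul_le_mul_of_nonneg_left (B2.trans (add_le_add_left N2 J))
      (by positivity : 0 ≤ 2 * T ^ 2)
    have Q0 := mul_le_mul_of_nonneg_left B0 (sq_nonneg K)
    have Q3 : 2 * K ^ 2 * ∫ p : ℝ × ℝ, E (p.1, flatAt ε (p.2 - a p.1)) ^ 2 ≤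
        2 * (extConst * C₀ + K ^ 2) * J := by linarith
    have Q4 := mul_le_mul_of_nonneg_left (add_le_add Q3 Q2)
      (by positivity : 0 ≤ 1 + 2 * (L : ℝ) ^ 2)
    simp only [SchwartzMap.lineDerivOp_apply_eq_fderiv] at Q1 Q4
    nlinarith [Q1, Q4]

/-- The lower domain has infinite depth, so no cutoff is needed: with κ = 1 the zeroth-order term
disappears and the homogeneous scale l = |k| is admissible. -/
theorem exists_lower_lift {f : ℝ → ℝ} (hf : IsW1Inf f) :
    ∃ C, 0 ≤ C ∧ ∀ (φ : ℝ → ℂ) (hφ : IsTest φ), ∃ (ψ : 𝓢(ℝ × ℝ, ℝ)) (ε : ℝ), 0 < ε ∧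
      (∀ x y, |y - f x| ≤ ε → ψ (x, y) = hφ.phys x) ∧
      ∫ p, gradSq ψ p ≤ C * ∫ k, |k| * ‖φ k‖ ^ 2 := by
  obtain ⟨⟨A, hA⟩, L, hL⟩ := hf
  obtain ⟨C, hC, H⟩ := exists_layer_lift (κ := fun _ => 1) (κ' := fun _ => 0) (K := 0) (r := 1)
    (C₀ := 1) hA hL (.const 1) (fun s => hasDerivAt_const s 1) (by simp) (by simp) one_pos
    (fun _ _ => rfl) isScale_abs (fun k _ => by simp)
  refine ⟨C, hC, fun φ hφ => ?_⟩
  obtain ⟨ψ, ε, hε, h1, -, h2⟩ := H φ hφ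
  exact ⟨ψ, ε, hε, h1, h2⟩

/-- Flattening at scale M about the line y = 0 continues a function of x alone from the strip |y| ≤
M to a Schwartz function; its size outside the strip is irrelevant. -/
theorem exists_flat_lift {φ : ℝ → ℂ} (hφ : IsTest φ) {M : ℝ} (hM : 0 < M) :
    ∃ ψ : 𝓢(ℝ × ℝ, ℝ), ∀ x y, |y| ≤ M → ψ (x, y) = hφ.phys x := by
  obtain ⟨ψ, hψ⟩ := exists_layer (extend hφ isScale_abs) (a := fun _ => 0) (κ := fun _ => 1)
    (.const 0) (A := 0) (by simp) (.const 1) (hasTemperateGrowth_flatAt M) (abs_le_flatAt hM)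
  refine ⟨ψ, fun x y h => ?_⟩
  rw [hψ, sub_zero, flatAt_eq_zero hM h, one_mul]
  exact extend_zero hφ isScale_abs x

theorem fderiv_of_eq_fst {ψ : 𝓢(ℝ × ℝ, ℝ)} {P P' : ℝ → ℝ} {x y : ℝ} (hP : HasDerivAt P (P' x) x)
    (h : ∀ᶠ p : ℝ × ℝ in 𝓝 (x, y), ψ p = P p.1) :
    fderiv ℝ ψ (x, y) (1, 0) = P' x ∧ fderiv ℝ ψ (x, y) (0, 1) = 0 := by
  have h1 : ∀ᶠ t in 𝓝 x, ψ (t, y) = P t :=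
    (Continuous.tendsto (by fun_prop : Continuous fun t : ℝ => (t, y)) x).eventually h
  have h2 : ∀ᶠ t in 𝓝 y, ψ (x, t) = P x :=
    (Continuous.tendsto (by fun_prop : Continuous fun t : ℝ => (x, t)) y).eventually h
  exact ⟨(hasDerivAt_schwartz_fst ψ x y).unique (hP.congr_of_eventuallyEq h1),
    (hasDerivAt_schwartz_snd ψ x y).unique ((hasDerivAt_const y (P x)).congr_of_eventuallyEq h2)⟩

/-! ### Geometry of the domains -/

theorem IsW1Inf.continuous {f : ℝ → ℝ} (hf : IsW1Inf f) : Continuous f := hf.2.choose_spec.continuous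

theorem IsW1Inf.one_add {f : ℝ → ℝ} (hf : IsW1Inf f) : IsW1Inf fun x => 1 + f x := by
  obtain ⟨⟨A, hA⟩, L, hL⟩ := hf
  refine ⟨⟨1 + A, fun x => (abs_add_le _ _).trans ?_⟩, L, fun x y => by simpa using hL x y⟩
  rw [abs_one]
  linarith [hA x]

theorem depth_lt {h₀ : ℝ} {η : (ℝ → ℝ) × (ℝ → ℝ)} (hη : η ∈ ClassW h₀) (x : ℝ) :
    h₀ < 1 + η.2 x - η.1 x := by
  obtain ⟨⟨⟨A, hA⟩, -⟩, ⟨⟨B, hB⟩, -⟩, h⟩ := hη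
  have h1 : BddBelow (Set.range fun x => η.2 x - η.1 x) := by
    refine ⟨-B - A, ?_⟩
    rintro _ ⟨z, rfl⟩
    have h2 := abs_le.1 (hA z)
    have h3 := abs_le.1 (hB z)
    dsimp only
    linarith
  have := ciInf_le h1 x
  linarith

theorem isOpen_lowerDomain {f : ℝ → ℝ} (hf : Continuous f) : IsOpen (lowerDomain f) :=
  isOpen_lt continuous_snd (hf.comp continuous_fst)

theorem isOpen_upperDomain {η : (ℝ → ℝ) × (ℝ → ℝ)} (h1 : Continuous η.1) (h2 : Continuous η.2) :
    IsOpen (upperDomain η) :=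
  (isOpen_lt (h1.comp continuous_fst) continuous_snd).inter
    (isOpen_lt continuous_snd (continuous_const.add (h2.comp continuous_fst)))

end TwoLayer
end

/-! ### Lifts in the upper layer: splitting by frequency. -/

noncomputable section

namespace TwoLayer

open scoped ComplexConjugate ContDiff SchwartzMap FourierTransform LineDeriv

theorem IsTest.phys_add {φ₁ φ₂ φ : ℝ → ℂ} (h₁ : IsTest φ₁) (h₂ : IsTest φ₂) (hφ : IsTest φ)
    (h : ∀ k, φ k = φ₁ k + φ₂ k) (x : ℝ) : hφ.phys x = h₁.phys x + h₂.phys x := by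
  have hI : ∀ {χ : ℝ → ℂ}, IsTest χ → Integrable fun k : ℝ => Complex.exp (Complex.I * k * x) * χ k := by
    intro χ hχ
    refine (hχ.toSchwartz.integrable (μ := volume)).bdd_mul (c := 1) ?_ (Eventually.of_forall fun p => ?_)
    · exact Continuous.aestronglyMeasurable (by fun_prop)
    · rw [Complex.norm_exp]
      simp
  rw [hφ.phys_apply, h₁.phys_apply, h₂.phys_apply, ← mul_add, ← Complex.add_re,
    ← integral_add (hI h₁) (hI h₂)]
  simp only [h, mul_add]

theorem gradSq_add_le {u v w : ℝ × ℝ → ℝ} {p : ℝ × ℝ} (hu : DifferentiableAt ℝ u p)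
    (hv : DifferentiableAt ℝ v p) (hw : DifferentiableAt ℝ w p) :
    gradSq (fun p => u p + v p + w p) p ≤ 3 * (gradSq u p + gradSq v p + gradSq w p) := by
  have h1 : ∀ e, fderiv ℝ (fun p => u p + v p + w p) p e =
      fderiv ℝ u p e + fderiv ℝ v p e + fderiv ℝ w p e := by
    intro e
    have : fderiv ℝ (fun p => u p + v p + w p) p = fderiv ℝ u p + fderiv ℝ v p + fderiv ℝ w p :=
      ((hu.hasFDerivAt.add hv.hasFDerivAt).add hw.hasFDerivAt).fderiv
    rw [this]
    rfl
  have h2 : ∀ a b c : ℝ, (a + b + c) ^ 2 ≤ 3 * (a ^ 2 + b ^ 2 + c ^ 2) := fun a b c => by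
    nlinarith [sq_nonneg (a - b), sq_nonneg (b - c), sq_nonneg (a - c)]
  rw [gradSq, h1, h1]
  refine (add_le_add (h2 _ _ _) (h2 _ _ _)).trans (le_of_eq ?_)
  simp only [gradSq]
  ring

theorem bracket_sq (k : ℝ) : bracket k ^ 2 = 1 + k ^ 2 := Real.sq_sqrt (by positivity)

/-- Low-frequency part. -/
theorem IsTest.low {φ : ℝ → ℂ} (hφ : IsTest φ) : IsTest fun k => (((bracket k)⁻¹ : ℝ) : ℂ) * φ k :=
  hφ.mul (g := fun k => (((bracket k)⁻¹ : ℝ) : ℂ))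
    (fun k _ => Complex.ofRealCLM.contDiff.contDiffAt.comp k
      (contDiff_bracket.contDiffAt.inv (bracket_pos k).ne'))
    (fun k => by rw [bracket_neg, Complex.conj_ofReal])

/-- High-frequency part. -/
theorem IsTest.high {φ : ℝ → ℂ} (hφ : IsTest φ) :
    IsTest fun k => ((1 - (bracket k)⁻¹ : ℝ) : ℂ) * φ k :=
  hφ.mul (g := fun k => ((1 - (bracket k)⁻¹ : ℝ) : ℂ))
    (fun k _ => Complex.ofRealCLM.contDiff.contDiffAt.comp k
      (contDiffAt_const.sub (contDiff_bracket.contDiffAt.inv (bracket_pos k).ne')))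
    (fun k => by rw [bracket_neg, Complex.conj_ofReal])

theorem continuous_bracket : Continuous bracket := contDiff_bracket.continuous

theorem continuous_bracket_inv : Continuous fun k => (bracket k)⁻¹ :=
  continuous_bracket.inv₀ fun k => (bracket_pos k).ne'

/-- Since ⟨k⟩⁻² ≤ ⟨k⟩⁻¹, the derivative of the low part is bounded in L² by the H_⋆^{1/2} norm of
the datum. -/
theorem integral_low_le {φ : ℝ → ℂ} (hφ : IsTest φ) :
    ∫ x, hφ.low.deriv.phys x ^ 2 ≤ ∫ k, (bracket k)⁻¹ * k ^ 2 * ‖φ k‖ ^ 2 := by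
  refine hφ.low.deriv.integral_phys_sq_le.trans ?_
  refine integral_mono_of_nonneg (Eventually.of_forall fun _ => sq_nonneg _)
    (hφ.integrable_mul (continuous_bracket_inv.mul (continuous_pow 2)).continuousOn)
    (Eventually.of_forall fun k => ?_)
  have h1 := bracket_pos k
  have h2 : (bracket k)⁻¹ ≤ 1 := inv_le_one_of_one_le₀ (one_le_bracket k)
  have h3 : 0 ≤ (bracket k)⁻¹ := by positivity
  simp only [norm_mul, Complex.norm_I, Complex.norm_real, Real.norm_eq_abs, mul_pow, sq_abs, one_mul]
  nlinarith [mul_nonneg (mul_nonneg h3 (sub_nonneg.2 h2)) (mul_nonneg (sq_nonneg k) (sq_nonneg ‖φ k‖))]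

/-- The inequality is (⟨k⟩ - 1)² ≤ ⟨k⟩² - 1 divided by ⟨k⟩: the high part lies in H^{1/2} with norm
at most the H_⋆^{1/2} norm of the whole. -/
theorem high_le {φ : ℝ → ℂ} (k : ℝ) :
    bracket k * ‖((1 - (bracket k)⁻¹ : ℝ) : ℂ) * φ k‖ ^ 2 ≤ (bracket k)⁻¹ * k ^ 2 * ‖φ k‖ ^ 2 := by
  have h1 := bracket_pos k
  have h2 := one_le_bracket k
  rw [norm_mul, Complex.norm_real, Real.norm_eq_abs, mul_pow, sq_abs, ← mul_assoc]
  refine mul_le_mul_of_nonneg_right ?_ (sq_nonneg _)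
  have h3 : k ^ 2 = bracket k ^ 2 - 1 := by rw [bracket_sq]; ring
  have h4 : bracket k * (1 - (bracket k)⁻¹) ^ 2 = (bracket k)⁻¹ * (bracket k - 1) ^ 2 := by
    field_simp
  rw [h4, h3]
  refine mul_le_mul_of_nonneg_left ?_ (by positivity)
  nlinarith

theorem integral_high_le {φ : ℝ → ℂ} (hφ : IsTest φ) :
    ∫ k, bracket k * ‖((1 - (bracket k)⁻¹ : ℝ) : ℂ) * φ k‖ ^ 2 ≤
      ∫ k, (bracket k)⁻¹ * k ^ 2 * ‖φ k‖ ^ 2 :=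
  integral_mono (hφ.high.integrable_mul continuous_bracket.continuousOn)
    (hφ.integrable_mul (continuous_bracket_inv.mul (continuous_pow 2)).continuousOn) high_le

theorem integral_high_add_le {φ χ : ℝ → ℂ} (hφ : IsTest φ) (hχ : IsTest χ) :
    ∫ k, bracket k * ‖((1 - (bracket k)⁻¹ : ℝ) : ℂ) * φ k + χ k‖ ^ 2 ≤
      2 * (∫ k, (bracket k)⁻¹ * k ^ 2 * ‖φ k‖ ^ 2) + 2 * ∫ k, bracket k * ‖χ k‖ ^ 2 := by
  have i1 : Integrable fun k => 2 * ((bracket k)⁻¹ * k ^ 2 * ‖φ k‖ ^ 2) :=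
    (hφ.integrable_mul (continuous_bracket_inv.mul (continuous_pow 2)).continuousOn).const_mul 2
  have i2 := (hχ.integrable_mul continuous_bracket.continuousOn).const_mul 2
  rw [← integral_const_mul, ← integral_const_mul, ← integral_add i1 i2]
  refine integral_mono ((hφ.high.add hχ).integrable_mul continuous_bracket.continuousOn) (i1.add i2)
    fun k => ?_
  have h1 := high_le (φ := φ) k
  have h2 := norm_add_le (((1 - (bracket k)⁻¹ : ℝ) : ℂ) * φ k) (χ k)
  set a := ‖((1 - (bracket k)⁻¹ : ℝ) : ℂ) * φ k‖
  set b := ‖χ k‖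
  have h3 : ‖((1 - (bracket k)⁻¹ : ℝ) : ℂ) * φ k + χ k‖ ^ 2 ≤ 2 * a ^ 2 + 2 * b ^ 2 := by
    refine (pow_le_pow_left₀ (norm_nonneg _) h2 2).trans ?_
    nlinarith [sq_nonneg (a - b)]
  have h4 := mul_le_mul_of_nonneg_left h3 (bracket_pos k).le
  show _ ≤ 2 * ((bracket k)⁻¹ * k ^ 2 * ‖φ k‖ ^ 2) + 2 * (bracket k * b ^ 2)
  linarith

/-- The lift is u + v + w: u carries the low part of φ unchanged in y through the bounded depth, v
carries the high part in a layer at the interface, and w carries the high part plus the jump χ in a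
layer at the surface. The traces add up to φ below and φ + χ above. -/
theorem exists_upper_lift {h₀ : ℝ} (hh₀ : 0 < h₀) {η : (ℝ → ℝ) × (ℝ → ℝ)} (hη : η ∈ ClassW h₀) :
    ∃ C, 0 ≤ C ∧ ∀ (φ χ σ : ℝ → ℂ) (hφ : IsTest φ) (_ : IsTest χ) (hσ : IsTest σ),
      (∀ k, σ k = φ k + χ k) → ∃ (ψ : 𝓢(ℝ × ℝ, ℝ)) (ε : ℝ), 0 < ε ∧
      (∀ x y, |y - η.1 x| ≤ ε → ψ (x, y) = hφ.phys x) ∧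
      (∀ x y, |y - (1 + η.2 x)| ≤ ε → ψ (x, y) = hσ.phys x) ∧
      ∫ p in upperDomain η, gradSq ψ p ≤
        C * ((∫ k, (bracket k)⁻¹ * k ^ 2 * ‖φ k‖ ^ 2) + ∫ k, bracket k * ‖χ k‖ ^ 2) := by
  have hdep := depth_lt hη
  obtain ⟨hη1, hη2, -⟩ := hη
  have hc1 := hη1.continuous
  have hc2 := hη2.continuous
  obtain ⟨⟨A, hA⟩, L, hL⟩ := hη1
  obtain ⟨⟨B, hB⟩, L', hL'⟩ := hη2.one_add
  have hA0 : 0 ≤ A := (abs_nonneg _).trans (hA 0)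
  have hB0 : 0 ≤ B := (abs_nonneg _).trans (hB 0)
  -- The cutoffs live in |s| ≤ 2r. As the depth exceeds 4r, errors of size r in both the position
  -- and the argument still leave each layer zero near the opposite boundary.
  set r : ℝ := h₀ / 4
  have hr : 0 < r := by positivity
  obtain ⟨K, hK0, hK⟩ := exists_bound_deriv_cutoff
  set κ : ℝ → ℝ := fun s => cutoff (s / r)
  set κ' : ℝ → ℝ := fun s => deriv cutoff (s / r) * (1 / r)
  have hκ' : ∀ s, HasDerivAt κ (κ' s) s := fun s =>
    ((contDiff_cutoff.differentiable (by simp) _).hasDerivAt).comp s ((hasDerivAt_id s).div_const r)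
  have hκK : ∀ s, |κ' s| ≤ K / r := fun s => by
    rw [abs_mul, abs_of_pos (by positivity : 0 < 1 / r), mul_one_div]
    exact div_le_div_of_nonneg_right (hK _) hr.le
  have hκ1 : ∀ s, |κ s| ≤ 1 := fun s => by
    rw [abs_of_nonneg (cutoff_nonneg _)]
    exact cutoff_le_one _
  have hκr : ∀ s, |s| ≤ r → κ s = 1 := fun s hs => cutoff_eq_one (by
    rwa [abs_div, abs_of_pos hr, div_le_one hr])
  have hκ0 : ∀ s, 2 * r ≤ |s| → κ s = 0 := fun s hs => cutoff_eq_zero (by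
    rwa [abs_div, abs_of_pos hr, le_div_iff₀ hr])
  have hκt : κ.HasTemperateGrowth := hasTemperateGrowth_scale hasTemperateGrowth_cutoff r
  have hC₀ : ∀ k, k ≠ 0 → k ^ 2 + (K / r) ^ 2 ≤ (1 + (K / r) ^ 2) * bracket k ^ 2 := by
    intro k _
    rw [bracket_sq]
    nlinarith [mul_nonneg (sq_nonneg (K / r)) (sq_nonneg k)]
  obtain ⟨C₁, hC₁, H₁⟩ := exists_layer_lift hA hL hκt hκ' hκ1 hκK hr hκr isScale_bracket hC₀
  obtain ⟨C₂, hC₂, H₂⟩ := exists_layer_lift hB hL' hκt hκ' hκ1 hκK hr hκr isScale_bracket hC₀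
  -- The strip |y| < M contains the fluid and the neighbourhoods of width ε ≤ 1 of both graphs.
  set M : ℝ := A + B + 2
  refine ⟨3 * (2 * M + C₁ + 2 * C₂), by positivity, fun φ χ σ hφ hχ hσ hsum => ?_⟩
  obtain ⟨u, hu⟩ := exists_flat_lift hφ.low (M := M) (by positivity)
  obtain ⟨v, εv, hεv, hv1, hv0, hve⟩ := H₁ _ hφ.high
  obtain ⟨w, εw, hεw, hw1, hw0, hwe⟩ := H₂ _ (hφ.high.add hχ)
  set ε := min (min εv εw) (min r 1)
  have hε : 0 < ε := lt_min (lt_min hεv hεw) (lt_min hr one_pos)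
  have hεv' : ε ≤ εv := (min_le_left _ _).trans (min_le_left _ _)
  have hεw' : ε ≤ εw := (min_le_left _ _).trans (min_le_right _ _)
  have hεr : ε ≤ r := (min_le_right _ _).trans (min_le_left _ _)
  have hε1 : ε ≤ 1 := (min_le_right _ _).trans (min_le_right _ _)
  have hr4 : h₀ = 4 * r := by simp only [r]; ring
  refine ⟨u + v + w, ε, hε, fun x y h => ?_, fun x y h => ?_, ?_⟩
  · have hy : |y| ≤ M := by
      have h1 := abs_add_le (y - η.1 x) (η.1 x)
      rw [sub_add_cancel] at h1
      linarith [hA x]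
    have hw : w (x, y) = 0 := by
      refine hw0 x y fun s hs => hκ0 s ?_
      have h1 := abs_le.1 h
      have h2 := abs_le.1 hs
      have h3 := hdep x
      exact (by linarith : 2 * r ≤ -s).trans (neg_le_abs s)
    show u (x, y) + v (x, y) + w (x, y) = _
    rw [hu x y hy, hv1 x y (h.trans hεv'), hw, add_zero]
    refine (hφ.low.phys_add hφ.high hφ (fun k => ?_) x).symm
    push_cast
    ring
  · have hy : |y| ≤ M := by
      have h1 := abs_add_le (y - (1 + η.2 x)) (1 + η.2 x)
      rw [sub_add_cancel] at h1
      linarith [hB x]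
    have hv : v (x, y) = 0 := by
      refine hv0 x y fun s hs => hκ0 s ?_
      have h1 := abs_le.1 h
      have h2 := abs_le.1 hs
      have h3 := hdep x
      exact (by linarith : 2 * r ≤ s).trans (le_abs_self s)
    show u (x, y) + v (x, y) + w (x, y) = _
    rw [hu x y hy, hv, hw1 x y (h.trans hεw'), add_zero]
    refine (hφ.low.phys_add (hφ.high.add hχ) hσ (fun k => ?_) x).symm
    rw [hsum]
    push_cast
    ring
  · set Ω := upperDomain η
    have hΩ : MeasurableSet Ω := (isOpen_upperDomain hc1 hc2).measurableSet
    set P := hφ.low.deriv.phys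
    set D : ℝ × ℝ → ℝ := fun p => P p.1 ^ 2 * (Set.Icc (-M) M).indicator (fun _ => 1) p.2
    have hDi : Integrable D := by
      refine Integrable.mul_prod (f := fun x => P x ^ 2) ?_
        ((integrable_indicator_iff measurableSet_Icc).2 (integrableOn_const (by simp)))
      simpa using integrable_norm_sq (μ := (volume : Measure ℝ)) P
    have hD : ∫ p, D p = (∫ x, P x ^ 2) * (2 * M) := by
      refine (integral_prod_mul (μ := (volume : Measure ℝ)) (ν := (volume : Measure ℝ))
        (fun x => P x ^ 2) ((Set.Icc (-M) M).indicator (fun _ => (1 : ℝ)))).trans ?_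
      rw [integral_indicator measurableSet_Icc]
      simp [Measure.real]
      rw [ENNReal.toReal_ofReal (by positivity)]
      ring_nf
      simp
    -- Inside the fluid u depends on x only; only here does the finite depth enter, as the factor
    -- 2M.
    have hub : ∫ p in Ω, gradSq u p ≤ (∫ x, P x ^ 2) * (2 * M) := by
      rw [← hD, ← integral_indicator hΩ]
      refine integral_mono ((integrable_gradSq u).indicator hΩ) hDi fun p => ?_
      by_cases hp : p ∈ Ω
      · rw [Set.indicator_of_mem hp]
        obtain ⟨x, y⟩ := p
        have h1 := abs_le.1 (hA x)
        have h2 := abs_le.1 (hB x)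
        have h3 : |y| < M := abs_lt.2 ⟨by linarith [hp.1], by linarith [hp.2]⟩
        have h4 := fderiv_of_eq_fst (ψ := u) (hφ.low.hasDerivAt_phys x) (y := y) (by
          have h5 : IsOpen {p : ℝ × ℝ | |p.2| < M} := isOpen_lt (by fun_prop) continuous_const
          filter_upwards [h5.mem_nhds h3] with q hq
          exact hu q.1 q.2 hq.le)
        have h6 : D (x, y) = P x ^ 2 := by
          simp only [D]
          rw [Set.indicator_of_mem (show y ∈ Set.Icc (-M) M from abs_le.1 h3.le), mul_one]
        rw [h6, gradSq, h4.1, h4.2]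
        simp [P]
      · rw [Set.indicator_of_notMem hp]
        exact mul_nonneg (sq_nonneg _) (Set.indicator_nonneg (fun _ _ => zero_le_one) _)
    have iu := (integrable_gradSq u).integrableOn (s := Ω)
    have iv := (integrable_gradSq v).integrableOn (s := Ω)
    have iw := (integrable_gradSq w).integrableOn (s := Ω)
    have h1 : ∫ p in Ω, gradSq (u + v + w : 𝓢(ℝ × ℝ, ℝ)) p ≤
        3 * ((∫ p in Ω, gradSq u p) + (∫ p in Ω, gradSq v p) + ∫ p in Ω, gradSq w p) := by
      rw [← integral_add iu iv, ← integral_add' (f := fun p => gradSq u p + gradSq v p) (iu.add iv) iw, ← integral_const_mul]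
      exact integral_mono (integrable_gradSq _).integrableOn (((iu.add iv).add iw).const_mul 3)
        fun p => gradSq_add_le u.differentiableAt v.differentiableAt w.differentiableAt
    have h2 : ∫ p in Ω, gradSq v p ≤ ∫ p, gradSq v p :=
      setIntegral_le_integral (integrable_gradSq v) (Eventually.of_forall (gradSq_nonneg v))
    have h3 : ∫ p in Ω, gradSq w p ≤ ∫ p, gradSq w p :=
      setIntegral_le_integral (integrable_gradSq w) (Eventually.of_forall (gradSq_nonneg w))
    have h4 := integral_low_le hφ
    have h5 := mul_le_mul_of_nonneg_left (integral_high_le hφ) hC₁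
    have h6 := mul_le_mul_of_nonneg_left (integral_high_add_le hφ hχ) hC₂
    have h7 : 0 ≤ ∫ k, bracket k * ‖χ k‖ ^ 2 :=
      integral_nonneg fun k => mul_nonneg (bracket_pos k).le (sq_nonneg _)
    have h8 := mul_le_mul_of_nonneg_right h4 (by positivity : 0 ≤ 2 * M)
    set X1 := ∫ k, (bracket k)⁻¹ * k ^ 2 * ‖φ k‖ ^ 2
    set X2 := ∫ k, bracket k * ‖χ k‖ ^ 2
    have h9 : 0 ≤ (2 * M + C₁) * X2 := by positivity
    nlinarith [h1, h2, h3, h5, h6, h8, hub, hve, hwe]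

end TwoLayer
end

/-! ### Decay on a closed domain and the rotated Green identity. -/

noncomputable section

namespace TwoLayer

open scoped ComplexConjugate ContDiff SchwartzMap FourierTransform LineDeriv

/-! ### The Schwartz class of a closed domain -/

section SchwartzOn

variable {Ω : Set (ℝ × ℝ)} {u : ℝ × ℝ → ℝ}

theorem isSchwartzOn_schwartz (ψ : 𝓢(ℝ × ℝ, ℝ)) (Ω : Set (ℝ × ℝ)) : IsSchwartzOn Ω ψ :=
  ⟨ψ.smooth _, fun m n => by
    obtain ⟨C, -, hC⟩ := ψ.decay m n
    exact ⟨C, fun p _ => hC p⟩⟩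

theorem IsSchwartzOn.add {v : ℝ × ℝ → ℝ} (hu : IsSchwartzOn Ω u) (hv : IsSchwartzOn Ω v) :
    IsSchwartzOn Ω (u + v) := by
  refine ⟨hu.1.add hv.1, fun m n => ?_⟩
  obtain ⟨C, hC⟩ := hu.2 m n
  obtain ⟨D, hD⟩ := hv.2 m n
  refine ⟨C + D, fun p hp => ?_⟩
  rw [iteratedFDeriv_add (hu.1.of_le (by exact_mod_cast le_top))
    (hv.1.of_le (by exact_mod_cast le_top)), Pi.add_apply]
  have h1 := hC p hp
  have h2 := hD p hp
  have h3 := mul_le_mul_of_nonneg_left (norm_add_le (iteratedFDeriv ℝ n u p)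
    (iteratedFDeriv ℝ n v p)) (pow_nonneg (norm_nonneg p) m)
  linarith

theorem IsSchwartzOn.const_smul (hu : IsSchwartzOn Ω u) (c : ℝ) : IsSchwartzOn Ω (c • u) := by
  refine ⟨contDiff_const.smul hu.1, fun m n => ?_⟩
  obtain ⟨C, hC⟩ := hu.2 m n
  refine ⟨|c| * C, fun p hp => ?_⟩
  rw [iteratedFDeriv_const_smul_apply (hu.1.contDiffAt.of_le (by exact_mod_cast le_top)), norm_smul,
    Real.norm_eq_abs, mul_left_comm]
  exact mul_le_mul_of_nonneg_left (hC p hp) (abs_nonneg c)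

theorem IsSchwartzOn.differentiable (hu : IsSchwartzOn Ω u) : Differentiable ℝ u :=
  hu.1.differentiable (by simp)

theorem IsSchwartzOn.continuous_fderiv_apply (hu : IsSchwartzOn Ω u) (e : ℝ × ℝ) :
    Continuous fun p => fderiv ℝ u p e :=
  (hu.1.continuous_fderiv (by simp)).clm_apply continuous_const

/-- An integrable function of two variables. -/
def decayKernel (p : ℝ × ℝ) : ℝ := (1 + p.1 ^ 2)⁻¹ * (1 + p.2 ^ 2)⁻¹

theorem integrable_decayKernel : Integrable decayKernel :=
  integrable_inv_one_add_sq.mul_prod integrable_inv_one_add_sq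

theorem decayKernel_nonneg (p : ℝ × ℝ) : 0 ≤ decayKernel p := by
  unfold decayKernel
  positivity

theorem decayKernel_le_one (p : ℝ × ℝ) : decayKernel p ≤ 1 := by
  have h : ∀ x : ℝ, (1 + x ^ 2)⁻¹ ≤ 1 := fun x => inv_le_one_of_one_le₀ (by nlinarith)
  exact mul_le_one₀ (h _) (by positivity) (h _)

theorem IsSchwartzOn.exists_bound (hu : IsSchwartzOn Ω u) (n : ℕ) :
    ∃ C, 0 ≤ C ∧ ∀ p ∈ closure Ω, ‖iteratedFDeriv ℝ n u p‖ ≤ C * decayKernel p := by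
  obtain ⟨C0, h0⟩ := hu.2 0 n
  obtain ⟨C2, h2⟩ := hu.2 2 n
  obtain ⟨C4, h4⟩ := hu.2 4 n
  refine ⟨|C0| + 2 * |C2| + |C4|, by positivity, fun p hp => ?_⟩
  have k0 := (h0 p hp).trans (le_abs_self _)
  have k2 := (h2 p hp).trans (le_abs_self _)
  have k4 := (h4 p hp).trans (le_abs_self _)
  set N := ‖iteratedFDeriv ℝ n u p‖
  have hN : 0 ≤ N := norm_nonneg _
  have e1 : p.1 ^ 2 ≤ ‖p‖ ^ 2 := sq_le_sq' (by linarith [neg_abs_le p.1, norm_fst_le p, Real.norm_eq_abs p.1])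
    ((le_abs_self _).trans (norm_fst_le p))
  have e2 : p.2 ^ 2 ≤ ‖p‖ ^ 2 := sq_le_sq' (by linarith [neg_abs_le p.2, norm_snd_le p, Real.norm_eq_abs p.2])
    ((le_abs_self _).trans (norm_snd_le p))
  -- This bound in the max norm explains the use of the seminorms with m = 0, 2, 4.
  have h5 : (1 + p.1 ^ 2) * (1 + p.2 ^ 2) ≤ 1 + 2 * ‖p‖ ^ 2 + ‖p‖ ^ 4 := by
    nlinarith [mul_le_mul e1 e2 (sq_nonneg _) (sq_nonneg ‖p‖)]
  rw [decayKernel, ← mul_inv, ← div_eq_mul_inv, le_div_iff₀ (by positivity)]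
  have h6 := mul_le_mul_of_nonneg_left h5 hN
  nlinarith

theorem IsSchwartzOn.exists_bound_fderiv (hu : IsSchwartzOn Ω u) :
    ∃ C, 0 ≤ C ∧ ∀ p ∈ closure Ω, |u p| ≤ C * decayKernel p ∧
      |fderiv ℝ u p (1, 0)| ≤ C * decayKernel p ∧ |fderiv ℝ u p (0, 1)| ≤ C * decayKernel p := by
  obtain ⟨C, hC0, hC⟩ := hu.exists_bound 0
  obtain ⟨D, hD0, hD⟩ := hu.exists_bound 1
  refine ⟨max C D, le_max_of_le_left hC0, fun p hp => ?_⟩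
  have k1 := hC p hp
  have k2 := hD p hp
  rw [norm_iteratedFDeriv_zero] at k1
  rw [norm_iteratedFDeriv_one] at k2
  have hk := decayKernel_nonneg p
  have hD' := k2.trans (mul_le_mul_of_nonneg_right (le_max_right C D) hk)
  have he : ∀ e : ℝ × ℝ, ‖e‖ = 1 → |fderiv ℝ u p e| ≤ max C D * decayKernel p := fun e h => by
    have := (fderiv ℝ u p).le_opNorm e
    rw [h, mul_one] at this
    exact this.trans hD'
  exact ⟨k1.trans (mul_le_mul_of_nonneg_right (le_max_left C D) hk), he _ (by simp [Prod.norm_def]),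
    he _ (by simp [Prod.norm_def])⟩

theorem IsSchwartzOn.integrableOn_gradSq (hu : IsSchwartzOn Ω u) (hΩ : MeasurableSet Ω) :
    IntegrableOn (gradSq u) Ω := by
  obtain ⟨C, hC0, hC⟩ := hu.exists_bound_fderiv
  have hc : Continuous (gradSq u) :=
    ((hu.continuous_fderiv_apply _).pow 2).add ((hu.continuous_fderiv_apply _).pow 2)
  refine ((integrable_decayKernel.const_mul (2 * C ^ 2)).integrableOn (s := Ω)).mono'
    hc.aestronglyMeasurable ?_
  filter_upwards [ae_restrict_mem hΩ] with p hp
  obtain ⟨-, h1, h2⟩ := hC p (subset_closure hp)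
  rw [Real.norm_of_nonneg (gradSq_nonneg u p)]
  have k0 := decayKernel_nonneg p
  have k1 := decayKernel_le_one p
  have g1 := pow_le_pow_left₀ (abs_nonneg _) h1 2
  have g2 := pow_le_pow_left₀ (abs_nonneg _) h2 2
  rw [sq_abs] at g1 g2
  rw [gradSq]
  have : (C * decayKernel p) ^ 2 ≤ C ^ 2 * decayKernel p := by
    rw [mul_pow]
    exact mul_le_mul_of_nonneg_left (by nlinarith) (sq_nonneg C)
  linarith

theorem IsSchwartzOn.integrable_trace (hu : IsSchwartzOn Ω u) {f : ℝ → ℝ} (hf : Continuous f)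
    (hcl : ∀ x, (x, f x) ∈ closure Ω) : Integrable fun x => u (x, f x) := by
  obtain ⟨C, hC0, hC⟩ := hu.exists_bound_fderiv
  refine (integrable_inv_one_add_sq.const_mul C).mono'
    (hu.1.continuous.comp (continuous_id.prodMk hf)).aestronglyMeasurable
    (Eventually.of_forall fun x => ?_)
  refine (hC _ (hcl x)).1.trans (mul_le_mul_of_nonneg_left ?_ hC0)
  refine mul_le_of_le_one_right (by positivity) (inv_le_one_of_one_le₀ ?_)
  nlinarith [sq_nonneg (f x)]

/-- Bounded functions times Schwartz functions are integrable. -/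
theorem integrable_indicator_mul {w : ℝ × ℝ → ℝ} (hw : Continuous w) {C : ℝ}
    (hC : ∀ p ∈ closure Ω, |w p| ≤ C * decayKernel p) (hC0 : 0 ≤ C) (hΩ : MeasurableSet Ω)
    (S : 𝓢(ℝ × ℝ, ℝ)) : Integrable (Ω.indicator fun p => w p * S p) := by
  rw [integrable_indicator_iff hΩ]
  refine ((S.integrable (μ := volume)).norm.const_mul C).integrableOn.mono'
    (hw.mul S.continuous).aestronglyMeasurable ?_
  filter_upwards [ae_restrict_mem hΩ] with p hp
  rw [norm_mul, Real.norm_eq_abs]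
  refine mul_le_mul_of_nonneg_right ((hC p (subset_closure hp)).trans ?_) (norm_nonneg _)
  exact mul_le_of_le_one_right hC0 (decayKernel_le_one p)

end SchwartzOn

/-! ### Green's identity -/

section Green

variable {Ω : Set (ℝ × ℝ)} {u : ℝ × ℝ → ℝ}

theorem hasDerivAt_comp_fst (hu : Differentiable ℝ u) (x y : ℝ) :
    HasDerivAt (fun t => u (t, y)) (fderiv ℝ u (x, y) (1, 0)) x :=
  (hu (x, y)).hasFDerivAt.comp_hasDerivAt (f := fun t : ℝ => (t, y)) x
    ((hasDerivAt_id x).prodMk (hasDerivAt_const x y))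

theorem hasDerivAt_comp_snd (hu : Differentiable ℝ u) (x y : ℝ) :
    HasDerivAt (fun t => u (x, t)) (fderiv ℝ u (x, y) (0, 1)) y :=
  (hu (x, y)).hasFDerivAt.comp_hasDerivAt (f := fun t : ℝ => (x, t)) y
    ((hasDerivAt_const y x).prodMk (hasDerivAt_id y))

/-- The derivative of a Schwartz function in the first variable. -/
def dxS (ψ : 𝓢(ℝ × ℝ, ℝ)) : 𝓢(ℝ × ℝ, ℝ) := ∂_{((1 : ℝ), (0 : ℝ))} ψ

/-- The derivative of a Schwartz function in the second variable. -/
def dyS (ψ : 𝓢(ℝ × ℝ, ℝ)) : 𝓢(ℝ × ℝ, ℝ) := ∂_{((0 : ℝ), (1 : ℝ))} ψ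

theorem dxS_apply (ψ : 𝓢(ℝ × ℝ, ℝ)) (p : ℝ × ℝ) : dxS ψ p = fderiv ℝ ψ p (1, 0) := rfl

theorem dyS_apply (ψ : 𝓢(ℝ × ℝ, ℝ)) (p : ℝ × ℝ) : dyS ψ p = fderiv ℝ ψ p (0, 1) := rfl

theorem fderiv_dxS_dyS (ψ : 𝓢(ℝ × ℝ, ℝ)) (p : ℝ × ℝ) :
    fderiv ℝ (dxS ψ) p (0, 1) = fderiv ℝ (dyS ψ) p (1, 0) := by
  have h1 : ∀ e e' : ℝ × ℝ, fderiv ℝ (fun q => fderiv ℝ ψ q e) p e' =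
      fderiv ℝ (fderiv ℝ ψ) p e' e := by
    intro e e'
    have h3 : DifferentiableAt ℝ (fderiv ℝ ψ) p :=
      ((ψ.smooth 2).fderiv_right (m := 1) (by norm_num)).differentiable (by simp) p
    have h4 := (h3.hasFDerivAt.clm_apply (hasFDerivAt_const e p)).fderiv
    rw [h4]
    simp
  refine (h1 (1, 0) (0, 1)).trans (Eq.trans ?_ (h1 (0, 1) (1, 0)).symm)
  exact (ψ.smooth 2).contDiffAt.isSymmSndFDerivAt (by simp) (0, 1) (1, 0)

/-- The integral of an `x`-derivative of a function vanishing near the boundary. -/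
theorem integral_fderiv_fst_eq_zero (hu : IsSchwartzOn Ω u) (hΩ : IsOpen Ω) (S : 𝓢(ℝ × ℝ, ℝ))
    (hS : ∀ p ∉ Ω, ∀ᶠ q in 𝓝 p, q ∈ Ω → S q = 0) :
    Integrable (Ω.indicator fun p => fderiv ℝ u p (1, 0) * S p + u p * fderiv ℝ S p (1, 0)) ∧
    ∫ p, Ω.indicator (fun p => fderiv ℝ u p (1, 0) * S p + u p * fderiv ℝ S p (1, 0)) p = 0 := by
  obtain ⟨C, hC0, hC⟩ := hu.exists_bound_fderiv
  have i0 := integrable_indicator_mul hu.1.continuous (fun p hp => (hC p hp).1) hC0 hΩ.measurableSet S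
  have i1 := integrable_indicator_mul (hu.continuous_fderiv_apply (1, 0)) (fun p hp => (hC p hp).2.1)
    hC0 hΩ.measurableSet S
  have i2 := integrable_indicator_mul hu.1.continuous (fun p hp => (hC p hp).1) hC0 hΩ.measurableSet
    (dxS S)
  have i3 : Integrable
      (Ω.indicator fun p => fderiv ℝ u p (1, 0) * S p + u p * fderiv ℝ S p (1, 0)) := by
    have h1 := i1.add i2
    rwa [← Set.indicator_add'] at h1
  refine ⟨i3, ?_⟩
  have h1 := integral_prod_symm (μ := (volume : Measure ℝ)) (ν := (volume : Measure ℝ)) _ i3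
  refine h1.trans (integral_eq_zero_of_ae ?_)
  filter_upwards [i0.prod_left_ae, i3.prod_left_ae] with y hy0 hy3
  -- On each horizontal line the extension of uS by zero is differentiable, since S vanishes in Ω
  -- near boundary points; so its derivative integrates to 0.
  refine integral_eq_zero_of_hasDerivAt_of_integrable
    (f := fun x => Ω.indicator (fun p => u p * S p) (x, y)) (fun x => ?_) hy3 hy0
  have hcont : Tendsto (fun t : ℝ => (t, y)) (𝓝 x) (𝓝 (x, y)) :=
    Continuous.tendsto (by fun_prop) x
  by_cases hp : (x, y) ∈ Ω
  · rw [Set.indicator_of_mem hp]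
    have h2 := (hasDerivAt_comp_fst hu.differentiable x y).mul (hasDerivAt_schwartz_fst S x y)
    refine h2.congr_of_eventuallyEq ?_
    filter_upwards [hcont.eventually (hΩ.mem_nhds hp)] with t ht
    rw [Set.indicator_of_mem ht]
    rfl
  · rw [Set.indicator_of_notMem hp]
    refine (hasDerivAt_const x (0 : ℝ)).congr_of_eventuallyEq ?_
    filter_upwards [hcont.eventually (hS _ hp)] with t ht
    by_cases hm : (t, y) ∈ Ω
    · rw [Set.indicator_of_mem hm, ht hm, mul_zero]
    · rw [Set.indicator_of_notMem hm]

/-- Integration by parts for `u_x ψ_y - u_y ψ_x`, if `ψ_y = 0` near the boundary. -/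
theorem integral_rot (hu : IsSchwartzOn Ω u) (hΩ : IsOpen Ω) (ψ : 𝓢(ℝ × ℝ, ℝ))
    (hψ : ∀ p ∉ Ω, ∀ᶠ q in 𝓝 p, q ∈ Ω → fderiv ℝ ψ q (0, 1) = 0) {bd : ℝ → ℝ}
    (hbd : ∀ x, Integrable (fun y => Ω.indicator
        (fun p => u p * (dxS ψ) p) (x, y)) →
      Integrable (fun y => Ω.indicator (fun p => fderiv ℝ u p (0, 1) * (dxS ψ) p +
        u p * fderiv ℝ (dxS ψ) p (0, 1)) (x, y)) →
      ∫ y, Ω.indicator (fun p => fderiv ℝ u p (0, 1) * (dxS ψ) p +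
        u p * fderiv ℝ (dxS ψ) p (0, 1)) (x, y) = bd x) :
    ∫ p in Ω, (fderiv ℝ u p (1, 0) * fderiv ℝ ψ p (0, 1) -
      fderiv ℝ u p (0, 1) * fderiv ℝ ψ p (1, 0)) = -∫ x, bd x := by
  set S1 := dxS ψ with hS1
  set S2 := dyS ψ with hS2
  obtain ⟨C, hC0, hC⟩ := hu.exists_bound_fderiv
  obtain ⟨iA, hA⟩ := integral_fderiv_fst_eq_zero hu hΩ S2 hψ
  have i0 := integrable_indicator_mul hu.1.continuous (fun p hp => (hC p hp).1) hC0 hΩ.measurableSet S1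
  have i1 := integrable_indicator_mul (hu.continuous_fderiv_apply (0, 1)) (fun p hp => (hC p hp).2.2)
    hC0 hΩ.measurableSet S1
  have i2 := integrable_indicator_mul hu.1.continuous (fun p hp => (hC p hp).1) hC0 hΩ.measurableSet
    (dyS S1)
  have iB : Integrable
      (Ω.indicator fun p => fderiv ℝ u p (0, 1) * S1 p + u p * fderiv ℝ S1 p (0, 1)) := by
    have h1 := i1.add i2
    rwa [← Set.indicator_add'] at h1
  have hB : ∫ p, Ω.indicator (fun p => fderiv ℝ u p (0, 1) * S1 p + u p * fderiv ℝ S1 p (0, 1)) p =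
      ∫ x, bd x := by
    refine (integral_prod (μ := (volume : Measure ℝ)) (ν := (volume : Measure ℝ)) _ iB).trans
      (integral_congr_ae ?_)
    filter_upwards [i0.prod_right_ae, iB.prod_right_ae] with x h0 h1
    exact hbd x h0 h1
  -- u_xψ_y - u_yψ_x = (uψ_y)_x - (uψ_x)_y by symmetry of second derivatives. The first term
  -- integrates to 0 along horizontals, the second to the boundary values along verticals.
  have hAB := integral_sub iA iB
  rw [hA, hB, zero_sub] at hAB
  rw [← hAB, ← integral_indicator hΩ.measurableSet]
  congr 1
  ext p
  by_cases hp : p ∈ Ω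
  · simp only [Set.indicator_of_mem hp]
    rw [hS1, fderiv_dxS_dyS, hS2, dxS_apply, dyS_apply]
    ring
  · simp only [Set.indicator_of_notMem hp, sub_zero]

/-- Cauchy–Schwarz for ∇u and the rotated gradient of ψ, which has the same length as ∇ψ; proved
through the discriminant of a nonnegative quadratic in t. -/
theorem sq_integral_rot_le (hu : IsSchwartzOn Ω u) (hΩ : MeasurableSet Ω) (ψ : 𝓢(ℝ × ℝ, ℝ)) :
    (∫ p in Ω, (fderiv ℝ u p (1, 0) * fderiv ℝ ψ p (0, 1) -
      fderiv ℝ u p (0, 1) * fderiv ℝ ψ p (1, 0))) ^ 2 ≤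
    (∫ p in Ω, gradSq u p) * ∫ p in Ω, gradSq ψ p := by
  set R := fun p => fderiv ℝ u p (1, 0) * fderiv ℝ ψ p (0, 1) -
      fderiv ℝ u p (0, 1) * fderiv ℝ ψ p (1, 0)
  have iu := hu.integrableOn_gradSq hΩ
  have iψ := (integrable_gradSq ψ).integrableOn (s := Ω)
  have hψs := isSchwartzOn_schwartz ψ Ω
  have hRc : Continuous R := ((hu.continuous_fderiv_apply _).mul (hψs.continuous_fderiv_apply _)).sub
    ((hu.continuous_fderiv_apply _).mul (hψs.continuous_fderiv_apply _))
  have hR : ∀ t p, 2 * t * R p ≤ gradSq u p + t ^ 2 * gradSq ψ p := fun t p => by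
    simp only [R, gradSq]
    nlinarith [sq_nonneg (fderiv ℝ u p (1, 0) - t * fderiv ℝ ψ p (0, 1)),
      sq_nonneg (fderiv ℝ u p (0, 1) + t * fderiv ℝ ψ p (1, 0))]
  have iR : IntegrableOn R Ω := by
    refine (iu.add iψ).mono' hRc.aestronglyMeasurable (Eventually.of_forall fun p => ?_)
    have h1 := hR 1 p
    have h2 := hR (-1) p
    have h3 := gradSq_nonneg u p
    have h4 := gradSq_nonneg ψ p
    rw [Real.norm_eq_abs, Pi.add_apply]
    exact abs_le.2 ⟨by linarith, by linarith⟩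
  have key : ∀ t : ℝ, 2 * t * ∫ p in Ω, R p ≤
      (∫ p in Ω, gradSq u p) + t ^ 2 * ∫ p in Ω, gradSq ψ p := by
    intro t
    rw [← integral_const_mul, ← integral_const_mul, ← integral_add iu (iψ.const_mul _)]
    exact integral_mono (iR.const_mul _) (iu.add (iψ.const_mul _)) (hR t)
  have h5 := discrim_le_zero (a := ∫ p in Ω, gradSq ψ p) (b := -(2 * ∫ p in Ω, R p))
    (c := ∫ p in Ω, gradSq u p) fun t => by nlinarith [key t]
  rw [discrim] at h5
  nlinarith

end Green

end TwoLayer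
end

/-! ### Trace estimates by duality. -/

noncomputable section

namespace TwoLayer

open scoped ComplexConjugate ContDiff SchwartzMap FourierTransform LineDeriv

/-! ### Boundary pairings -/

theorem mem_closure_lowerDomain (f : ℝ → ℝ) (x : ℝ) : (x, f x) ∈ closure (lowerDomain f) := by
  have h1 : Tendsto (fun s : ℝ => (x, f x - s)) (𝓝[>] 0) (𝓝 (x, f x)) := by
    have : Tendsto (fun s : ℝ => (x, f x - s)) (𝓝 0) (𝓝 (x, f x - 0)) :=
      Continuous.tendsto (by fun_prop) 0
    rw [sub_zero] at this
    exact this.mono_left nhdsWithin_le_nhds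
  refine mem_closure_of_tendsto h1 ?_
  filter_upwards [self_mem_nhdsWithin] with s hs
  show f x - s < f x
  linarith [Set.mem_Ioi.1 hs]

section UpperClosure

variable {η : (ℝ → ℝ) × (ℝ → ℝ)} {x : ℝ}

theorem mem_closure_upperDomain_fst (h : η.1 x < 1 + η.2 x) :
    (x, η.1 x) ∈ closure (upperDomain η) := by
  have h1 : Tendsto (fun s : ℝ => (x, η.1 x + s)) (𝓝[>] 0) (𝓝 (x, η.1 x)) := by
    have : Tendsto (fun s : ℝ => (x, η.1 x + s)) (𝓝 0) (𝓝 (x, η.1 x + 0)) :=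
      Continuous.tendsto (by fun_prop) 0
    rw [add_zero] at this
    exact this.mono_left nhdsWithin_le_nhds
  refine mem_closure_of_tendsto h1 ?_
  filter_upwards [Ioo_mem_nhdsGT (sub_pos.2 h)] with s hs
  exact ⟨show η.1 x < η.1 x + s by linarith [hs.1], show η.1 x + s < 1 + η.2 x by linarith [hs.2]⟩

theorem mem_closure_upperDomain_snd (h : η.1 x < 1 + η.2 x) :
    (x, 1 + η.2 x) ∈ closure (upperDomain η) := by
  have h1 : Tendsto (fun s : ℝ => (x, 1 + η.2 x - s)) (𝓝[>] 0) (𝓝 (x, 1 + η.2 x)) := by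
    have : Tendsto (fun s : ℝ => (x, 1 + η.2 x - s)) (𝓝 0) (𝓝 (x, 1 + η.2 x - 0)) :=
      Continuous.tendsto (by fun_prop) 0
    rw [sub_zero] at this
    exact this.mono_left nhdsWithin_le_nhds
  refine mem_closure_of_tendsto h1 ?_
  filter_upwards [Ioo_mem_nhdsGT (sub_pos.2 h)] with s hs
  exact ⟨show η.1 x < 1 + η.2 x - s by linarith [hs.2], show 1 + η.2 x - s < 1 + η.2 x by linarith [hs.1]⟩

end UpperClosure

/-- Because the lift is independent of y near the graph, its boundary derivative is that of the
datum and the Lipschitz function f is never differentiated. -/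
theorem fderiv_near_graph {f : ℝ → ℝ} (hf : Continuous f) {χ : ℝ → ℂ} (hχ : IsTest χ)
    {ψ : 𝓢(ℝ × ℝ, ℝ)} {ε : ℝ} (hψ : ∀ x y, |y - f x| ≤ ε → ψ (x, y) = hχ.phys x) {x y : ℝ}
    (hy : |y - f x| < ε) :
    fderiv ℝ ψ (x, y) (1, 0) = hχ.deriv.phys x ∧ fderiv ℝ ψ (x, y) (0, 1) = 0 := by
  refine fderiv_of_eq_fst (hχ.hasDerivAt_phys x) ?_
  have h1 : IsOpen {p : ℝ × ℝ | |p.2 - f p.1| < ε} := isOpen_lt (by fun_prop) continuous_const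
  filter_upwards [h1.mem_nhds hy] with q hq
  exact hψ q.1 q.2 hq.le

theorem lower_green {f : ℝ → ℝ} (hf : Continuous f) {u : ℝ × ℝ → ℝ}
    (hu : IsSchwartzOn (lowerDomain f) u) {χ : ℝ → ℂ} (hχ : IsTest χ) {ψ : 𝓢(ℝ × ℝ, ℝ)} {ε : ℝ}
    (hε : 0 < ε) (hψ : ∀ x y, |y - f x| ≤ ε → ψ (x, y) = hχ.phys x) :
    ∫ p in lowerDomain f, (fderiv ℝ u p (1, 0) * fderiv ℝ ψ p (0, 1) -
      fderiv ℝ u p (0, 1) * fderiv ℝ ψ p (1, 0)) = -∫ x, u (x, f x) * hχ.deriv.phys x := by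
  refine integral_rot hu (isOpen_lowerDomain hf) ψ (fun p hp => ?_) fun x h0 h1 => ?_
  · have h1 : IsOpen {q : ℝ × ℝ | f q.1 - ε < q.2} := isOpen_lt (by fun_prop) continuous_snd
    have h2 : f p.1 ≤ p.2 := not_lt.1 hp
    filter_upwards [h1.mem_nhds (show f p.1 - ε < p.2 by linarith)] with q hq hqΩ
    have h3 : f q.1 - ε < q.2 := hq
    have h4 : q.2 < f q.1 := hqΩ
    exact (fderiv_near_graph hf hχ hψ (x := q.1) (y := q.2)
      (abs_lt.2 ⟨by linarith, by linarith⟩)).2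
  · have hs : ∀ (F : ℝ × ℝ → ℝ), (fun y => (lowerDomain f).indicator F (x, y)) =
        (Set.Iio (f x)).indicator fun y => F (x, y) := fun F => by
      ext y
      by_cases hy : y < f x
      · rw [Set.indicator_of_mem (show y ∈ Set.Iio (f x) from hy), Set.indicator_of_mem (show (x, y) ∈ lowerDomain f from hy)]
      · rw [Set.indicator_of_notMem (show y ∉ Set.Iio (f x) from hy),
          Set.indicator_of_notMem (show (x, y) ∉ lowerDomain f from hy)]
    rw [hs, integrable_indicator_iff measurableSet_Iio, ← integrableOn_Iic_iff_integrableOn_Iio] at h0 h1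
    rw [hs, integral_indicator measurableSet_Iio, ← integral_Iic_eq_integral_Iio]
    have hd : ∀ y, HasDerivAt (fun y => u (x, y) * dxS ψ (x, y))
        (fderiv ℝ u (x, y) (0, 1) * dxS ψ (x, y) + u (x, y) * fderiv ℝ (dxS ψ) (x, y) (0, 1)) y :=
      fun y => (hasDerivAt_comp_snd hu.differentiable x y).mul (hasDerivAt_schwartz_snd _ x y)
    have h2 := integral_Iic_of_hasDerivAt_of_tendsto' (fun y _ => hd y) h1
      (tendsto_zero_of_hasDerivAt_of_integrableOn_Iic (fun y _ => hd y) h1 h0)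
    rw [h2, sub_zero, dxS_apply, (fderiv_near_graph hf hχ hψ (by simpa using hε)).1]

theorem upper_green {η : (ℝ → ℝ) × (ℝ → ℝ)} (h1c : Continuous η.1) (h2c : Continuous η.2)
    (hlt : ∀ x, η.1 x < 1 + η.2 x) {u : ℝ × ℝ → ℝ}
    (hu : IsSchwartzOn (upperDomain η) u) {φ χ : ℝ → ℂ} (hφ : IsTest φ) (hχ : IsTest χ)
    {ψ : 𝓢(ℝ × ℝ, ℝ)} {ε : ℝ} (hε : 0 < ε)
    (hψ₁ : ∀ x y, |y - η.1 x| ≤ ε → ψ (x, y) = hφ.phys x)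
    (hψ₂ : ∀ x y, |y - (1 + η.2 x)| ≤ ε → ψ (x, y) = hχ.phys x) :
    ∫ p in upperDomain η, (fderiv ℝ u p (1, 0) * fderiv ℝ ψ p (0, 1) -
      fderiv ℝ u p (0, 1) * fderiv ℝ ψ p (1, 0)) =
      -∫ x, (u (x, 1 + η.2 x) * hχ.deriv.phys x - u (x, η.1 x) * hφ.deriv.phys x) := by
  have h2c' : Continuous fun x => 1 + η.2 x := continuous_const.add h2c
  refine integral_rot hu (isOpen_upperDomain h1c h2c) ψ (fun p hp => ?_) fun x h0 h1 => ?_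
  · by_cases hp1 : p.2 ≤ η.1 p.1
    · have h1 : IsOpen {q : ℝ × ℝ | q.2 < η.1 q.1 + ε} := isOpen_lt continuous_snd (by fun_prop)
      filter_upwards [h1.mem_nhds (show p.2 < η.1 p.1 + ε by linarith)] with q hq hqΩ
      have h3 : q.2 < η.1 q.1 + ε := hq
      have h4 : η.1 q.1 < q.2 := hqΩ.1
      exact (fderiv_near_graph h1c hφ hψ₁ (x := q.1) (y := q.2)
        (abs_lt.2 ⟨by linarith, by linarith⟩)).2
    · have h1 : IsOpen {q : ℝ × ℝ | 1 + η.2 q.1 - ε < q.2} := isOpen_lt (by fun_prop) continuous_snd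
      have h2 : 1 + η.2 p.1 ≤ p.2 := not_lt.1 fun h => hp ⟨not_le.1 hp1, h⟩
      filter_upwards [h1.mem_nhds (show 1 + η.2 p.1 - ε < p.2 by linarith)] with q hq hqΩ
      have h3 : 1 + η.2 q.1 - ε < q.2 := hq
      have h4 : q.2 < 1 + η.2 q.1 := hqΩ.2
      exact (fderiv_near_graph h2c' hχ hψ₂ (x := q.1) (y := q.2)
        (abs_lt.2 ⟨by linarith, by linarith⟩)).2
  · have hs : ∀ (F : ℝ × ℝ → ℝ), (fun y => (upperDomain η).indicator F (x, y)) =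
        (Set.Ioo (η.1 x) (1 + η.2 x)).indicator fun y => F (x, y) := fun F => by
      ext y
      by_cases hy : y ∈ Set.Ioo (η.1 x) (1 + η.2 x)
      · rw [Set.indicator_of_mem hy, Set.indicator_of_mem (show (x, y) ∈ upperDomain η from hy)]
      · rw [Set.indicator_of_notMem hy,
          Set.indicator_of_notMem (show (x, y) ∉ upperDomain η from hy)]
    rw [hs, integrable_indicator_iff measurableSet_Ioo, ← integrableOn_Ioc_iff_integrableOn_Ioo,
      ← intervalIntegrable_iff_integrableOn_Ioc_of_le (hlt x).le] at h1
    rw [hs, integral_indicator measurableSet_Ioo, ← integral_Ioc_eq_integral_Ioo,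
      ← intervalIntegral.integral_of_le (hlt x).le]
    have hd : ∀ y, HasDerivAt (fun y => u (x, y) * dxS ψ (x, y))
        (fderiv ℝ u (x, y) (0, 1) * dxS ψ (x, y) + u (x, y) * fderiv ℝ (dxS ψ) (x, y) (0, 1)) y :=
      fun y => (hasDerivAt_comp_snd hu.differentiable x y).mul (hasDerivAt_schwartz_snd _ x y)
    rw [intervalIntegral.integral_eq_sub_of_hasDerivAt (fun y _ => hd y) h1, dxS_apply, dxS_apply,
      (fderiv_near_graph h1c hφ hψ₁ (x := x) (y := η.1 x) (by simpa using hε)).1,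
      (fderiv_near_graph h2c' hχ hψ₂ (x := x) (y := 1 + η.2 x) (by simpa using hε)).1]

/-- The boundary integral equals, up to sign, the rotated energy of u and a lift of χ, so the lift
estimate bounds it. -/
theorem lower_pairing_le {f : ℝ → ℝ} (hf : IsW1Inf f) : ∃ C, 0 ≤ C ∧
    ∀ (χ : ℝ → ℂ) (hχ : IsTest χ) (u : ℝ × ℝ → ℝ), IsSchwartzOn (lowerDomain f) u →
      (∫ x, u (x, f x) * hχ.deriv.phys x) ^ 2 ≤
        C * (∫ p in lowerDomain f, gradSq u p) * ∫ k, |k| * ‖χ k‖ ^ 2 := by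
  obtain ⟨C, hC, H⟩ := exists_lower_lift hf
  refine ⟨C, hC, fun χ hχ u hu => ?_⟩
  obtain ⟨ψ, ε, hε, h1, h2⟩ := H χ hχ
  have hm := (isOpen_lowerDomain hf.continuous).measurableSet
  have h3 := sq_integral_rot_le hu hm ψ
  rw [lower_green hf.continuous hu hχ hε h1, neg_sq] at h3
  have h4 : ∫ p in lowerDomain f, gradSq ψ p ≤ ∫ p, gradSq ψ p :=
    setIntegral_le_integral (integrable_gradSq ψ) (Eventually.of_forall (gradSq_nonneg ψ))
  have h5 : 0 ≤ ∫ p in lowerDomain f, gradSq u p := integral_nonneg (gradSq_nonneg u)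
  refine h3.trans ((mul_le_mul_of_nonneg_left (h4.trans h2) h5).trans (le_of_eq ?_))
  ring

theorem upper_pairing_le {h₀ : ℝ} (hh₀ : 0 < h₀) {η : (ℝ → ℝ) × (ℝ → ℝ)} (hη : η ∈ ClassW h₀) :
    ∃ C, 0 ≤ C ∧ ∀ (φ χ σ : ℝ → ℂ) (hφ : IsTest φ) (_ : IsTest χ) (hσ : IsTest σ),
      (∀ k, σ k = φ k + χ k) → ∀ u, IsSchwartzOn (upperDomain η) u →
      (∫ x, (u (x, 1 + η.2 x) * hσ.deriv.phys x - u (x, η.1 x) * hφ.deriv.phys x)) ^ 2 ≤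
        C * (∫ p in upperDomain η, gradSq u p) *
          ((∫ k, (bracket k)⁻¹ * k ^ 2 * ‖φ k‖ ^ 2) + ∫ k, bracket k * ‖χ k‖ ^ 2) := by
  obtain ⟨C, hC, H⟩ := exists_upper_lift hh₀ hη
  refine ⟨C, hC, fun φ χ σ hφ hχ hσ hsum u hu => ?_⟩
  obtain ⟨ψ, ε, hε, h1, h1', h2⟩ := H φ χ σ hφ hχ hσ hsum
  have hc1 := hη.1.continuous
  have hc2 := hη.2.1.continuous
  have h3 := sq_integral_rot_le hu (isOpen_upperDomain hc1 hc2).measurableSet ψ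
  rw [upper_green hc1 hc2 (fun x => by linarith [depth_lt hη x]) hu hφ hσ hε h1 h1', neg_sq] at h3
  have h5 : 0 ≤ ∫ p in upperDomain η, gradSq u p := integral_nonneg (gradSq_nonneg u)
  refine h3.trans ((mul_le_mul_of_nonneg_left h2 h5).trans (le_of_eq ?_))
  ring

/-! ### Trace estimates -/

theorem integrable_exp_mul {g : ℝ → ℝ} (hg : Integrable g) (k : ℝ) :
    Integrable fun x : ℝ => Complex.exp (-(Complex.I * k * x)) * (g x : ℂ) := by
  refine hg.ofReal.bdd_mul (c := 1) (Continuous.aestronglyMeasurable (by fun_prop))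
    (Eventually.of_forall fun x => ?_)
  rw [Complex.norm_exp]
  simp

/-- The antiderivative of a test function. -/
theorem IsTest.antideriv {φ : ℝ → ℂ} (hφ : IsTest φ) :
    IsTest fun k => (Complex.I * (k : ℂ))⁻¹ * φ k :=
  hφ.mul (g := fun k => (Complex.I * (k : ℂ))⁻¹)
    (fun k hk => (contDiffAt_const.mul Complex.ofRealCLM.contDiff.contDiffAt).inv (by simpa using hk))
    (fun k => by simp)

theorem IsTest.antideriv_deriv_phys {φ : ℝ → ℂ} (hφ : IsTest φ) (x : ℝ) :
    hφ.antideriv.deriv.phys x = hφ.phys x := by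
  rw [IsTest.phys_apply, IsTest.phys_apply]
  congr 2
  refine integral_congr_ae ?_
  filter_upwards [ae_ne_zero] with k hk
  have : (k : ℂ) ≠ 0 := by exact_mod_cast hk
  field_simp

theorem norm_antideriv_sq {φ : ℝ → ℂ} (k : ℝ) :
    ‖(Complex.I * (k : ℂ))⁻¹ * φ k‖ ^ 2 = (k ^ 2)⁻¹ * ‖φ k‖ ^ 2 := by
  simp [mul_pow]

theorem integral_antideriv {φ : ℝ → ℂ} {w v : ℝ → ℝ} (h : ∀ k, k ≠ 0 → w k * (k ^ 2)⁻¹ = v k) :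
    ∫ k, w k * ‖(Complex.I * (k : ℂ))⁻¹ * φ k‖ ^ 2 = ∫ k, v k * ‖φ k‖ ^ 2 := by
  refine integral_congr_ae ?_
  filter_upwards [ae_ne_zero] with k hk
  rw [norm_antideriv_sq, ← h k hk]
  ring

theorem dual_eq_integral {φ : ℝ → ℂ} (hφ : IsTest φ) {q t : FreqFun} (hq : ∀ᵐ k : ℝ, q k = φ k)
    {g : ℝ → ℝ} (hg : Integrable g) (ht : IsFourier t g) : dual q t = ∫ x, g x * hφ.phys x := by
  rw [hφ.integral_mul_phys hg, dual_comm, dual]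
  refine integral_congr_ae ?_
  filter_upwards [hq, ht] with k h1 h2
  rw [h1, h2]

theorem norm_sq_of_ae {w : Weight} {q : Sob w} {φ : ℝ → ℂ} (hq : ∀ᵐ k : ℝ, (q : FreqFun) k = φ k) :
    ∫ k, w k * ‖φ k‖ ^ 2 = ‖q‖ ^ 2 := by
  rw [Sob.norm_sq]
  refine integral_congr_ae ?_
  filter_upwards [hq] with k hk
  rw [hk]

theorem abs_le_of_sq_le_mul {a C D b : ℝ} (hC : 0 ≤ C) (hD : 0 ≤ D) (hb : 0 ≤ b)
    (h : a ^ 2 ≤ C * D * b ^ 2) : |a| ≤ √C * √D * b := by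
  refine abs_le_of_sq_le_sq ?_ (by positivity)
  rwa [mul_pow, mul_pow, Real.sq_sqrt hC, Real.sq_sqrt hD]

/-- Every test element of Ḣ^{-1/2} is the derivative of its antiderivative, whose Ḣ^{1/2} norm is
the same; the pairing estimate then bounds the trace by duality. -/
theorem lower_trace_le {f : ℝ → ℝ} (hf : IsW1Inf f) : ∃ C, 0 ≤ C ∧
    ∀ (u : ℝ × ℝ → ℝ) (t : DotHalf), IsSchwartzOn (lowerDomain f) u →
      IsFourier t (fun x => u (x, f x)) → ‖t‖ ≤ C * √(∫ p in lowerDomain f, gradSq u p) := by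
  obtain ⟨C, hC, H⟩ := lower_pairing_le hf
  refine ⟨√C, by positivity, fun u t hu ht => ?_⟩
  have hg := hu.integrable_trace hf.continuous (mem_closure_lowerDomain f)
  refine Sob.norm_le_of_dual dualWeights_dot regular_wDotNegHalf t (by positivity) ?_
  rintro q ⟨φ, hφ, hq⟩
  rw [dual_eq_integral hφ hq hg ht]
  have h1 := H _ hφ.antideriv u hu
  simp only [hφ.antideriv_deriv_phys] at h1
  rw [integral_antideriv (v := wDotNegHalf) (fun k hk => by
    show |k| * (k ^ 2)⁻¹ = |k|⁻¹
    rw [← sq_abs]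
    have := abs_ne_zero.2 hk
    field_simp), norm_sq_of_ae hq] at h1
  exact abs_le_of_sq_le_mul hC (integral_nonneg (gradSq_nonneg u)) (norm_nonneg _) h1

theorem IsTest.zero_deriv_phys (x : ℝ) : IsTest.zero.deriv.phys x = 0 := by
  rw [IsTest.phys_apply]
  simp

/-- Antiderivatives of H_⋆^{-1/2} lie in H^{1/2} and those of H^{-1/2} in H_⋆^{1/2}. The three parts
of the X-norm come from three choices of boundary data for the lift: Q on the interface only, on the
surface only, and on both. -/
theorem upper_trace_le {h₀ : ℝ} (hh₀ : 0 < h₀) {η : (ℝ → ℝ) × (ℝ → ℝ)} (hη : η ∈ ClassW h₀) :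
    ∃ C, 0 ≤ C ∧ ∀ (u : ℝ × ℝ → ℝ) (t : SpX), IsSchwartzOn (upperDomain η) u →
      IsFourier t.1.1 (fun x => u (x, η.1 x)) → IsFourier t.1.2 (fun x => u (x, 1 + η.2 x)) →
      ‖t‖ ≤ C * √(∫ p in upperDomain η, gradSq u p) := by
  obtain ⟨C, hC, H⟩ := upper_pairing_le hh₀ hη
  -- The squared bounds below are 2C, C and C times the energy; 5 covers their sum.
  refine ⟨√(5 * C), by positivity, fun u t hu ht1 ht2 => ?_⟩
  have hlt : ∀ x, η.1 x < 1 + η.2 x := fun x => by linarith [depth_lt hη x]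
  have hg1 := hu.integrable_trace hη.1.continuous fun x => mem_closure_upperDomain_fst (hlt x)
  have hg2 := hu.integrable_trace hη.2.1.one_add.continuous
    fun x => mem_closure_upperDomain_snd (hlt x)
  set D := ∫ p in upperDomain η, gradSq u p
  have hD : 0 ≤ D := integral_nonneg (gradSq_nonneg u)
  have H' : ∀ (φ χ σ : ℝ → ℂ) (hφ : IsTest φ) (_ : IsTest χ) (hσ : IsTest σ),
      (∀ k, σ k = φ k + χ k) → ∀ p s : ℝ → ℝ, (∀ x, hφ.deriv.phys x = p x) →
      (∀ x, hσ.deriv.phys x = s x) →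
      (∫ x, (u (x, 1 + η.2 x) * s x - u (x, η.1 x) * p x)) ^ 2 ≤
        C * D * ((∫ k, (bracket k)⁻¹ * k ^ 2 * ‖φ k‖ ^ 2) + ∫ k, bracket k * ‖χ k‖ ^ 2) := by
    intro φ χ σ hφ hχ hσ hsum p s hp hs
    have h1 := H φ χ σ hφ hχ hσ hsum u hu
    simp only [hp, hs] at h1
    exact h1
  have hstar : ∀ φ : ℝ → ℂ, ∫ k, (bracket k)⁻¹ * k ^ 2 * ‖(Complex.I * (k : ℂ))⁻¹ * φ k‖ ^ 2 =
      ∫ k, wNegHalf k * ‖φ k‖ ^ 2 := fun φ => integral_antideriv fun k hk => by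
    show _ = (bracket k)⁻¹
    field_simp
  have hhalf : ∀ φ : ℝ → ℂ, ∫ k, bracket k * ‖(Complex.I * (k : ℂ))⁻¹ * φ k‖ ^ 2 =
      ∫ k, wStarNegHalf k * ‖φ k‖ ^ 2 := fun φ => integral_antideriv fun k hk => rfl
  have hle : ∀ q : Sob wStarNegHalf, ∀ φ : ℝ → ℂ, (∀ᵐ k : ℝ, (q : FreqFun) k = φ k) → IsTest φ →
      ∫ k, wNegHalf k * ‖φ k‖ ^ 2 ≤ ‖q‖ ^ 2 := fun q φ hq hφ => by
    rw [← norm_sq_of_ae hq]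
    refine integral_mono_ae (hφ.integrable_mul continuous_bracket_inv.continuousOn)
      (q.2.2.congr ?_) ?_
    · filter_upwards [hq] with k hk
      rw [hk]
    · filter_upwards [ae_ne_zero] with k hk
      exact mul_le_mul_of_nonneg_right (wNegHalf_le_wStarNegHalf k hk) (sq_nonneg _)
  have b1 : ‖PairSob.fst t‖ ≤ √(2 * C) * √D := by
    refine Sob.norm_le_of_dual dualWeights_star regular_wStarNegHalf _ (by positivity) ?_
    rintro q ⟨φ, hφ, hq⟩
    have e1 : dual q (PairSob.fst t) = ∫ x, u (x, η.1 x) * hφ.phys x :=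
      dual_eq_integral hφ hq hg1 ht1
    rw [e1]
    -- Data Q on the interface and 0 on the surface: the jump is -Q, so both norms of Q appear, each
    -- at most ‖q‖, which gives the factor 2.
    have h1 := H' _ _ _ hφ.antideriv (hφ.antideriv.const_mul (-1)) IsTest.zero (fun k => by simp)
      hφ.phys (fun _ => 0) hφ.antideriv_deriv_phys IsTest.zero_deriv_phys
    simp only [mul_zero, zero_sub] at h1
    rw [integral_neg, neg_sq, hstar] at h1
    have e2 : ∫ k, bracket k * ‖((-1 : ℝ) : ℂ) * ((Complex.I * (k : ℂ))⁻¹ * φ k)‖ ^ 2 = ‖q‖ ^ 2 := by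
      rw [← norm_sq_of_ae hq, ← hhalf]
      simp
    rw [e2] at h1
    have h2 := hle q φ hq hφ
    refine abs_le_of_sq_le_mul (by positivity) hD (norm_nonneg _) (h1.trans ?_)
    have := mul_le_mul_of_nonneg_left h2 (mul_nonneg hC hD)
    linarith
  have b2 : ‖PairSob.snd t‖ ≤ √C * √D := by
    refine Sob.norm_le_of_dual dualWeights_star regular_wStarNegHalf _ (by positivity) ?_
    rintro q ⟨φ, hφ, hq⟩
    have e1 : dual q (PairSob.snd t) = ∫ x, u (x, 1 + η.2 x) * hφ.phys x :=
      dual_eq_integral hφ hq hg2 ht2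
    rw [e1]
    have h1 := H' _ _ _ IsTest.zero hφ.antideriv hφ.antideriv (fun k => by simp)
      (fun _ => 0) hφ.phys IsTest.zero_deriv_phys hφ.antideriv_deriv_phys
    simp only [mul_zero, sub_zero] at h1
    rw [hhalf, norm_sq_of_ae hq] at h1
    refine abs_le_of_sq_le_mul hC hD (norm_nonneg _) (h1.trans (le_of_eq ?_))
    simp
  have b3 : ‖PairSob.comb t‖ ≤ √C * √D := by
    refine Sob.norm_le_of_dual dualWeights_half regular_wNegHalf _ (by positivity) ?_
    rintro q ⟨φ, hφ, hq⟩
    have e1 : dual q (PairSob.comb t) =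
        ∫ x, (u (x, 1 + η.2 x) * hφ.phys x - u (x, η.1 x) * hφ.phys x) := by
      have hF : IsFourier (PairSob.comb t : FreqFun) fun x => u (x, 1 + η.2 x) - u (x, η.1 x) := by
        have h1 : ∀ᵐ k : ℝ, (t.1.2 + (-1 : ℝ) • t.1.1 : FreqFun) k = t.1.2 k - t.1.1 k := by
          filter_upwards [AEEqFun.coeFn_add t.1.2 ((-1 : ℝ) • t.1.1),
            AEEqFun.coeFn_smul (-1 : ℝ) t.1.1] with k h1 h2
          rw [h1, Pi.add_apply, h2, Pi.smul_apply, neg_one_smul, sub_eq_add_neg]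
        filter_upwards [h1, ht1, ht2] with k h2 h3 h4
        refine h2.trans ?_
        rw [h3, h4, fourier, fourier, fourier, ← mul_sub, ← integral_sub (integrable_exp_mul hg2 k) (integrable_exp_mul hg1 k)]
        congr 2
        ext x
        push_cast
        ring
      rw [dual_eq_integral hφ hq (g := fun x => u (x, 1 + η.2 x) - u (x, η.1 x)) (hg2.sub hg1) hF]
      simp only [sub_mul]
    rw [e1]
    -- Equal data Q on both boundaries have no jump, so only the H_⋆^{1/2} norm of Q is needed, and
    -- q may range over H^{-1/2}.
    have h1 := H' _ _ _ hφ.antideriv IsTest.zero hφ.antideriv (fun k => by simp)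
      hφ.phys hφ.phys hφ.antideriv_deriv_phys hφ.antideriv_deriv_phys
    rw [hstar, norm_sq_of_ae hq] at h1
    refine abs_le_of_sq_le_mul hC hD (norm_nonneg _) (h1.trans (le_of_eq ?_))
    simp
  refine le_of_sq_le_sq ?_ (by positivity)
  have c1 := pow_le_pow_left₀ (norm_nonneg _) b1 2
  have c2 := pow_le_pow_left₀ (norm_nonneg _) b2 2
  have c3 := pow_le_pow_left₀ (norm_nonneg _) b3 2
  rw [mul_pow, Real.sq_sqrt (by positivity), Real.sq_sqrt hD] at c1 c2 c3 ⊢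
  rw [PairSob.norm_sq_eq]
  nlinarith [mul_nonneg hC hD]

end TwoLayer
end

/-! ### From trace relations to the Dirichlet–Neumann operators. -/

noncomputable section

namespace TwoLayer

open scoped ComplexConjugate ContDiff SchwartzMap FourierTransform LineDeriv

/-! ### Gradients in `L²` -/

section Gradient

variable {Ω : Set (ℝ × ℝ)} {u : ℝ × ℝ → ℝ}

theorem norm_grad_sq (u : ℝ × ℝ → ℝ) (p : ℝ × ℝ) : ‖grad u p‖ ^ 2 = gradSq u p := by
  rw [EuclideanSpace.norm_sq_eq, Fin.sum_univ_two]
  simp [grad, gradSq]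

theorem IsSchwartzOn.continuous_grad (hu : IsSchwartzOn Ω u) : Continuous (grad u) := by
  refine (PiLp.continuous_toLp 2 _).comp (continuous_pi fun i => ?_)
  fin_cases i
  · exact hu.continuous_fderiv_apply (1, 0)
  · exact hu.continuous_fderiv_apply (0, 1)

theorem IsSchwartzOn.memLp_grad (hu : IsSchwartzOn Ω u) (hΩ : MeasurableSet Ω) :
    MemLp (grad u) 2 (volume.restrict Ω) := by
  rw [memLp_two_iff_integrable_sq_norm hu.continuous_grad.aestronglyMeasurable]
  simp only [norm_grad_sq]
  exact hu.integrableOn_gradSq hΩ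

theorem norm_eq_of_ae_grad {g : L2Field Ω} (hg : g =ᵐ[volume.restrict Ω] grad u) :
    ‖g‖ = √(∫ p in Ω, gradSq u p) := by
  rw [← Real.sqrt_sq (norm_nonneg g), ← real_inner_self_eq_norm_sq, L2.inner_def]
  congr 1
  refine integral_congr_ae ?_
  filter_upwards [hg] with p hp
  rw [hp, real_inner_self_eq_norm_sq, norm_grad_sq]

theorem grad_add (hu : Differentiable ℝ u) {v : ℝ × ℝ → ℝ} (hv : Differentiable ℝ v) (p : ℝ × ℝ) :
    grad (u + v) p = grad u p + grad v p := by
  rw [grad, fderiv_add (hu p) (hv p)]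
  ext i
  fin_cases i <;> simp [grad]

theorem grad_const_smul (hu : Differentiable ℝ u) (c : ℝ) (p : ℝ × ℝ) :
    grad (c • u) p = c • grad u p := by
  rw [grad, fderiv_const_smul (hu p)]
  ext i
  fin_cases i <;> simp [grad]

end Gradient

/-! ### Abstract trace relations -/

section Trace

variable {Ω : Set (ℝ × ℝ)} {F F' : Type*} [NormedAddCommGroup F] [NormedSpace ℝ F]
  [NormedAddCommGroup F'] [NormedSpace ℝ F']

/-- A linear trace relation on the Schwartz class of `Ω`. -/
structure IsTraceRel (Ω : Set (ℝ × ℝ)) (tr : (ℝ × ℝ → ℝ) → F → Prop) : Prop where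
  zero : tr 0 0
  add : ∀ u v t s, IsSchwartzOn Ω u → IsSchwartzOn Ω v → tr u t → tr v s → tr (u + v) (t + s)
  smul : ∀ (c : ℝ) u t, IsSchwartzOn Ω u → tr u t → tr (c • u) (c • t)

variable {tr : (ℝ × ℝ → ℝ) → F → Prop}

theorem isSchwartzOn_zero : IsSchwartzOn Ω 0 := isSchwartzOn_schwartz 0 Ω

/-- The graph of a trace relation over gradients. -/
def traceGraph (h : IsTraceRel Ω tr) : Submodule ℝ (L2Field Ω × F) where
  carrier := {q | ∃ u, IsSchwartzOn Ω u ∧ q.1 =ᵐ[volume.restrict Ω] grad u ∧ tr u q.2}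
  zero_mem' := by
    refine ⟨0, isSchwartzOn_zero, ?_, h.zero⟩
    filter_upwards [Lp.coeFn_zero (EuclideanSpace ℝ (Fin 2)) 2 (volume.restrict Ω)] with p hp
    refine hp.trans ?_
    ext i
    fin_cases i <;> simp [grad]
  add_mem' := by
    rintro q q' ⟨u, hu, h1, h2⟩ ⟨v, hv, h3, h4⟩
    refine ⟨u + v, hu.add hv, ?_, h.add u v _ _ hu hv h2 h4⟩
    filter_upwards [Lp.coeFn_add q.1 q'.1, h1, h3] with p hp h5 h6
    rw [grad_add hu.differentiable hv.differentiable, ← h5, ← h6]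
    exact hp
  smul_mem' := by
    rintro c q ⟨u, hu, h1, h2⟩
    refine ⟨c • u, hu.const_smul c, ?_, h.smul c u _ hu h2⟩
    filter_upwards [Lp.coeFn_smul c q.1, h1] with p hp h5
    rw [grad_const_smul hu.differentiable, ← h5]
    exact hp

/-- The closure of a trace relation. -/
def HasTrace (Ω : Set (ℝ × ℝ)) (tr : (ℝ × ℝ → ℝ) → F → Prop) (g : L2Field Ω) (Φ : F) : Prop :=
  ∃ (u : ℕ → ℝ × ℝ → ℝ) (t : ℕ → F), (∀ n, IsSchwartzOn Ω (u n)) ∧ (∀ n, tr (u n) (t n)) ∧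
    GradTendsto Ω u g ∧ Tendsto t atTop (𝓝 Φ)

theorem gradTendsto_iff {u : ℕ → ℝ × ℝ → ℝ} {G : ℕ → L2Field Ω} {g : L2Field Ω}
    (hG : ∀ n, G n =ᵐ[volume.restrict Ω] grad (u n)) :
    GradTendsto Ω u g ↔ Tendsto G atTop (𝓝 g) := by
  rw [Lp.tendsto_Lp_iff_tendsto_eLpNorm', GradTendsto]
  have h1 : ∀ n, eLpNorm (fun p => grad (u n) p - g p) 2 (volume.restrict Ω) =
      eLpNorm (⇑(G n) - ⇑g) 2 (volume.restrict Ω) := fun n => by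
    refine eLpNorm_congr_ae ?_
    filter_upwards [hG n] with p hp
    rw [Pi.sub_apply, hp]
  simp only [h1]

/-- In a metric space the closure of the graph is described by sequences, so the trace relation is a
closed subspace and the Hilbert space lemmas apply to it. -/
theorem hasTrace_iff (h : IsTraceRel Ω tr) (hΩ : MeasurableSet Ω) (g : L2Field Ω) (Φ : F) :
    HasTrace Ω tr g Φ ↔ (g, Φ) ∈ (traceGraph h).topologicalClosure := by
  rw [← SetLike.mem_coe, Submodule.topologicalClosure_coe, mem_closure_iff_seq_limit]
  constructor
  · rintro ⟨u, t, hu, ht, hg, hΦ⟩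
    set G : ℕ → L2Field Ω := fun n => ((hu n).memLp_grad hΩ).toLp
    have hG : ∀ n, G n =ᵐ[volume.restrict Ω] grad (u n) := fun n => MemLp.coeFn_toLp _
    exact ⟨fun n => (G n, t n), fun n => ⟨u n, hu n, hG n, ht n⟩,
      ((gradTendsto_iff hG).1 hg).prodMk_nhds hΦ⟩
  · rintro ⟨q, hq, hlim⟩
    choose u hu hG ht using hq
    exact ⟨u, fun n => (q n).2, hu, ht, (gradTendsto_iff hG).2 ((continuous_fst.tendsto _).comp hlim),
      (continuous_snd.tendsto _).comp hlim⟩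

/-- Weak harmonicity with prescribed trace. -/
def IsHarmonicFor (Ω : Set (ℝ × ℝ)) (tr : (ℝ × ℝ → ℝ) → F → Prop) (Φ : F) (g : L2Field Ω) : Prop :=
  HasTrace Ω tr g Φ ∧ ∀ h, HasTrace Ω tr h 0 → inner ℝ g h = 0

theorem isHarmonicFor_iff (h : IsTraceRel Ω tr) (hΩ : MeasurableSet Ω) (Φ : F) (g : L2Field Ω) :
    IsHarmonicFor Ω tr Φ g ↔ IsHarmonicLift (traceGraph h).topologicalClosure Φ g := by
  simp only [IsHarmonicFor, IsHarmonicLift, hasTrace_iff h hΩ]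

/-- Existence, uniqueness and coercivity of the Dirichlet–Neumann operator of a trace relation. -/
theorem existsUnique_dirichletNeumann [CompleteSpace F] [CompleteSpace F'] (h : IsTraceRel Ω tr)
    (hΩ : MeasurableSet Ω) {C₁ C₂ : ℝ} (hC₂ : 0 < C₂)
    (h1 : ∀ u t, IsSchwartzOn Ω u → tr u t → ‖t‖ ≤ C₁ * √(∫ p in Ω, gradSq u p))
    {D : Submodule ℝ F} (hD : D.topologicalClosure = ⊤)
    (h2 : ∀ Φ ∈ D, ∃ u, IsSchwartzOn Ω u ∧ tr u Φ ∧ √(∫ p in Ω, gradSq u p) ≤ C₂ * ‖Φ‖)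
    (p : F' →L[ℝ] F →L[ℝ] ℝ) (hp : Function.Bijective p) :
    (∃! G : F →L[ℝ] F', (∀ Φ, ∃! g, IsHarmonicFor Ω tr Φ g) ∧
      ∀ Φ₁ Φ₂ g₁ g₂, IsHarmonicFor Ω tr Φ₁ g₁ → IsHarmonicFor Ω tr Φ₂ g₂ →
        p (G Φ₁) Φ₂ = inner ℝ g₁ g₂) ∧
    ∃ c : ℝ, 0 < c ∧ ∀ G : F →L[ℝ] F',
      (∀ Φ₁ Φ₂ g₁ g₂, IsHarmonicFor Ω tr Φ₁ g₁ → IsHarmonicFor Ω tr Φ₂ g₂ →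
        p (G Φ₁) Φ₂ = inner ℝ g₁ g₂) → ∀ Φ, c * ‖Φ‖ ^ 2 ≤ p (G Φ) Φ := by
  set T := (traceGraph h).topologicalClosure
  have hT : IsClosed (T : Set (L2Field Ω × F)) := (traceGraph h).isClosed_topologicalClosure
  -- The trace bound is a closed condition, so it passes from Schwartz functions to the closure of
  -- the graph.
  have h1' : ∀ g Φ, (g, Φ) ∈ T → ‖Φ‖ ≤ C₁ * ‖g‖ := by
    intro g Φ hgΦ
    have hcl : IsClosed {q : L2Field Ω × F | ‖q.2‖ ≤ C₁ * ‖q.1‖} :=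
      isClosed_le (by fun_prop) (by fun_prop)
    have hsub : (traceGraph h : Set (L2Field Ω × F)) ⊆ {q | ‖q.2‖ ≤ C₁ * ‖q.1‖} := by
      rintro q ⟨u, hu, hg, ht⟩
      show ‖q.2‖ ≤ C₁ * ‖q.1‖
      rw [norm_eq_of_ae_grad hg]
      exact h1 u q.2 hu ht
    exact closure_minimal hsub hcl hgΦ
  have h2' : ∀ Φ ∈ D, ∃ g, (g, Φ) ∈ T ∧ ‖g‖ ≤ C₂ * ‖Φ‖ := by
    intro Φ hΦ
    obtain ⟨u, hu, ht, hb⟩ := h2 Φ hΦ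
    have hg : (hu.memLp_grad hΩ).toLp =ᵐ[volume.restrict Ω] grad u := MemLp.coeFn_toLp _
    refine ⟨(hu.memLp_grad hΩ).toLp, (traceGraph h).le_topologicalClosure ⟨u, hu, hg, ht⟩, ?_⟩
    rw [norm_eq_of_ae_grad hg]
    exact hb
  obtain ⟨H, hH, c, hc, hcoer⟩ := harmonicLift_of_dense hT hC₂ h1' hD h2'
  obtain ⟨G, hG⟩ := exists_dirichletOperator p hp H
  have hiff := fun Φ g => isHarmonicFor_iff h hΩ Φ g
  have hHh : ∀ Φ, IsHarmonicFor Ω tr Φ (H Φ) := fun Φ => (hiff Φ _).2 (hH Φ)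
  have huniq : ∀ Φ g, IsHarmonicFor Ω tr Φ g → g = H Φ := fun Φ g hg =>
    ((hiff Φ g).1 hg).unique (hH Φ)
  refine ⟨⟨G, ⟨fun Φ => ⟨H Φ, hHh Φ, huniq Φ⟩, fun Φ₁ Φ₂ g₁ g₂ k1 k2 => ?_⟩, ?_⟩, c, hc, ?_⟩
  · rw [huniq _ _ k1, huniq _ _ k2, hG]
  · rintro G' ⟨-, hG'⟩
    ext Φ : 1
    refine hp.1 ?_
    ext Φ'
    rw [hG, hG' Φ Φ' _ _ (hHh Φ) (hHh Φ')]
  · intro G' hG' Φ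
    rw [hG' Φ Φ _ _ (hHh Φ) (hHh Φ)]
    exact hcoer Φ

end Trace

/-! ### The Fourier transform of traces -/

theorem isFourier_zero : IsFourier 0 (fun _ => 0) := by
  filter_upwards [AEEqFun.coeFn_zero (α := ℝ) (β := ℂ) (μ := volume)] with k hk
  rw [hk]
  simp [fourier]

theorem IsFourier.add {t s : FreqFun} {f g : ℝ → ℝ} (ht : IsFourier t f) (hs : IsFourier s g)
    (hf : Integrable f) (hg : Integrable g) : IsFourier (t + s) (fun x => f x + g x) := by
  filter_upwards [AEEqFun.coeFn_add t s, ht, hs] with k h1 h2 h3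
  rw [h1, Pi.add_apply, h2, h3, fourier, fourier, fourier, ← mul_add,
    ← integral_add (integrable_exp_mul hf k) (integrable_exp_mul hg k)]
  simp only [Complex.ofReal_add, mul_add]

theorem IsFourier.smul {t : FreqFun} {f : ℝ → ℝ} (ht : IsFourier t f) (c : ℝ) :
    IsFourier (c • t) (fun x => c * f x) := by
  filter_upwards [AEEqFun.coeFn_smul c t, ht] with k h1 h2
  rw [h1, Pi.smul_apply, h2, fourier, fourier, Complex.real_smul, mul_left_comm,
    ← integral_const_mul]
  congr 2
  ext x
  push_cast
  ring

theorem IsTest.isFourier {φ : ℝ → ℂ} (hφ : IsTest φ) {t : FreqFun} (ht : ∀ᵐ k : ℝ, t k = φ k)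
    {g : ℝ → ℝ} (hg : ∀ x, g x = hφ.phys x) : IsFourier t g := by
  have h1 : g = hφ.phys := funext hg
  filter_upwards [ht] with k hk
  rw [hk, h1, hφ.fourier_phys]

theorem sqrt_le_of_le_mul_sq {a C b : ℝ} (hC : 0 ≤ C) (hb : 0 ≤ b) (h : a ≤ C * b ^ 2) :
    √a ≤ (√C + 1) * b := by
  refine (Real.sqrt_le_sqrt h).trans ?_
  rw [Real.sqrt_mul hC, Real.sqrt_sq hb]
  nlinarith

/-! ### The Dirichlet–Neumann operators -/

/-- The abstract coercivity holds for every operator representing the Dirichlet form, hence for the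
one selected in `lowerG`. -/
theorem lowerDNO {η : (ℝ → ℝ) × (ℝ → ℝ)} (hη : IsW1Inf η.1) :
    (∃! G, IsLowerDNO η.1 G) ∧
      ∃ c : ℝ, 0 < c ∧ ∀ Φ, c * ‖Φ‖ ^ 2 ≤ dual (lowerG η Φ) Φ := by
  have hc := hη.continuous
  obtain ⟨C₁, -, H₁⟩ := lower_trace_le hη
  obtain ⟨C₂, hC₂, H₂⟩ := exists_lower_lift hη
  set Ω := lowerDomain η.1
  have hΩ : MeasurableSet Ω := (isOpen_lowerDomain hc).measurableSet
  set tr : (ℝ × ℝ → ℝ) → DotHalf → Prop := fun u t => IsFourier t (fun x => u (x, η.1 x))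
  have hint : ∀ u, IsSchwartzOn Ω u → Integrable fun x => u (x, η.1 x) := fun u hu =>
    hu.integrable_trace hc (mem_closure_lowerDomain η.1)
  have htr : IsTraceRel Ω tr :=
    ⟨isFourier_zero, fun u v t s hu hv ht hs => ht.add hs (hint u hu) (hint v hv),
      fun c u t hu ht => ht.smul c⟩
  obtain ⟨hex, c, hcpos, hcoer⟩ := existsUnique_dirichletNeumann htr hΩ
    (by positivity : 0 < √C₂ + 1) H₁ (testSub_dense regular_wDotHalf) (by
      rintro Φ ⟨φ, hφ, hΦ⟩
      obtain ⟨ψ, ε, hε, h1, h2⟩ := H₂ φ hφ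
      refine ⟨ψ, isSchwartzOn_schwartz ψ Ω, hφ.isFourier hΦ fun x => h1 x _ (by simpa using hε.le), ?_⟩
      refine sqrt_le_of_le_mul_sq hC₂ (norm_nonneg _) ?_
      rw [← norm_sq_of_ae hΦ]
      exact (setIntegral_le_integral (integrable_gradSq ψ)
        (Eventually.of_forall (gradSq_nonneg ψ))).trans h2)
    (dualL dualWeights_dot) ⟨dualL_injective _, dualL_surjective _⟩
  simp only [dualL_apply] at hex hcoer
  have hex' : ∃! G, IsLowerDNO η.1 G := hex
  exact ⟨hex', c, hcpos, hcoer _ (theOperator_spec hex'.exists).2⟩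

theorem upperDNO {h₀ : ℝ} (hh₀ : 0 < h₀) {η : (ℝ → ℝ) × (ℝ → ℝ)} (hη : η ∈ ClassW h₀) :
    (∃! G, IsUpperDNO η G) ∧
      ∃ c : ℝ, 0 < c ∧ ∀ Φ, c * ‖Φ‖ ^ 2 ≤ dualPair (upperG η Φ) Φ := by
  have hc1 := hη.1.continuous
  have hc2 := hη.2.1.one_add.continuous
  have hlt : ∀ x, η.1 x < 1 + η.2 x := fun x => by linarith [depth_lt hη x]
  obtain ⟨C₁, -, H₁⟩ := upper_trace_le hh₀ hη
  obtain ⟨C₂, hC₂, H₂⟩ := exists_upper_lift hh₀ hη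
  set Ω := upperDomain η
  have hΩ : MeasurableSet Ω := (isOpen_upperDomain hc1 hη.2.1.continuous).measurableSet
  set tr : (ℝ × ℝ → ℝ) → SpX → Prop := fun u t =>
    IsFourier t.1.1 (fun x => u (x, η.1 x)) ∧ IsFourier t.1.2 (fun x => u (x, 1 + η.2 x))
  have hint1 : ∀ u, IsSchwartzOn Ω u → Integrable fun x => u (x, η.1 x) := fun u hu =>
    hu.integrable_trace hc1 fun x => mem_closure_upperDomain_fst (hlt x)
  have hint2 : ∀ u, IsSchwartzOn Ω u → Integrable fun x => u (x, 1 + η.2 x) := fun u hu =>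
    hu.integrable_trace hc2 fun x => mem_closure_upperDomain_snd (hlt x)
  have htr : IsTraceRel Ω tr :=
    ⟨⟨isFourier_zero, isFourier_zero⟩,
      fun u v t s hu hv ht hs => ⟨ht.1.add hs.1 (hint1 u hu) (hint1 v hv),
        ht.2.add hs.2 (hint2 u hu) (hint2 v hv)⟩,
      fun c u t hu ht => ⟨ht.1.smul c, ht.2.smul c⟩⟩
  set e : SpX ≃L[ℝ] StarHalf × HHalf := PairSob.equivProd wStarHalf_le_wHalf
  -- The dense set of data: test functions in the independent coordinates Φ₁ ∈ H_⋆^{1/2} and Φ₂ - Φ₁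
  -- ∈ H^{1/2}, the φ and χ of the lift.
  set D : Submodule ℝ SpX :=
    ((testSub wStarHalf).prod (testSub wHalf)).comap (e : SpX →L[ℝ] StarHalf × HHalf).toLinearMap
  have hD : D.topologicalClosure = ⊤ := by
    rw [← Submodule.dense_iff_topologicalClosure_eq_top]
    exact ((testSub_denseSet regular_wStarHalf).prod (testSub_denseSet regular_wHalf)).preimage
      e.toHomeomorph.isOpenMap
  obtain ⟨hex, c, hcpos, hcoer⟩ := existsUnique_dirichletNeumann htr hΩ
    (by positivity : 0 < √C₂ + 1) (fun u t hu ht => H₁ u t hu ht.1 ht.2) hD (by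
      rintro Φ ⟨⟨φ, hφ, hφΦ⟩, χ, hχ, hχΦ⟩
      have k1 : ∀ᵐ k : ℝ, (PairSob.fst Φ : FreqFun) k = φ k := hφΦ
      have k2 : ∀ᵐ k : ℝ, (PairSob.comb Φ : FreqFun) k = χ k := hχΦ
      have k3 : ∀ᵐ k : ℝ, Φ.1.2 k = φ k + χ k := by
        have h1 : Φ.1.2 = Φ.1.1 + (Φ.1.2 + (-1 : ℝ) • Φ.1.1) := by
          rw [negOne_smul]
          abel
        filter_upwards [k1, k2, AEEqFun.coeFn_add Φ.1.1 (Φ.1.2 + (-1 : ℝ) • Φ.1.1)] with k a1 a2 a3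
        rw [h1, a3, Pi.add_apply]
        exact congrArg₂ (· + ·) a1 a2
      obtain ⟨ψ, ε, hε, h1, h1', h2⟩ := H₂ φ χ _ hφ hχ (hφ.add hχ) fun _ => rfl
      refine ⟨ψ, isSchwartzOn_schwartz ψ Ω, ⟨hφ.isFourier k1 fun x => h1 x _ (by simpa using hε.le),
        (hφ.add hχ).isFourier k3 fun x => h1' x _ (by simpa using hε.le)⟩, ?_⟩
      refine sqrt_le_of_le_mul_sq hC₂ (norm_nonneg _) (h2.trans ?_)
      refine mul_le_mul_of_nonneg_left ?_ hC₂
      have n1 : ∫ k, (bracket k)⁻¹ * k ^ 2 * ‖φ k‖ ^ 2 = ‖PairSob.fst Φ‖ ^ 2 := norm_sq_of_ae k1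
      have n2 : ∫ k, bracket k * ‖χ k‖ ^ 2 = ‖PairSob.comb Φ‖ ^ 2 := norm_sq_of_ae k2
      rw [n1, n2, PairSob.norm_sq_eq]
      linarith [sq_nonneg ‖PairSob.snd Φ‖])
    pairYX pairYX_bijective
  simp only [pairYX, dualPairL_apply] at hex hcoer
  have hex' : ∃! G, IsUpperDNO η G := hex
  exact ⟨hex', c, hcpos, hcoer _ (theOperator_spec hex'.exists).2⟩

end TwoLayer
end

theorem mainTheorem9 (ρ h₀ : ℝ) (hρ : 0 < ρ ∧ ρ < 1) (hh₀ : 0 < h₀ ∧ h₀ < 1)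
    (η : (ℝ → ℝ) × (ℝ → ℝ)) (hη : η ∈ TwoLayer.ClassW h₀) :
    -- the operators entering the definitions of `G`, `N`, `K` exist and are unique,
    -- and the inverses used are genuine
    (∃! G, TwoLayer.IsLowerDNO η.1 G) ∧ (∃! G, TwoLayer.IsUpperDNO η G) ∧
    (TwoLayer.lowerG η).IsInvertible ∧ (TwoLayer.upperG η).IsInvertible ∧
    (TwoLayer.opB η ρ).IsInvertible ∧
    (∃! G, TwoLayer.IsCombinedDNO η ρ G) ∧
    -- `G(η)` is invertible with inverse `N(η)`
    (TwoLayer.combinedG η ρ).IsInvertible ∧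
    (TwoLayer.combinedG η ρ).inverse = TwoLayer.combinedN η ρ ∧
    -- `K(η)` is a coercive isomorphism
    (TwoLayer.opK η ρ).IsInvertible ∧
    ∃ c : ℝ, 0 < c ∧ ∀ ξ : TwoLayer.SpXb,
      c * ‖ξ‖ ^ 2 ≤ TwoLayer.dualPair (TwoLayer.opK η ρ ξ) ξ :=
  let ⟨hL, _, hcL, hA⟩ := TwoLayer.lowerDNO hη.1
  let ⟨hU, _, hcU, hB⟩ := TwoLayer.upperDNO hh₀.1 hη
  ⟨hL, hU, TwoLayer.interface_operators hρ.1 hcL hcU hA hB⟩
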